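/- **Setting.** Let $S$ be a $k$-solenoid of class $C^{r,s}$ with $r\ge 1$, i.e. a compact Hausdorff space with an atlas of flow-boxes $\varphi:U\to D^k\times K(U)$ (homeomorphisms from open sets $U\subset S$, $D^k\subset\mathbb R^k$ the open unit ball, $K(U)\subset\mathbb R^l$) whose changes of charts have locally the form $(x,y)\mapsto (X(x,y),Y(y))$ with $X$ of class $C^{r,s}$ and $Y$ of class $C^s$. The *leaf topology* on $S$ is the one whose connected components are the leaves, which are $k$-dimensional manifolds; connected components, closures, interiors and boundaries below are taken in the leaf topology. Let $S$ be endowed with a Riemannian metric on the leaves which is continuous in flow-boxes; $\operatorname{Vol}_k$ is the Riemannian volume on the leaves. An *exhaustion* of a leaf $\ell$ is an increasing sequence of compact $k$-dimensional $C^r$ submanifolds with boundary $\hat U_n\subset \ell$ whose interiors cover $\ell$. A *Riemann exhaustion* of $\ell$ is an increasing sequence of closed Riemannian balls $U_n=\bar B(x_0,R_n)$ of $\ell$ with $x_0\in\ell$, $R_n\to+\infty$. Two sequences $(U_n)$, $(\hat U_n)$ are *equivalent* if $$\frac{\operatorname{Vol}_k(U_n\setminus\hat U_n)+\operatorname{Vol}_k(\hat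 U_n\setminus U_n)}{\operatorname{Vol}_k(U_n)}\to 0 .$$ The solenoid $S$ is *controlled* by an open set $V\subset S$ if for every Riemann exhaustion $(U_n)$ of every leaf there is an equivalent exhaustion $(\hat U_n)$ of that leaf with $\partial\hat U_n\subset V$ for all $n$. A *trapping region* is an open set $W\subset S$ for which there are a continuous map $\pi:S\to\mathbb T=\mathbb R/\mathbb Z$, a number $0<\epsilon_0<1/2$ and a set $T\subset S$ such that: 1. $W=\pi^{-1}((-\epsilon_0,\epsilon_0))$; 2. $T\subset\pi^{-1}(\{0\})$ is a global transversal, i.e. a finite union of transversals $\varphi^{-1}(\{a\}\times K(U))$ of flow-boxes that meets every leaf; 3. each connected component of $\pi^{-1}(\{0\})$ meets $T$ in exactly one point; 4. $\pi$ is of class $C^{r,s}$ in a neighbourhood of $\pi^{-1}(\{0\})$ and its leafwise differential is surjective at each point of $\pi^{-1}(\{0\})$; 5. for each connected component $L$ of $\pi^{-1}(\mathbb T\setminus\{0\})$ there are $x,y$ (possibly equal) with $\overline L\cap T=\{x,y\}$, where $x$ is the only point of $T$ in the closure of $L\cap\pi^{-1}((-\epsilon_0,0))$ and $y$ is the only point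 of $T$ in the closure of $L\cap\pi^{-1}((0,\epsilon_0))$. We then say that $L$ *goes from $x$ to $y$*; the closures $\overline L$ are called *fundamental pieces*. **Theorem.** If $W$ is a trapping region of $S$, then $S$ is controlled by $W$. More precisely, for every choice of $\pi,T,\epsilon_0$ as above and every Riemann exhaustion $(U_n)$ of a leaf $\ell$, there are points $x_j\in T$ and components $L_j$ of $\pi^{-1}(\mathbb T\setminus\{0\})$ going from $x_j$ to $x_{j+1}$ $(j\in\mathbb Z)$ with $\ell=\bigcup_{j\in\mathbb Z}\overline{L_j}$, and integers $a_n<b_n$, such that the unions of consecutive fundamental pieces $$\hat U_n=\bigcup_{j=a_n}^{b_n-1}\overline{L_j}$$ form an exhaustion of $\ell$ that is equivalent to $(U_n)$ and satisfies $\partial\hat U_n\subset W$ for all $n$. -/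

import Mathlib

open Set Filter Topology MeasureTheory
open scoped ENNReal

noncomputable section

/-- Euclidean space `ℝⁿ`. -/
abbrev Euc (n : ℕ) : Type := EuclideanSpace ℝ (Fin n)

/-- The `k`-dimensional open ball `D^k`. -/
abbrev openDisk (k : ℕ) : Set (Euc k) := Metric.ball 0 1

/-- `f(x, y)` is of class `C^{r,s}` on the (open) set `O`: it is `C^r` in `x`, each `x`-derivative
of order `≤ r` is `C^s` in `y`, and all these mixed derivatives are jointly continuous. -/
def IsClassCrs {k l : ℕ} {F : Type*} [NormedAddCommGroup F] [NormedSpace ℝ F]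
    (r s : WithTop ℕ∞) (f : Euc k × Euc l → F) (O : Set (Euc k × Euc l)) : Prop :=
  (∀ z ∈ O, ContDiffAt ℝ r (fun x => f (x, z.2)) z.1) ∧
  (∀ i : ℕ, (i : WithTop ℕ∞) ≤ r → ∀ z ∈ O,
    ContDiffAt ℝ s (fun y => iteratedFDeriv ℝ i (fun x => f (x, y)) z.1) z.2) ∧
  (∀ i j : ℕ, (i : WithTop ℕ∞) ≤ r → (j : WithTop ℕ∞) ≤ s →
    ContinuousOn (fun z : Euc k × Euc l =>
      iteratedFDeriv ℝ j (fun y => iteratedFDeriv ℝ i (fun x => f (x, y)) z.1) z.2) O)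

/-- A flow-box `φ : U → D^k × K` with `U ⊆ S` open and `K ⊆ ℝ^l` an arbitrary subset:
a homeomorphism from `U` (the `source`) onto `D^k × K` (the `target`). -/
structure FlowBox (k l : ℕ) (S : Type*) [TopologicalSpace S] extends
    PartialEquiv S (Euc k × Euc l) where
  /-- the transversal set of the flow-box -/
  K : Set (Euc l)
  target_eq : target = openDisk k ×ˢ K
  open_source : IsOpen source
  continuousOn_toFun : ContinuousOn toFun source
  continuousOn_invFun : ContinuousOn invFun target

/-- The change of charts `ψ ∘ φ⁻¹` is locally of the form `(x, y) ↦ (X(x, y), Y(y))` with `X` of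
class `C^{r,s}` and `Y` of class `C^s`; since `K` is an arbitrary subset of `ℝ^l`, regularity is
that of local extensions to open sets of `ℝ^k × ℝ^l`. -/
def FlowBox.ChangeOfCharts {k l : ℕ} {S : Type*} [TopologicalSpace S] (r s : WithTop ℕ∞)
    (φ ψ : FlowBox k l S) : Prop :=
  ∀ p ∈ φ.source ∩ ψ.source, ∃ (A : Set (Euc k)) (B : Set (Euc l))
    (X : Euc k × Euc l → Euc k) (Y : Euc l → Euc l),
    IsOpen A ∧ IsOpen B ∧ φ.toPartialEquiv p ∈ A ×ˢ B ∧
    IsClassCrs r s X (A ×ˢ B) ∧ ContDiffOn ℝ s Y B ∧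
    ∀ z ∈ (A ×ˢ B) ∩ φ.target, φ.toPartialEquiv.symm z ∈ ψ.source →
      ψ.toPartialEquiv (φ.toPartialEquiv.symm z) = (X z, Y z.2)

/-- The structure of a `k`-solenoid of class `C^{r,s}` on `S` (to be used on a compact Hausdorff
space): an atlas of flow-boxes with changes of charts of class `C^{r,s}`. -/
structure Solenoid (k l : ℕ) (r s : WithTop ℕ∞) (S : Type*) [TopologicalSpace S] where
  atlas : Set (FlowBox k l S)
  cover : ∀ p : S, ∃ φ ∈ atlas, p ∈ φ.source
  compatible : ∀ φ ∈ atlas, ∀ ψ ∈ atlas, φ.ChangeOfCharts r s ψ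

namespace Solenoid

variable {k l : ℕ} {r s : WithTop ℕ∞} {S : Type*} [TopologicalSpace S]

/-- A flow-box of the solenoid: one that is compatible with the atlas. -/
def IsFlowBox (𝒮 : Solenoid k l r s S) (φ : FlowBox k l S) : Prop :=
  ∀ ψ ∈ 𝒮.atlas, φ.ChangeOfCharts r s ψ ∧ ψ.ChangeOfCharts r s φ

/-- A flow-box of the atlas around a given point. -/
def boxAt (𝒮 : Solenoid k l r s S) (p : S) : FlowBox k l S := (𝒮.cover p).choose

/-! ### Leaves -/

/-- The leaf topology on `S`: the finest topology for which all the inclusions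
`D^k × {y} → S` of the local leaves are continuous. -/
@[reducible] def leafTopology (𝒮 : Solenoid k l r s S) : TopologicalSpace S where
  IsOpen A := ∀ φ ∈ 𝒮.atlas, ∀ y ∈ φ.K,
    IsOpen {x : Euc k | x ∈ openDisk k ∧ φ.toPartialEquiv.symm (x, y) ∈ A}
  isOpen_univ := by
    intro φ _ y _
    have h : {x : Euc k | x ∈ openDisk k ∧ φ.toPartialEquiv.symm (x, y) ∈ (univ : Set S)} =
        openDisk k := by
      ext x
      exact and_iff_left (mem_univ _)
    rw [h]
    exact Metric.isOpen_ball
  isOpen_inter := by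
    intro A B hA hB φ hφ y hy
    have h := (hA φ hφ y hy).inter (hB φ hφ y hy)
    convert h using 1
    ext x
    simp only [mem_ofPred_eq, mem_inter_iff]
    tauto
  isOpen_sUnion := by
    intro C hC φ hφ y hy
    have h : {x : Euc k | x ∈ openDisk k ∧ φ.toPartialEquiv.symm (x, y) ∈ ⋃₀ C} =
        ⋃ A ∈ C, {x : Euc k | x ∈ openDisk k ∧ φ.toPartialEquiv.symm (x, y) ∈ A} := by
      ext x
      simp only [mem_ofPred_eq, mem_sUnion, mem_iUnion, exists_prop]
      tauto
    rw [h]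
    exact isOpen_biUnion fun A hA => hC A hA φ hφ y hy

/-- The leaf through `p`: its connected component for the leaf topology. -/
def leaf (𝒮 : Solenoid k l r s S) (p : S) : Set S :=
  @connectedComponent S 𝒮.leafTopology p

/-- Closure in the leaf topology. -/
def leafClosure (𝒮 : Solenoid k l r s S) (A : Set S) : Set S := @closure S 𝒮.leafTopology A

/-- Interior in the leaf topology. -/
def leafInterior (𝒮 : Solenoid k l r s S) (A : Set S) : Set S := @interior S 𝒮.leafTopology A

/-- Boundary in the leaf topology. -/
def leafBoundary (𝒮 : Solenoid k l r s S) (A : Set S) : Set S := @frontier S 𝒮.leafTopology A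

/-- The connected component through `p` of the set `A`, for the leaf topology. -/
def leafComponentIn (𝒮 : Solenoid k l r s S) (A : Set S) (p : S) : Set S :=
  @connectedComponentIn S 𝒮.leafTopology A p

/-- A transversal: a finite union of transversals `φ⁻¹({a} × K(U))` of flow-boxes. -/
def IsTransversal (𝒮 : Solenoid k l r s S) (T : Set S) : Prop :=
  ∃ F : Set (FlowBox k l S × Euc k), F.Finite ∧
    (∀ c ∈ F, 𝒮.IsFlowBox c.1 ∧ c.2 ∈ openDisk k) ∧
    T = ⋃ c ∈ F, c.1.toPartialEquiv.symm '' ({c.2} ×ˢ c.1.K)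

/-- A global transversal: a transversal that meets every leaf. -/
def IsGlobalTransversal (𝒮 : Solenoid k l r s S) (T : Set S) : Prop :=
  𝒮.IsTransversal T ∧ ∀ p : S, (T ∩ 𝒮.leaf p).Nonempty

/-! ### Riemannian structure: length, distance, volume -/

/-- A Riemannian structure: an inner product on the tangent space of the leaf at each point,
given in flow-boxes of the atlas, compatible with the changes of charts, and continuous on `S`. -/
structure Metric (𝒮 : Solenoid k l r s S) where
  g : FlowBox k l S → S → Euc k →L[ℝ] Euc k →L[ℝ] ℝ
  symm : ∀ φ ∈ 𝒮.atlas, ∀ p ∈ φ.source, ∀ v w, g φ p v w = g φ p w v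
  pos : ∀ φ ∈ 𝒮.atlas, ∀ p ∈ φ.source, ∀ v, v ≠ 0 → 0 < g φ p v v
  continuousOn : ∀ φ ∈ 𝒮.atlas, ContinuousOn (g φ) φ.source
  compatible : ∀ φ ∈ 𝒮.atlas, ∀ ψ ∈ 𝒮.atlas, ∀ p ∈ φ.source ∩ ψ.source, ∀ v w,
    let D : Euc k →L[ℝ] Euc k :=
      fderiv ℝ (fun x => (ψ.toPartialEquiv
        (φ.toPartialEquiv.symm (x, (φ.toPartialEquiv p).2))).1) (φ.toPartialEquiv p).1
    g φ p v w = g ψ p (D v) (D w)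

/-- `γ : [0,1] → S` is a `C¹` path inside a leaf. -/
def IsC1Path (𝒮 : Solenoid k l r s S) (γ : ℝ → S) : Prop :=
  ∀ t ∈ Icc (0 : ℝ) 1, ∀ φ ∈ 𝒮.atlas, γ t ∈ φ.source →
    (∀ᶠ τ in 𝓝[Icc (0 : ℝ) 1] t, γ τ ∈ φ.source ∧
      (φ.toPartialEquiv (γ τ)).2 = (φ.toPartialEquiv (γ t)).2) ∧
    ContDiffWithinAt ℝ 1 (fun τ => (φ.toPartialEquiv (γ τ)).1) (Icc (0 : ℝ) 1) t

variable {𝒮 : Solenoid k l r s S}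

/-- The length of a `C¹` path (the speed at time `t` is computed in some flow-box around `γ t`). -/
def Metric.length (g : 𝒮.Metric) (γ : ℝ → S) : ℝ≥0∞ :=
  ∫⁻ t in Icc (0 : ℝ) 1,
    let φ := 𝒮.boxAt (γ t)
    let v : Euc k := derivWithin (fun τ => (φ.toPartialEquiv (γ τ)).1) (Icc (0 : ℝ) 1) t
    ENNReal.ofReal (Real.sqrt (g.g φ (γ t) v v))

/-- `g.PathLength p q L`: there is a piecewise `C¹` path inside a leaf (a finite concatenation of
`C¹` paths) from `p` to `q`, of total length `L`. -/
inductive Metric.PathLength (g : 𝒮.Metric) : S → S → ℝ≥0∞ → Prop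
  | refl (p : S) : Metric.PathLength g p p 0
  | append {p : S} {L : ℝ≥0∞} (γ : ℝ → S) (h : Metric.PathLength g p (γ 0) L)
      (hγ : 𝒮.IsC1Path γ) : Metric.PathLength g p (γ 1) (L + g.length γ)

/-- The Riemannian distance of the leaves (it is `∞` between distinct leaves). -/
def Metric.leafDist (g : 𝒮.Metric) (p q : S) : ℝ≥0∞ :=
  ⨅ (L : ℝ≥0∞) (_ : g.PathLength p q L), L

/-- The closed Riemannian ball in the leaf of `p`, with center `p` and radius `R ≥ 0`. -/
def Metric.closedBall (g : 𝒮.Metric) (p : S) (R : ℝ) : Set S :=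
  {q | g.leafDist p q ≤ ENNReal.ofReal R}

/-- The Riemannian volume, in the flow-box `φ`, of the part of `A` in the local leaf
`D^k × {y}`: the integral of `√(det g)`. -/
def Metric.plaqueVolume (g : 𝒮.Metric) (φ : FlowBox k l S) (y : Euc l) (A : Set S) : ℝ≥0∞ :=
  ∫⁻ x in {x : Euc k | x ∈ openDisk k ∧ φ.toPartialEquiv.symm (x, y) ∈ A},
    ENNReal.ofReal (Real.sqrt (Matrix.of fun i j : Fin k =>
      g.g φ (φ.toPartialEquiv.symm (x, y))
        (EuclideanSpace.single i 1) (EuclideanSpace.single j 1)).det)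

/-- The `k`-dimensional Riemannian volume `Vol_k` of the leaves, as an outer measure: the largest
one that is bounded by `plaqueVolume` on subsets of local leaves, i.e. the infimum of the sums of
volumes over countable covers by subsets of local leaves. -/
def Metric.vol (g : 𝒮.Metric) : OuterMeasure S :=
  OuterMeasure.boundedBy fun A =>
    ⨅ (φ ∈ 𝒮.atlas) (y ∈ φ.K)
      (_ : A ⊆ φ.toPartialEquiv.symm '' (openDisk k ×ˢ {y})), g.plaqueVolume φ y A

/-! ### Exhaustions -/

variable (𝒮) in
/-- `A` is a compact `k`-dimensional submanifold with boundary, of class `C^r`, of a leaf (or of a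
finite union of leaves): near each boundary point it is `{h ≤ 0}` with `h` of class `C^r` and
`dh ≠ 0`. -/
def IsCompactDomain (A : Set S) : Prop :=
  @IsCompact S 𝒮.leafTopology A ∧
  ∀ p ∈ 𝒮.leafBoundary A, ∃ φ ∈ 𝒮.atlas, p ∈ φ.source ∧
    ∃ (V : Set (Euc k)) (h : Euc k → ℝ), IsOpen V ∧ V ⊆ openDisk k ∧
      (φ.toPartialEquiv p).1 ∈ V ∧ ContDiffOn ℝ r h V ∧
      fderiv ℝ h (φ.toPartialEquiv p).1 ≠ 0 ∧
      ∀ x ∈ V, (φ.toPartialEquiv.symm (x, (φ.toPartialEquiv p).2) ∈ A ↔ h x ≤ 0)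

variable (𝒮) in
/-- `(U n)` is an exhaustion of the leaf `ℓ` by compact submanifolds with boundary. -/
def IsExhaustion (ℓ : Set S) (U : ℕ → Set S) : Prop :=
  (∀ n, U n ⊆ ℓ ∧ 𝒮.IsCompactDomain (U n)) ∧ Monotone U ∧ ℓ ⊆ ⋃ n, 𝒮.leafInterior (U n)

/-- `(U n)` is a Riemann exhaustion of the leaf `ℓ`: an increasing sequence of closed Riemannian
balls `B̄(x₀, R n)` with a fixed center `x₀ ∈ ℓ` and `R n → ∞` (no smoothness of the boundaries of
the balls is required). -/
def Metric.IsRiemannExhaustion (g : 𝒮.Metric) (ℓ : Set S) (U : ℕ → Set S) : Prop :=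
  Monotone U ∧ ∃ x₀ ∈ ℓ, ∃ R : ℕ → ℝ, (∀ n, 0 ≤ R n) ∧ Tendsto R atTop atTop ∧
    ∀ n, U n = g.closedBall x₀ (R n)

/-- Equivalence of exhaustions. -/
def Metric.EquivalentExhaustions (g : 𝒮.Metric) (U U' : ℕ → Set S) : Prop :=
  Tendsto (fun n => (g.vol (U n \ U' n) + g.vol (U' n \ U n)) / g.vol (U n)) atTop (𝓝 0)

/-- The solenoid is controlled by the open set `V`. -/
def Metric.IsControlledBy (g : 𝒮.Metric) (V : Set S) : Prop :=
  IsOpen V ∧ ∀ (p : S) (U : ℕ → Set S), g.IsRiemannExhaustion (𝒮.leaf p) U →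
    ∃ U' : ℕ → Set S, 𝒮.IsExhaustion (𝒮.leaf p) U' ∧ g.EquivalentExhaustions U U' ∧
      ∀ n, 𝒮.leafBoundary (U' n) ⊆ V

/-! ### Trapping regions -/

/-- The arc of `𝕋 = ℝ/ℤ` that is the image of the real interval `(a, b)`. -/
def arc (a b : ℝ) : Set UnitAddCircle := (fun t : ℝ => (t : UnitAddCircle)) '' Ioo a b

variable (𝒮) in
/-- `L` is a connected component (in a leaf) of `π⁻¹(𝕋 - {0})`. -/
def IsPiece (π : S → UnitAddCircle) (L : Set S) : Prop :=
  ∃ q, π q ≠ 0 ∧ L = 𝒮.leafComponentIn (π ⁻¹' {0}ᶜ) q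

variable (𝒮) in
/-- The closure of `L` (in its leaf) meets `T` exactly in `x` and `y`, where `x` is the only point
of `T` adherent to the part of `L` over `(-ε₀, 0)`, and `y` the only one adherent to the part of
`L` over `(0, ε₀)`. So `R_T x = y`. The case `x = y` is allowed. -/
def HasEnds (π : S → UnitAddCircle) (T : Set S) (ε₀ : ℝ) (L : Set S) (x y : S) : Prop :=
  𝒮.leafClosure L ∩ T = {x, y} ∧
  𝒮.leafClosure (L ∩ π ⁻¹' arc (-ε₀) 0) ∩ T = {x} ∧
  𝒮.leafClosure (L ∩ π ⁻¹' arc 0 ε₀) ∩ T = {y}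

variable (𝒮) in
/-- `π` is of class `C^{r,s}` near `q` and its leafwise differential at `q` is surjective
(for `q` with `π q = 0`). Here `f` is a local lift of `π` to `ℝ`, read in a flow-box. -/
def IsRegularZero (π : S → UnitAddCircle) (q : S) : Prop :=
  ∃ φ ∈ 𝒮.atlas, q ∈ φ.source ∧ ∃ (O : Set (Euc k × Euc l)) (f : Euc k × Euc l → ℝ),
    IsOpen O ∧ φ.toPartialEquiv q ∈ O ∧ IsClassCrs r s f O ∧
    (∀ z ∈ O ∩ φ.target, π (φ.toPartialEquiv.symm z) = (f z : UnitAddCircle)) ∧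
    f (φ.toPartialEquiv q) = 0 ∧
    fderiv ℝ (fun x => f (x, (φ.toPartialEquiv q).2)) (φ.toPartialEquiv q).1 ≠ 0

variable (𝒮) in
/-- `W` is a trapping region, as witnessed by the map `π`, the global transversal `T` and `ε₀`. -/
structure IsTrappingRegion (W : Set S) (π : S → UnitAddCircle) (T : Set S) (ε₀ : ℝ) :
    Prop where
  continuous : Continuous π
  pos : 0 < ε₀
  lt_half : ε₀ < 1 / 2
  eq_preimage : W = π ⁻¹' arc (-ε₀) ε₀
  transversal : 𝒮.IsGlobalTransversal T
  transversal_subset : T ⊆ π ⁻¹' {0}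
  component : ∀ q, π q = 0 → ∃! t, t ∈ 𝒮.leafComponentIn (π ⁻¹' {0}) q ∩ T
  regular : ∀ q, π q = 0 → 𝒮.IsRegularZero π q
  ends : ∀ L, 𝒮.IsPiece π L → ∃ x y, 𝒮.HasEnds π T ε₀ L x y

end Solenoid

end

/-! Inside a leaf the fundamental pieces are strung along a line or a circle. Near a zero of `π` the
leaf has exactly one piece on each side (`exists_sides_unique`), and these sides do not change along
a component of the zero set. Since every piece has one end in `T` on each side, sending a point of
`T` to the other end of the piece on its negative side is a bijection of `T` (`exists_return`). Its
orbits give chains of pieces. The union of the closures in a chain is connected, open and closed,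
hence a whole leaf, and the chain is injective or periodic (`exists_isChain`).

The estimates are uniform because `S` is compact. Every point of `S` has a neighbourhood whose
points off the zero set can be moved, within the closure of their piece and over a bounded distance,
to a point of `T` that determines their local leaf (`isGood`). As a piece has at most two points of
`T` in its closure, it meets each of finitely many flow-boxes in at most two local leaves. So closed
pieces are compact, of bounded volume and bounded diameter (`exists_piece_bounds`,
`exists_piece_diam`), while the negative side of a zero always contains a ball of definite volume
(`exists_piece_volume`).

If the chain is periodic, the leaf is compact and large balls fill it. If it is injective, the index
of the piece can be smoothed near the zeros of `π` into a leafwise Lipschitz height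
(`IsChain.exists_height`). Let `U'` be the union of all pieces from the lowest to the highest one
met by the ball `U`. An almost minimal path from the centre to an extreme piece takes every
intermediate height, and at a height far below the extreme one it still has enough length left for
the whole neighbouring piece to be in the ball. So `U' \ U` lies in boundedly many pieces at the two
extremities: its volume stays bounded while that of the balls tends to infinity. The boundary of a
union of closed pieces consists of zeros of `π`, which lie in `W`. -/

noncomputable section

/-! ### Coordinates in a flow-box. -/

namespace FlowBox

variable {k l : ℕ} {S : Type*} [TopologicalSpace S] {r s : WithTop ℕ∞}

/-- The leafwise coordinate of a point in a flow-box. -/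
def hor (φ : FlowBox k l S) (p : S) : Euc k := (φ.toPartialEquiv p).1

/-- The transverse coordinate of a point in a flow-box. -/
def ver (φ : FlowBox k l S) (p : S) : Euc l := (φ.toPartialEquiv p).2

/-- The parametrization of the local leaf at height `y`. -/
def param (φ : FlowBox k l S) (y : Euc l) (x : Euc k) : S := φ.toPartialEquiv.symm (x, y)

variable (φ ψ : FlowBox k l S) {p : S} {x : Euc k} {y : Euc l}

lemma mem_target_iff : (x, y) ∈ φ.target ↔ x ∈ openDisk k ∧ y ∈ φ.K := by
  rw [φ.target_eq]; rfl

lemma hor_mem (hp : p ∈ φ.source) : φ.hor p ∈ openDisk k :=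
  ((φ.mem_target_iff).1 (φ.toPartialEquiv.map_source hp)).1

lemma ver_mem (hp : p ∈ φ.source) : φ.ver p ∈ φ.K :=
  ((φ.mem_target_iff).1 (φ.toPartialEquiv.map_source hp)).2

lemma param_mem (hx : x ∈ openDisk k) (hy : y ∈ φ.K) : φ.param y x ∈ φ.source :=
  φ.toPartialEquiv.map_target (φ.mem_target_iff.2 ⟨hx, hy⟩)

lemma coe_param (hx : x ∈ openDisk k) (hy : y ∈ φ.K) :
    φ.toPartialEquiv (φ.param y x) = (x, y) :=
  φ.toPartialEquiv.right_inv (φ.mem_target_iff.2 ⟨hx, hy⟩)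

lemma hor_param (hx : x ∈ openDisk k) (hy : y ∈ φ.K) : φ.hor (φ.param y x) = x := by
  rw [hor, coe_param φ hx hy]

lemma ver_param (hx : x ∈ openDisk k) (hy : y ∈ φ.K) : φ.ver (φ.param y x) = y := by
  rw [ver, coe_param φ hx hy]

lemma param_hor (hp : p ∈ φ.source) : φ.param (φ.ver p) (φ.hor p) = p :=
  φ.toPartialEquiv.left_inv hp

lemma source_mem_nhds (hp : p ∈ φ.source) : φ.source ∈ 𝓝 p := φ.open_source.mem_nhds hp

lemma continuousAt_coe (hp : p ∈ φ.source) : ContinuousAt φ.toPartialEquiv p :=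
  φ.continuousOn_toFun.continuousAt (φ.source_mem_nhds hp)

lemma continuousAt_hor (hp : p ∈ φ.source) : ContinuousAt φ.hor p :=
  (φ.continuousAt_coe hp).fst

lemma continuousAt_ver (hp : p ∈ φ.source) : ContinuousAt φ.ver p :=
  (φ.continuousAt_coe hp).snd

/-- Points with coordinates close to those of `p` are close to `p`. -/
lemma exists_ball_param_mem (hp : p ∈ φ.source) {N : Set S} (hN : N ∈ 𝓝 p) :
    ∃ ρ > 0, ∀ x ∈ _root_.Metric.ball (φ.hor p) ρ, ∀ y ∈ _root_.Metric.ball (φ.ver p) ρ,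
      y ∈ φ.K → x ∈ openDisk k ∧ φ.param y x ∈ N := by
  have hc : ContinuousWithinAt φ.toPartialEquiv.symm φ.target (φ.toPartialEquiv p) :=
    φ.continuousOn_invFun _ (φ.toPartialEquiv.map_source hp)
  have hl : φ.toPartialEquiv.symm (φ.toPartialEquiv p) = p := φ.toPartialEquiv.left_inv hp
  have h1 : φ.toPartialEquiv.symm ⁻¹' N ∈ 𝓝[φ.target] (φ.toPartialEquiv p) :=
    hc (by rw [hl]; exact hN)
  obtain ⟨ρ₁, hρ₁, h1⟩ := _root_.Metric.mem_nhdsWithin_iff.1 h1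
  obtain ⟨ρ₂, hρ₂, h2⟩ := _root_.Metric.isOpen_iff.1
    (_root_.Metric.isOpen_ball : IsOpen (openDisk k)) _ (φ.hor_mem hp)
  refine ⟨min ρ₁ ρ₂, lt_min hρ₁ hρ₂, fun x hx y hy hyK => ?_⟩
  have hxD : x ∈ openDisk k := h2 (_root_.Metric.ball_subset_ball (min_le_right _ _) hx)
  refine ⟨hxD, h1 ⟨?_, φ.mem_target_iff.2 ⟨hxD, hyK⟩⟩⟩
  rw [_root_.Metric.mem_ball, Prod.dist_eq]
  exact max_lt (lt_of_lt_of_le (_root_.Metric.mem_ball.1 hx) (min_le_left _ _))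
    (lt_of_lt_of_le (_root_.Metric.mem_ball.1 hy) (min_le_left _ _))

/-- The change of charts near a common point, in uniform form. -/
lemma ChangeOfCharts.exists_ball {φ ψ : FlowBox k l S} (h : φ.ChangeOfCharts r s ψ)
    (hp : p ∈ φ.source) (hp' : p ∈ ψ.source) :
    ∃ ρ > 0, ∃ (X : Euc k × Euc l → Euc k) (Y : Euc l → Euc l),
      ∀ x ∈ _root_.Metric.ball (φ.hor p) ρ, ∀ y ∈ _root_.Metric.ball (φ.ver p) ρ, y ∈ φ.K →
        x ∈ openDisk k ∧ φ.param y x ∈ ψ.source ∧ ψ.hor (φ.param y x) = X (x, y) ∧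
        ψ.ver (φ.param y x) = Y y ∧ ContDiffAt ℝ r (fun x => X (x, y)) x := by
  obtain ⟨A, B, X, Y, hA, hB, hpAB, hX, -, hXY⟩ := h p ⟨hp, hp'⟩
  obtain ⟨ρ₁, hρ₁, h1⟩ := φ.exists_ball_param_mem hp (ψ.source_mem_nhds hp')
  obtain ⟨ρ₂, hρ₂, h2⟩ := _root_.Metric.isOpen_iff.1 hA _ hpAB.1
  obtain ⟨ρ₃, hρ₃, h3⟩ := _root_.Metric.isOpen_iff.1 hB _ hpAB.2
  refine ⟨min ρ₁ (min ρ₂ ρ₃), lt_min hρ₁ (lt_min hρ₂ hρ₃), X, Y, fun x hx y hy hyK => ?_⟩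
  obtain ⟨hxD, hs⟩ := h1 x (_root_.Metric.ball_subset_ball (min_le_left _ _) hx) y
    (_root_.Metric.ball_subset_ball (min_le_left _ _) hy) hyK
  have hxA : x ∈ A := h2 (_root_.Metric.ball_subset_ball
    ((min_le_right _ _).trans (min_le_left _ _)) hx)
  have hyB : y ∈ B := h3 (_root_.Metric.ball_subset_ball
    ((min_le_right _ _).trans (min_le_right _ _)) hy)
  have h4 : ψ.toPartialEquiv (φ.param y x) = (X (x, y), Y y) :=
    hXY (x, y) ⟨⟨hxA, hyB⟩, φ.mem_target_iff.2 ⟨hxD, hyK⟩⟩ hs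
  refine ⟨hxD, hs, ?_, ?_, hX.1 (x, y) ⟨hxA, hyB⟩⟩
  · rw [hor, h4]
  · rw [ver, h4]

end FlowBox

/-! ### Neighbourhoods in the leaf topology. -/

namespace Solenoid

variable {k l : ℕ} {r s : WithTop ℕ∞} {S : Type*} [TopologicalSpace S]

/-- The space `S` with the leaf topology. -/
def Lf (_ : Solenoid k l r s S) : Type _ := S

instance (𝒮 : Solenoid k l r s S) : TopologicalSpace 𝒮.Lf := 𝒮.leafTopology

/-- Neighbourhoods in the leaf topology. -/
def nhdsL (𝒮 : Solenoid k l r s S) (p : S) : Filter S := @nhds S 𝒮.leafTopology p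

variable {𝒮 : Solenoid k l r s S} {φ ψ : FlowBox k l S} {p q : S} {x : Euc k} {y : Euc l}

lemma boxAt_mem (𝒮 : Solenoid k l r s S) (p : S) : 𝒮.boxAt p ∈ 𝒮.atlas :=
  (𝒮.cover p).choose_spec.1

lemma mem_boxAt (𝒮 : Solenoid k l r s S) (p : S) : p ∈ (𝒮.boxAt p).source :=
  (𝒮.cover p).choose_spec.2

/-- At fixed height the transition map is continuous in the leafwise variable, and the height in `φ`
depends only on the height in `ψ`; so a whole neighbourhood in the local leaf of `ψ` stays in the
local leaf of `φ` and lands in `E`. -/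
lemma isOpen_leaf_image (hφ : 𝒮.IsFlowBox φ) (hy : y ∈ φ.K) {E : Set (Euc k)} (hE : IsOpen E)
    (hED : E ⊆ openDisk k) : IsOpen[𝒮.leafTopology] (φ.param y '' E) := by
  intro ψ hψ y' hy'
  change IsOpen {x : Euc k | x ∈ openDisk k ∧ ψ.param y' x ∈ φ.param y '' E}
  rw [isOpen_iff_mem_nhds]
  rintro x' ⟨hx', x₁, hx₁, he⟩
  set p := ψ.param y' x' with hpdef
  have hpψ : p ∈ ψ.source := ψ.param_mem hx' hy'
  have hpφ : p ∈ φ.source := by rw [← he]; exact φ.param_mem (hED hx₁) hy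
  obtain ⟨ρ, hρ, X, Y, h⟩ := (hφ ψ hψ).2.exists_ball hpψ hpφ
  have hh : ψ.hor p = x' := ψ.hor_param hx' hy'
  have hv : ψ.ver p = y' := ψ.ver_param hx' hy'
  rw [hh, hv] at h
  have h0 := h x' (_root_.Metric.mem_ball_self hρ) y' (_root_.Metric.mem_ball_self hρ) hy'
  have hX0 : X (x', y') = x₁ := by
    rw [← h0.2.2.1, ← hpdef, ← he, φ.hor_param (hED hx₁) hy]
  have hY0 : Y y' = y := by
    rw [← h0.2.2.2.1, ← hpdef, ← he, φ.ver_param (hED hx₁) hy]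
  have hcont : ∀ᶠ x in 𝓝 x', X (x, y') ∈ E :=
    h0.2.2.2.2.continuousAt (by show E ∈ 𝓝 (X (x', y')); rw [hX0]; exact hE.mem_nhds hx₁)
  filter_upwards [hcont, _root_.Metric.ball_mem_nhds x' hρ] with x hxE hxb
  have hx := h x hxb y' (_root_.Metric.mem_ball_self hρ) hy'
  refine ⟨hx.1, X (x, y'), hxE, ?_⟩
  rw [← hx.2.2.1, ← hY0, ← hx.2.2.2.1]
  exact φ.param_hor hx.2.1

lemma isFlowBox_of_mem (hφ : φ ∈ 𝒮.atlas) : 𝒮.IsFlowBox φ := fun ψ hψ =>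
  ⟨𝒮.compatible φ hφ ψ hψ, 𝒮.compatible ψ hψ φ hφ⟩

/-- One inclusion is the openness of images of open sets of a local leaf, the other is the
definition of the leaf topology. All later leafwise arguments are reduced to `ℝᵏ` by this identity.
-/
lemma nhdsL_eq_map (hφ : φ ∈ 𝒮.atlas) (hp : p ∈ φ.source) :
    𝒮.nhdsL p = Filter.map (φ.param (φ.ver p)) (𝓝 (φ.hor p)) := by
  apply le_antisymm
  · intro A hA
    have hA' : φ.param (φ.ver p) ⁻¹' A ∩ openDisk k ∈ 𝓝 (φ.hor p) :=
      inter_mem hA (_root_.Metric.isOpen_ball.mem_nhds (φ.hor_mem hp))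
    obtain ⟨E, hEs, hE, hpE⟩ := mem_nhds_iff.1 hA'
    have := isOpen_leaf_image (isFlowBox_of_mem hφ) (φ.ver_mem hp) hE
      (fun x hx => (hEs hx).2)
    refine (@mem_nhds_iff S 𝒮.leafTopology p A).2 ⟨_, ?_, this, φ.hor p, hpE, φ.param_hor hp⟩
    rintro _ ⟨x, hx, rfl⟩
    exact (hEs hx).1
  · intro A hA
    obtain ⟨E, hEs, hE, hpE⟩ := (@mem_nhds_iff S 𝒮.leafTopology p A).1 hA
    have h := hE φ hφ _ (φ.ver_mem hp)
    refine mem_map.2 (mem_of_superset (h.mem_nhds ⟨φ.hor_mem hp, ?_⟩) fun x hx => hEs hx.2)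
    change φ.param (φ.ver p) (φ.hor p) ∈ E
    rwa [φ.param_hor hp]

lemma nhdsL_param (hφ : φ ∈ 𝒮.atlas) (hx : x ∈ openDisk k) (hy : y ∈ φ.K) :
    𝒮.nhdsL (φ.param y x) = Filter.map (φ.param y) (𝓝 x) := by
  rw [nhdsL_eq_map hφ (φ.param_mem hx hy), φ.ver_param hx hy, φ.hor_param hx hy]

/-- The leaf topology is finer than that of `S`, so continuity of `π` and of the metric passes to
the leaves. -/
lemma nhdsL_le (𝒮 : Solenoid k l r s S) (p : S) : 𝒮.nhdsL p ≤ 𝓝 p := by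
  rw [nhdsL_eq_map (𝒮.boxAt_mem p) (𝒮.mem_boxAt p)]
  intro N hN
  obtain ⟨ρ, hρ, h⟩ := (𝒮.boxAt p).exists_ball_param_mem (𝒮.mem_boxAt p) hN
  exact mem_map.2 <| mem_of_superset (_root_.Metric.ball_mem_nhds _ hρ) fun x hx =>
    (h x hx _ (_root_.Metric.mem_ball_self hρ) ((𝒮.boxAt p).ver_mem (𝒮.mem_boxAt p))).2

lemma isOpenL_of_isOpen (𝒮 : Solenoid k l r s S) {A : Set S} (hA : IsOpen A) :
    IsOpen[𝒮.leafTopology] A :=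
  (@isOpen_iff_mem_nhds S 𝒮.leafTopology A).2 fun p hp => 𝒮.nhdsL_le p (hA.mem_nhds hp)

instance [T2Space S] : T2Space 𝒮.Lf where
  t2 p q hpq := by
    obtain ⟨u, v, hu, hv, h⟩ := t2_separation (X := S) hpq
    exact ⟨u, v, 𝒮.isOpenL_of_isOpen hu, 𝒮.isOpenL_of_isOpen hv, h⟩

/-- Nearby points of the leaf are in the same local leaf. -/
lemma eventually_ver_eq (hφ : φ ∈ 𝒮.atlas) (hp : p ∈ φ.source) :
    ∀ᶠ z in 𝒮.nhdsL p, z ∈ φ.source ∧ φ.ver z = φ.ver p := by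
  rw [nhdsL_eq_map hφ hp, eventually_map]
  filter_upwards [_root_.Metric.isOpen_ball.mem_nhds (φ.hor_mem hp)] with x hx
  exact ⟨φ.param_mem hx (φ.ver_mem hp), φ.ver_param hx (φ.ver_mem hp)⟩

lemma tendsto_hor (hp : p ∈ φ.source) : Tendsto φ.hor (𝒮.nhdsL p) (𝓝 (φ.hor p)) :=
  (φ.continuousAt_hor hp).mono_left (𝒮.nhdsL_le p)

lemma continuousOn_param (hφ : φ ∈ 𝒮.atlas) (hy : y ∈ φ.K) :
    ContinuousOn (fun x => (show 𝒮.Lf from φ.param y x)) (openDisk k) := fun x hx => by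
  refine ContinuousAt.continuousWithinAt ?_
  change Filter.map (φ.param y) (𝓝 x) ≤ 𝒮.nhdsL (φ.param y x)
  rw [nhdsL_param hφ hx hy]

lemma isPreconnected_param_image (hφ : φ ∈ 𝒮.atlas) (hy : y ∈ φ.K) {E : Set (Euc k)}
    (hE : IsPreconnected E) (hED : E ⊆ openDisk k) :
    IsPreconnected (α := 𝒮.Lf) (φ.param y '' E) :=
  hE.image (fun x => (show 𝒮.Lf from φ.param y x)) ((continuousOn_param hφ hy).mono hED)

lemma isCompact_param_image (hφ : φ ∈ 𝒮.atlas) (hy : y ∈ φ.K) {E : Set (Euc k)}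
    (hE : IsCompact E) (hED : E ⊆ openDisk k) :
    IsCompact (X := 𝒮.Lf) (φ.param y '' E) :=
  hE.image_of_continuousOn (f := fun x => (show 𝒮.Lf from φ.param y x))
    ((continuousOn_param hφ hy).mono hED)

/-- Transverse coordinates determine each other in nearby flow-boxes. -/
lemma exists_ver_eq_of_ver_eq (h : φ.ChangeOfCharts r s ψ) (hp : p ∈ φ.source)
    (hp' : p ∈ ψ.source) : ∃ N ∈ 𝓝 p, N ⊆ φ.source ∩ ψ.source ∧
      ∀ z ∈ N, ∀ z' ∈ N, φ.ver z = φ.ver z' → ψ.ver z = ψ.ver z' := by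
  obtain ⟨ρ, hρ, X, Y, h⟩ := h.exists_ball hp hp'
  have h1 := (φ.continuousAt_hor hp) (_root_.Metric.ball_mem_nhds _ hρ)
  have h2 := (φ.continuousAt_ver hp) (_root_.Metric.ball_mem_nhds _ hρ)
  have key : ∀ z ∈ φ.hor ⁻¹' _root_.Metric.ball (φ.hor p) ρ ∩
      φ.ver ⁻¹' _root_.Metric.ball (φ.ver p) ρ ∩ (φ.source ∩ ψ.source),
      ψ.ver z = Y (φ.ver z) := by
    rintro z ⟨⟨hz1, hz2⟩, hz3, -⟩
    have := (h _ hz1 _ hz2 (φ.ver_mem hz3)).2.2.2.1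
    rwa [φ.param_hor hz3] at this
  refine ⟨_, inter_mem (inter_mem h1 h2)
    (inter_mem (φ.source_mem_nhds hp) (ψ.source_mem_nhds hp')), fun z hz => hz.2, ?_⟩
  intro z hz z' hz' he
  rw [key z hz, key z' hz', he]

end Solenoid
end
-- Leafwise paths, length and distance.
noncomputable section

namespace Solenoid

variable {k l : ℕ} {r s : WithTop ℕ∞} {S : Type*} [TopologicalSpace S]
variable {𝒮 : Solenoid k l r s S} {φ ψ : FlowBox k l S} {p q : S} {x : Euc k} {y : Euc l}

/-! ### Transition maps of local leaves -/

lemma contDiffAt_transition (hφ : φ ∈ 𝒮.atlas) (hψ : ψ ∈ 𝒮.atlas) (hp : p ∈ φ.source)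
    (hp' : p ∈ ψ.source) :
    ContDiffAt ℝ r (fun x => ψ.hor (φ.param (φ.ver p) x)) (φ.hor p) := by
  obtain ⟨ρ, hρ, X, Y, h⟩ := (𝒮.compatible φ hφ ψ hψ).exists_ball hp hp'
  have hv := _root_.Metric.mem_ball_self (x := φ.ver p) hρ
  have hX := (h _ (_root_.Metric.mem_ball_self hρ) _ hv (φ.ver_mem hp)).2.2.2.2
  refine hX.congr_of_eventuallyEq ?_
  filter_upwards [_root_.Metric.ball_mem_nhds _ hρ] with x hx
  exact (h x hx _ hv (φ.ver_mem hp)).2.2.1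

lemma eventually_transition (hφ : φ ∈ 𝒮.atlas) (hψ : ψ ∈ 𝒮.atlas) (hp : p ∈ φ.source)
    (hp' : p ∈ ψ.source) : ∀ᶠ x in 𝓝 (φ.hor p), φ.param (φ.ver p) x ∈ ψ.source ∧
      ψ.ver (φ.param (φ.ver p) x) = ψ.ver p := by
  have := eventually_ver_eq hψ hp'
  rwa [nhdsL_eq_map hφ hp] at this

/-! ### Leafwise paths -/

lemma IsC1Path.eventually {γ : ℝ → S} (h : 𝒮.IsC1Path γ) {t : ℝ} (ht : t ∈ Icc (0 : ℝ) 1)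
    (hφ : φ ∈ 𝒮.atlas) (hp : γ t ∈ φ.source) :
    ∀ᶠ τ in 𝓝[Icc (0 : ℝ) 1] t, γ τ ∈ φ.source ∧ φ.ver (γ τ) = φ.ver (γ t) :=
  (h t ht φ hφ hp).1

lemma IsC1Path.contDiffWithinAt {γ : ℝ → S} (h : 𝒮.IsC1Path γ) {t : ℝ}
    (ht : t ∈ Icc (0 : ℝ) 1) (hφ : φ ∈ 𝒮.atlas) (hp : γ t ∈ φ.source) :
    ContDiffWithinAt ℝ 1 (fun τ => φ.hor (γ τ)) (Icc (0 : ℝ) 1) t :=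
  (h t ht φ hφ hp).2

lemma IsC1Path.tendsto {γ : ℝ → S} (h : 𝒮.IsC1Path γ) {t : ℝ} (ht : t ∈ Icc (0 : ℝ) 1) :
    Tendsto γ (𝓝[Icc (0 : ℝ) 1] t) (𝒮.nhdsL (γ t)) := by
  set φ := 𝒮.boxAt (γ t)
  have hφ : φ ∈ 𝒮.atlas := 𝒮.boxAt_mem _
  have hp : γ t ∈ φ.source := 𝒮.mem_boxAt _
  rw [nhdsL_eq_map hφ hp]
  have h1 : Tendsto (fun τ => φ.hor (γ τ)) (𝓝[Icc (0 : ℝ) 1] t) (𝓝 (φ.hor (γ t))) :=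
    (h.contDiffWithinAt ht hφ hp).continuousWithinAt
  refine (tendsto_map.comp h1).congr' ?_
  filter_upwards [h.eventually ht hφ hp] with τ hτ
  simp only [Function.comp]
  rw [← hτ.2, φ.param_hor hτ.1]

lemma IsC1Path.continuousOn {γ : ℝ → S} (h : 𝒮.IsC1Path γ) :
    ContinuousOn (fun t => (show 𝒮.Lf from γ t)) (Icc (0 : ℝ) 1) :=
  fun _ ht => h.tendsto ht

lemma IsC1Path.mem_leaf {γ : ℝ → S} (h : 𝒮.IsC1Path γ) {t : ℝ} (ht : t ∈ Icc (0 : ℝ) 1)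
    (hp : γ 0 ∈ 𝒮.leaf p) : γ t ∈ 𝒮.leaf p := by
  have hc : IsPreconnected (α := 𝒮.Lf) (γ '' Icc (0 : ℝ) 1) :=
    isPreconnected_Icc.image (fun t => (show 𝒮.Lf from γ t)) h.continuousOn
  have h0 : γ 0 ∈ γ '' Icc (0 : ℝ) 1 := mem_image_of_mem _ (by simp)
  have h1 : 𝒮.leaf p = 𝒮.leaf (γ 0) := connectedComponent_eq (α := 𝒮.Lf) hp
  rw [h1]
  exact IsPreconnected.subset_connectedComponent (α := 𝒮.Lf) hc h0 (mem_image_of_mem _ ht)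

/-- The speed of a path, computed in the flow-box `φ`. -/
def Metric.speed (g : 𝒮.Metric) (φ : FlowBox k l S) (γ : ℝ → S) (t : ℝ) : ℝ :=
  Real.sqrt (g.g φ (γ t) (derivWithin (fun τ => φ.hor (γ τ)) (Icc (0 : ℝ) 1) t)
    (derivWithin (fun τ => φ.hor (γ τ)) (Icc (0 : ℝ) 1) t))

/-- The speed of a path. -/
def Metric.spd (g : 𝒮.Metric) (γ : ℝ → S) (t : ℝ) : ℝ := g.speed (𝒮.boxAt (γ t)) γ t

variable (g : 𝒮.Metric)

lemma Metric.spd_nonneg (γ : ℝ → S) (t : ℝ) : 0 ≤ g.spd γ t := Real.sqrt_nonneg _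

lemma Metric.length_eq (γ : ℝ → S) :
    g.length γ = ∫⁻ t in Icc (0 : ℝ) 1, ENNReal.ofReal (g.spd γ t) := rfl

/-- The chain rule turns the velocity in `φ` into the velocity in `ψ` by the derivative of the
transition map, which is exactly the map in the compatibility condition of the metric. -/
lemma Metric.speed_eq {γ : ℝ → S} (h : 𝒮.IsC1Path γ) {t : ℝ} (ht : t ∈ Icc (0 : ℝ) 1)
    (hφ : φ ∈ 𝒮.atlas) (hψ : ψ ∈ 𝒮.atlas) (hp : γ t ∈ φ.source) (hp' : γ t ∈ ψ.source)
    (hr : 1 ≤ r) : g.speed φ γ t = g.speed ψ γ t := by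
  have hr0 : r ≠ 0 := fun h0 => by simp [h0] at hr
  set D : Euc k →L[ℝ] Euc k :=
    fderiv ℝ (fun x => ψ.hor (φ.param (φ.ver (γ t)) x)) (φ.hor (γ t)) with hD
  have hDd : HasFDerivAt (fun x => ψ.hor (φ.param (φ.ver (γ t)) x)) D (φ.hor (γ t)) :=
    ((contDiffAt_transition hφ hψ hp hp').differentiableAt hr0).hasFDerivAt
  have hu : UniqueDiffWithinAt ℝ (Icc (0 : ℝ) 1) t := uniqueDiffOn_Icc_zero_one t ht
  have h1 : HasDerivWithinAt (fun τ => φ.hor (γ τ))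
      (derivWithin (fun τ => φ.hor (γ τ)) (Icc (0 : ℝ) 1) t) (Icc (0 : ℝ) 1) t :=
    ((h.contDiffWithinAt ht hφ hp).differentiableWithinAt one_ne_zero).hasDerivWithinAt
  have h2 := HasFDerivAt.comp_hasDerivWithinAt (f := fun τ => φ.hor (γ τ)) t hDd h1
  have h3 : HasDerivWithinAt (fun τ => ψ.hor (γ τ))
      (D (derivWithin (fun τ => φ.hor (γ τ)) (Icc (0 : ℝ) 1) t)) (Icc (0 : ℝ) 1) t := by
    refine h2.congr_of_eventuallyEq ?_ ?_
    · filter_upwards [h.eventually ht hφ hp] with τ hτ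
      simp only [Function.comp]
      rw [← hτ.2, φ.param_hor hτ.1]
    · simp only [Function.comp]
      rw [φ.param_hor hp]
  have h4 := g.compatible φ hφ ψ hψ (γ t) ⟨hp, hp'⟩
    (derivWithin (fun τ => φ.hor (γ τ)) (Icc (0 : ℝ) 1) t)
    (derivWithin (fun τ => φ.hor (γ τ)) (Icc (0 : ℝ) 1) t)
  rw [Metric.speed, Metric.speed, h3.derivWithin hu]
  exact congrArg _ h4

/-- The flow-box in the definition of the speed jumps with `t`; by independence of the chart it can
be frozen near a given time. -/
lemma Metric.continuousOn_spd {γ : ℝ → S} (h : 𝒮.IsC1Path γ) (hr : 1 ≤ r) :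
    ContinuousOn (g.spd γ) (Icc (0 : ℝ) 1) := by
  intro t ht
  set φ := 𝒮.boxAt (γ t)
  have hφ : φ ∈ 𝒮.atlas := 𝒮.boxAt_mem _
  have hp : γ t ∈ φ.source := 𝒮.mem_boxAt _
  have h1 : ∀ᶠ τ in 𝓝[Icc (0 : ℝ) 1] t, g.speed φ γ τ = g.spd γ τ := by
    filter_upwards [h.eventually ht hφ hp, self_mem_nhdsWithin] with τ hτ hτI
    exact g.speed_eq h hτI hφ (𝒮.boxAt_mem _) hτ.1 (𝒮.mem_boxAt _) hr
  have h2 : ContinuousWithinAt (fun τ => derivWithin (fun τ => φ.hor (γ τ)) (Icc (0 : ℝ) 1) τ)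
      (Icc (0 : ℝ) 1) t :=
    ((h.contDiffWithinAt ht hφ hp).continuousWithinAt_fderivWithin uniqueDiffOn_Icc_zero_one
      one_ne_zero ht).clm_apply continuousWithinAt_const
  have h3 : ContinuousWithinAt (fun τ => g.g φ (γ τ)) (Icc (0 : ℝ) 1) t :=
    ((g.continuousOn φ hφ).continuousAt (φ.source_mem_nhds hp)).tendsto.comp
      ((h.tendsto ht).mono_right (𝒮.nhdsL_le _))
  have h4 : ContinuousWithinAt (g.speed φ γ) (Icc (0 : ℝ) 1) t :=
    ((h3.clm_apply h2).clm_apply h2).sqrt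
  exact h4.congr_of_eventuallyEq (h1.mono fun _ h => h.symm) rfl

lemma Metric.length_eq_integral {γ : ℝ → S} (h : 𝒮.IsC1Path γ) (hr : 1 ≤ r) :
    g.length γ = ENNReal.ofReal (∫ t in (0 : ℝ)..1, g.spd γ t) := by
  rw [g.length_eq, intervalIntegral.integral_of_le zero_le_one, ← integral_Icc_eq_integral_Ioc,
    ofReal_integral_eq_lintegral_ofReal]
  · exact (g.continuousOn_spd h hr).integrableOn_Icc
  · exact Eventually.of_forall fun t => g.spd_nonneg γ t

lemma Metric.intervalIntegrable_spd {γ : ℝ → S} (h : 𝒮.IsC1Path γ) (hr : 1 ≤ r) {a b : ℝ}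
    (ha : a ∈ Icc (0 : ℝ) 1) (hb : b ∈ Icc (0 : ℝ) 1) :
    IntervalIntegrable (g.spd γ) volume a b :=
  ((g.continuousOn_spd h hr).mono (uIcc_subset_Icc ha hb)).intervalIntegrable

/-! ### Initial segments of paths -/

lemma IsC1Path.initial {γ : ℝ → S} (h : 𝒮.IsC1Path γ) {c : ℝ} (hc : c ∈ Icc (0 : ℝ) 1) :
    𝒮.IsC1Path fun t => γ (c * t) := by
  intro t ht φ hφ hp
  have hct : ∀ t ∈ Icc (0 : ℝ) 1, c * t ∈ Icc (0 : ℝ) 1 := fun t ht =>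
    ⟨mul_nonneg hc.1 ht.1, mul_le_one₀ hc.2 ht.1 ht.2⟩
  have hT : Tendsto (fun t => c * t) (𝓝[Icc (0 : ℝ) 1] t) (𝓝[Icc (0 : ℝ) 1] (c * t)) :=
    tendsto_nhdsWithin_of_tendsto_nhds_of_eventually_within _
      ((continuous_const.mul continuous_id).continuousAt.mono_left nhdsWithin_le_nhds)
      (eventually_nhdsWithin_of_forall hct)
  refine ⟨hT.eventually (h (c * t) (hct t ht) φ hφ hp).1, ?_⟩
  exact ContDiffWithinAt.comp (g := fun τ => φ.hor (γ τ)) (t := Icc (0 : ℝ) 1) t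
    (h.contDiffWithinAt (hct t ht) hφ hp) (contDiff_const.mul contDiff_id).contDiffWithinAt hct

lemma Metric.spd_initial {γ : ℝ → S} (h : 𝒮.IsC1Path γ) {c : ℝ}
    (hc : c ∈ Icc (0 : ℝ) 1) {t : ℝ} (ht : t ∈ Icc (0 : ℝ) 1) :
    g.spd (fun t => γ (c * t)) t = c * g.spd γ (c * t) := by
  have hct : ∀ t ∈ Icc (0 : ℝ) 1, c * t ∈ Icc (0 : ℝ) 1 := fun t ht =>
    ⟨mul_nonneg hc.1 ht.1, mul_le_one₀ hc.2 ht.1 ht.2⟩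
  set φ := 𝒮.boxAt (γ (c * t)) with hφd
  have hφ : φ ∈ 𝒮.atlas := 𝒮.boxAt_mem _
  have hp : γ (c * t) ∈ φ.source := 𝒮.mem_boxAt _
  have h1 : HasDerivWithinAt (fun τ => φ.hor (γ τ))
      (derivWithin (fun τ => φ.hor (γ τ)) (Icc (0 : ℝ) 1) (c * t)) (Icc (0 : ℝ) 1) (c * t) :=
    ((h.contDiffWithinAt (hct t ht) hφ hp).differentiableWithinAt one_ne_zero).hasDerivWithinAt
  have h2 : HasDerivWithinAt (fun t : ℝ => c * t) c (Icc (0 : ℝ) 1) t := by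
    simpa using (hasDerivWithinAt_id t (Icc (0 : ℝ) 1)).const_mul c
  have h3 := HasDerivWithinAt.scomp t h1 h2 hct
  have h4 := h3.derivWithin (uniqueDiffOn_Icc_zero_one t ht)
  rw [Metric.spd, Metric.spd, ← hφd, Metric.speed, Metric.speed]
  change Real.sqrt (g.g φ (γ (c * t)) (derivWithin ((fun τ => φ.hor (γ τ)) ∘ fun t => c * t) _ t)
    (derivWithin ((fun τ => φ.hor (γ τ)) ∘ fun t => c * t) _ t)) = _
  rw [h4]
  simp only [map_smul, FunLike.coe_smul, Pi.smul_apply, smul_eq_mul]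
  rw [← mul_assoc, Real.sqrt_mul (mul_self_nonneg c), Real.sqrt_mul_self hc.1]

/-- Reparametrizing an initial segment to `[0, 1]` is what allows a path to be cut at an interior
time. -/
lemma Metric.length_initial {γ : ℝ → S} (h : 𝒮.IsC1Path γ) (hr : 1 ≤ r) {c : ℝ}
    (hc : c ∈ Icc (0 : ℝ) 1) :
    g.length (fun t => γ (c * t)) = ENNReal.ofReal (∫ t in (0 : ℝ)..c, g.spd γ t) := by
  rw [g.length_eq_integral (h.initial hc) hr]
  congr 1
  have h1 : ∫ t in (0 : ℝ)..1, g.spd (fun t => γ (c * t)) t =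
      ∫ t in (0 : ℝ)..1, c * g.spd γ (c * t) := by
    refine intervalIntegral.integral_congr fun t ht => ?_
    rw [uIcc_of_le zero_le_one] at ht
    exact g.spd_initial h hc ht
  rw [h1, intervalIntegral.integral_const_mul]
  simp

/-! ### Leafwise Lipschitz functions and splitting of paths -/

/-- `F` is leafwise differentiable along paths of the leaf of `p`, with gradient at most `C`. -/
def Metric.IsLip (p : S) (C : ℝ) (F : S → ℝ) : Prop :=
  ∀ γ : ℝ → S, 𝒮.IsC1Path γ → γ 0 ∈ 𝒮.leaf p → ∀ t ∈ Icc (0 : ℝ) 1,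
    ∃ u, HasDerivWithinAt (fun τ => F (γ τ)) u (Icc (0 : ℝ) 1) t ∧ |u| ≤ C * g.spd γ t

variable {g}

lemma Metric.IsLip.neg {C : ℝ} {F : S → ℝ} (h : g.IsLip p C F) :
    g.IsLip p C fun q => -F q := by
  intro γ hγ h0 t ht
  obtain ⟨u, hu, hle⟩ := h γ hγ h0 t ht
  exact ⟨-u, hu.neg, by rwa [abs_neg]⟩

/-- The mean value inequality in integral form: the right derivative of `F ∘ γ` is at most `C` times
the speed. -/
lemma Metric.IsLip.sub_le {C : ℝ} {F : S → ℝ} (h : g.IsLip p C F) (hr : 1 ≤ r)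
    {γ : ℝ → S} (hγ : 𝒮.IsC1Path γ) (h0 : γ 0 ∈ 𝒮.leaf p) {a b : ℝ}
    (ha : a ∈ Icc (0 : ℝ) 1) (hb : b ∈ Icc (0 : ℝ) 1) (hab : a ≤ b) :
    F (γ b) - F (γ a) ≤ C * ∫ t in a..b, g.spd γ t := by
  choose! u hu hle using h γ hγ h0
  have hsub : Icc a b ⊆ Icc (0 : ℝ) 1 := Icc_subset_Icc ha.1 hb.2
  rw [← intervalIntegral.integral_const_mul]
  refine intervalIntegral.sub_le_integral_of_hasDeriv_right_of_le (g := fun τ => F (γ τ))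
    (g' := u) hab (fun t ht => ((hu t (hsub ht)).continuousWithinAt).mono hsub) ?_ ?_ ?_
  · intro t ht
    have ht' := hsub (Ioo_subset_Icc_self ht)
    refine ((hu t ht').hasDerivAt (Icc_mem_nhds ?_ ?_)).hasDerivWithinAt
    · exact lt_of_le_of_lt ha.1 ht.1
    · exact lt_of_lt_of_le ht.2 hb.2
  · exact (continuousOn_const.mul ((g.continuousOn_spd hγ hr).mono hsub)).integrableOn_Icc
  · intro t ht
    exact (le_abs_self _).trans (hle t (hsub (Ioo_subset_Icc_self ht)))

lemma Metric.PathLength.mem_leaf {L : ℝ≥0∞} (h : g.PathLength p q L) : q ∈ 𝒮.leaf p := by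
  induction h with
  | refl => exact mem_connectedComponent (α := 𝒮.Lf)
  | append γ _ hγ ih => exact hγ.mem_leaf (by simp) ih

lemma Metric.PathLength.trans {m : S} {L L' : ℝ≥0∞} (h : g.PathLength p m L)
    (h' : g.PathLength m q L') : g.PathLength p q (L + L') := by
  induction h' with
  | refl => simpa using h
  | append γ _ hγ ih => rw [← add_assoc]; exact .append γ ih hγ

lemma Metric.IsLip.sub_le_length {C : ℝ} (hC : 0 ≤ C) {F : S → ℝ} (h : g.IsLip p C F)
    (hr : 1 ≤ r) {L : ℝ≥0∞} (hL : g.PathLength p q L) :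
    ENNReal.ofReal (F q - F p) ≤ ENNReal.ofReal C * L := by
  induction hL with
  | refl => simp
  | @append L γ hp hγ ih =>
    have h1 := h.sub_le hr hγ hp.mem_leaf (a := 0) (b := 1) (by simp) (by simp) zero_le_one
    have h2 : F (γ 1) - F p = (F (γ 0) - F p) + (F (γ 1) - F (γ 0)) := by ring
    rw [h2, mul_add, g.length_eq_integral hγ hr, ← ENNReal.ofReal_mul hC]
    exact ENNReal.ofReal_add_le.trans (add_le_add ih (ENNReal.ofReal_le_ofReal h1))

/-- A path along which `F` increases past the value `c` can be cut at this value. -/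
lemma Metric.IsLip.exists_split {C : ℝ} (hC : 0 ≤ C) {F : S → ℝ} (h : g.IsLip p C F)
    (hr : 1 ≤ r) {L : ℝ≥0∞} (hL : g.PathLength p q L) {c : ℝ} (hp : F p ≤ c) (hq : c ≤ F q) :
    ∃ m L₁ L₂, F m = c ∧ g.PathLength p m L₁ ∧ L₁ + L₂ ≤ L ∧
      ENNReal.ofReal (F q - c) ≤ ENNReal.ofReal C * L₂ := by
  induction hL with
  | refl =>
    refine ⟨p, 0, 0, le_antisymm hp hq, .refl p, by simp, ?_⟩
    simp [sub_nonpos.2 hp]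
  | @append L γ hpL hγ ih =>
    -- If the level `c` is already passed before the last arc, the cut is inherited and the last arc
    -- joins the second part. Otherwise the last arc crosses the level and is cut there by the
    -- intermediate value theorem.
    by_cases hc : c ≤ F (γ 0)
    · obtain ⟨m, L₁, L₂, hm, hpm, h12, hL₂⟩ := ih hc
      refine ⟨m, L₁, L₂ + g.length γ, hm, hpm, by rw [← add_assoc]; gcongr, ?_⟩
      have h1 := h.sub_le hr hγ hpL.mem_leaf (a := 0) (b := 1) (by simp) (by simp) zero_le_one
      have h2 : F (γ 1) - c = (F (γ 0) - c) + (F (γ 1) - F (γ 0)) := by ring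
      rw [h2, mul_add, g.length_eq_integral hγ hr, ← ENNReal.ofReal_mul hC]
      exact ENNReal.ofReal_add_le.trans (add_le_add hL₂ (ENNReal.ofReal_le_ofReal h1))
    · push Not at hc
      have hcont : ContinuousOn (fun τ => F (γ τ)) (Icc (0 : ℝ) 1) := fun t ht => by
        obtain ⟨u, hu, -⟩ := h γ hγ hpL.mem_leaf t ht
        exact hu.continuousWithinAt
      obtain ⟨τ, hτ, hτc⟩ := intermediate_value_Icc zero_le_one hcont ⟨hc.le, hq⟩
      have hpath : g.PathLength p (γ τ)
          (L + ENNReal.ofReal (∫ t in (0 : ℝ)..τ, g.spd γ t)) := by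
        have := Metric.PathLength.append (g := g) (p := p) (L := L) (fun t => γ (τ * t))
          (by simpa using hpL) (hγ.initial hτ)
        rwa [g.length_initial hγ hr hτ, mul_one] at this
      refine ⟨γ τ, _, ENNReal.ofReal (∫ t in τ..1, g.spd γ t), hτc, hpath, ?_, ?_⟩
      · rw [add_assoc, ← ENNReal.ofReal_add
          (intervalIntegral.integral_nonneg hτ.1 fun t _ => g.spd_nonneg γ t)
          (intervalIntegral.integral_nonneg hτ.2 fun t _ => g.spd_nonneg γ t),
          intervalIntegral.integral_add_adjacent_intervals
            (g.intervalIntegrable_spd hγ hr (by simp) hτ)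
            (g.intervalIntegrable_spd hγ hr hτ (by simp)), g.length_eq_integral hγ hr]
      · rw [← ENNReal.ofReal_mul hC]
        refine ENNReal.ofReal_le_ofReal ?_
        have := h.sub_le hr hγ hpL.mem_leaf hτ (b := 1) (by simp) hτ.2
        rwa [show F (γ τ) = c from hτc] at this

/-! ### Leafwise distance -/

variable (g)

lemma Metric.leafDist_le {L : ℝ≥0∞} (h : g.PathLength p q L) : g.leafDist p q ≤ L :=
  iInf₂_le L h

lemma Metric.exists_pathLength_lt {a : ℝ≥0∞} (h : g.leafDist p q < a) :
    ∃ L, g.PathLength p q L ∧ L < a := by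
  simpa [Metric.leafDist, iInf_lt_iff] using h

lemma Metric.leafDist_triangle (p m q : S) :
    g.leafDist p q ≤ g.leafDist p m + g.leafDist m q := by
  refine ENNReal.le_of_forall_pos_le_add fun ε hε hlt => ?_
  obtain ⟨h1, h2⟩ := ENNReal.add_lt_top.1 hlt
  have hε2 : (ε / 2 : ℝ≥0∞) ≠ 0 := by simpa using hε.ne'
  obtain ⟨L₁, hL₁, hl₁⟩ := g.exists_pathLength_lt (ENNReal.lt_add_right h1.ne hε2)
  obtain ⟨L₂, hL₂, hl₂⟩ := g.exists_pathLength_lt (ENNReal.lt_add_right h2.ne hε2)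
  calc g.leafDist p q ≤ L₁ + L₂ := g.leafDist_le (hL₁.trans hL₂)
    _ ≤ (g.leafDist p m + ε / 2) + (g.leafDist m q + ε / 2) := add_le_add hl₁.le hl₂.le
    _ = g.leafDist p m + g.leafDist m q + (ε / 2 + ε / 2) := by ring
    _ = g.leafDist p m + g.leafDist m q + ε := by rw [ENNReal.add_halves]

lemma Metric.mem_leaf_of_leafDist_lt_top (h : g.leafDist p q < ⊤) : q ∈ 𝒮.leaf p := by
  obtain ⟨L, hL, -⟩ := g.exists_pathLength_lt h
  exact hL.mem_leaf

/-- The larger one of the two leafwise distances between two points. -/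
def Metric.symDist (p q : S) : ℝ≥0∞ := max (g.leafDist p q) (g.leafDist q p)

/-- Taking the maximum gives a symmetric distance without reversing paths. -/
lemma Metric.symDist_comm (p q : S) : g.symDist p q = g.symDist q p := max_comm _ _

lemma Metric.symDist_triangle (p m q : S) :
    g.symDist p q ≤ g.symDist p m + g.symDist m q := by
  refine max_le ((g.leafDist_triangle p m q).trans
    (add_le_add (le_max_left _ _) (le_max_left _ _))) ?_
  rw [add_comm]
  exact (g.leafDist_triangle q m p).trans (add_le_add (le_max_right _ _) (le_max_right _ _))

lemma Metric.leafDist_le_symDist (p q : S) : g.leafDist p q ≤ g.symDist p q := le_max_left _ _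

/-! ### Bounds of the metric in flow-boxes -/

/-- At `p` the form is coercive by compactness of the unit sphere; continuity of the metric in
operator norm extends the bounds to a neighbourhood in `S`, hence to all nearby local leaves at
once. -/
lemma Metric.exists_bounds (hφ : φ ∈ 𝒮.atlas) (hp : p ∈ φ.source) :
    ∃ N ∈ 𝓝 p, N ⊆ φ.source ∧ ∃ c > 0, ∃ C > 0, ∀ z ∈ N, ∀ v : Euc k,
      c * ‖v‖ ≤ Real.sqrt (g.g φ z v v) ∧ Real.sqrt (g.g φ z v v) ≤ C * ‖v‖ := by
  have hcont : ContinuousAt (g.g φ) p := (g.continuousOn φ hφ).continuousAt (φ.source_mem_nhds hp)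
  obtain ⟨m, hm, hmin⟩ : ∃ m > 0, ∀ v : Euc k, m * ‖v‖ ^ 2 ≤ g.g φ p v v := by
    have hK : IsCompact (_root_.Metric.sphere (0 : Euc k) 1) := isCompact_sphere _ _
    -- The sphere is empty exactly when `k = 0`, where any constant works.
    rcases (_root_.Metric.sphere (0 : Euc k) 1).eq_empty_or_nonempty with he | hne
    · refine ⟨1, one_pos, fun v => ?_⟩
      have hv : v = 0 := by
        by_contra hv
        have : (‖v‖⁻¹ • v) ∈ _root_.Metric.sphere (0 : Euc k) 1 := by
          simp [norm_smul, hv]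
        rw [he] at this
        exact this
      simp [hv]
    · have hc : ContinuousOn (fun v => g.g φ p v v) (_root_.Metric.sphere (0 : Euc k) 1) := by
        have : Continuous fun v => g.g φ p v v :=
          (g.g φ p).continuous.clm_apply continuous_id
        exact this.continuousOn
      obtain ⟨v₀, hv₀, hv₀m⟩ := hK.exists_isMinOn hne hc
      have hv₀0 : v₀ ≠ 0 := by
        rintro rfl
        simp at hv₀
      refine ⟨_, g.pos φ hφ p hp v₀ hv₀0, fun v => ?_⟩
      by_cases hv : v = 0
      · simp [hv]
      have hmem : (‖v‖⁻¹ • v) ∈ _root_.Metric.sphere (0 : Euc k) 1 := by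
        simp [norm_smul, hv]
      have h1 := isMinOn_iff.1 hv₀m _ hmem
      simp only [map_smul, FunLike.coe_smul, Pi.smul_apply, smul_eq_mul] at h1
      have hn : 0 < ‖v‖ := norm_pos_iff.2 hv
      have h2 := mul_le_mul_of_nonneg_right h1 (sq_nonneg ‖v‖)
      calc _ ≤ _ := h2
        _ = g.g φ p v v := by field_simp
  -- Half of the coercivity constant `m` is given up to the variation of the form.
  have hN : ∀ᶠ z in 𝓝 p, ‖g.g φ z - g.g φ p‖ < m / 2 := by
    have hb : _root_.Metric.ball (g.g φ p) (m / 2) ∈ 𝓝 (g.g φ p) :=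
      _root_.Metric.ball_mem_nhds (g.g φ p) (half_pos hm)
    filter_upwards [hcont hb] with z hz
    have hz' : dist (g.g φ z) (g.g φ p) < m / 2 := hz
    exact lt_of_eq_of_lt (dist_eq_norm (g.g φ z) (g.g φ p)).symm hz'
  refine ⟨_, inter_mem (φ.source_mem_nhds hp) hN, inter_subset_left, Real.sqrt (m / 2),
    Real.sqrt_pos.2 (half_pos hm), Real.sqrt (‖g.g φ p‖ + m / 2),
    Real.sqrt_pos.2 (by positivity), ?_⟩
  rintro z ⟨-, hz⟩ v
  have hz' : ‖g.g φ z - g.g φ p‖ < m / 2 := hz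
  have hd : |g.g φ z v v - g.g φ p v v| ≤ m / 2 * ‖v‖ ^ 2 := by
    have h1 : ‖(g.g φ z - g.g φ p) v v‖ ≤ ‖g.g φ z - g.g φ p‖ * ‖v‖ * ‖v‖ :=
      ContinuousLinearMap.le_opNorm₂ _ _ _
    have h2 : (g.g φ z - g.g φ p) v v = g.g φ z v v - g.g φ p v v := rfl
    rw [h2, Real.norm_eq_abs] at h1
    refine h1.trans ?_
    rw [mul_assoc, ← sq]
    gcongr
  have hpu : g.g φ p v v ≤ ‖g.g φ p‖ * ‖v‖ ^ 2 := by
    have h1 : ‖g.g φ p v v‖ ≤ ‖g.g φ p‖ * ‖v‖ * ‖v‖ := ContinuousLinearMap.le_opNorm₂ _ _ _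
    rw [mul_assoc, ← sq] at h1
    exact (le_abs_self _).trans h1
  have hm' := hmin v
  have hd' := abs_le.1 hd
  have hsq : ∀ a : ℝ, 0 ≤ a → Real.sqrt a * ‖v‖ = Real.sqrt (a * ‖v‖ ^ 2) := fun a ha => by
    rw [Real.sqrt_mul ha, Real.sqrt_sq (norm_nonneg v)]
  rw [hsq _ (half_pos hm).le, hsq _ (by positivity)]
  constructor <;> apply Real.sqrt_le_sqrt <;> linarith [hd'.1, hd'.2]

/-! ### Segments in flow-boxes -/

lemma isC1Path_param (hr : 1 ≤ r) (hφ : φ ∈ 𝒮.atlas) (hy : y ∈ φ.K) {c : ℝ → Euc k}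
    (hc : ContDiff ℝ 1 c) (hcD : ∀ t ∈ Icc (0 : ℝ) 1, c t ∈ openDisk k) :
    𝒮.IsC1Path fun t => φ.param y (c t) := by
  intro t ht ψ hψ hp
  have hx := hcD t ht
  have hpφ := φ.param_mem hx hy
  have h1 := eventually_transition hφ hψ hpφ hp
  have h2 := contDiffAt_transition hφ hψ hpφ hp
  rw [φ.hor_param hx hy, φ.ver_param hx hy] at h1 h2
  have hT : Tendsto c (𝓝[Icc (0 : ℝ) 1] t) (𝓝 (c t)) :=
    hc.continuous.continuousAt.mono_left nhdsWithin_le_nhds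
  exact ⟨hT.eventually h1, ((h2.of_le hr).comp t hc.contDiffAt).contDiffWithinAt⟩

lemma Metric.spd_param (hr : 1 ≤ r) (hφ : φ ∈ 𝒮.atlas) (hy : y ∈ φ.K) {c : ℝ → Euc k}
    (hc : ContDiff ℝ 1 c) (hcD : ∀ t ∈ Icc (0 : ℝ) 1, c t ∈ openDisk k) {t : ℝ}
    (ht : t ∈ Icc (0 : ℝ) 1) : g.spd (fun t => φ.param y (c t)) t =
      Real.sqrt (g.g φ (φ.param y (c t)) (deriv c t) (deriv c t)) := by
  have hx := hcD t ht
  rw [Metric.spd, g.speed_eq (isC1Path_param hr hφ hy hc hcD) ht (𝒮.boxAt_mem _) hφ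
    (𝒮.mem_boxAt _) (φ.param_mem hx hy) hr, Metric.speed]
  have h1 : HasDerivWithinAt (fun τ => φ.hor (φ.param y (c τ))) (deriv c t)
      (Icc (0 : ℝ) 1) t := by
    refine ((hc.differentiable one_ne_zero t).hasDerivAt.hasDerivWithinAt).congr ?_ ?_
    · exact fun τ hτ => φ.hor_param (hcD τ hτ) hy
    · exact φ.hor_param hx hy
  rw [h1.derivWithin (uniqueDiffOn_Icc_zero_one t ht)]

/-- Two points of a convex part of a local leaf on which the metric is bounded are at bounded
leafwise distance. -/
lemma Metric.leafDist_param_le (hr : 1 ≤ r) (hφ : φ ∈ 𝒮.atlas) (hy : y ∈ φ.K) {V : Set (Euc k)}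
    (hV : Convex ℝ V) (hVD : V ⊆ openDisk k) {C : ℝ}
    (hg : ∀ x ∈ V, ∀ v : Euc k, Real.sqrt (g.g φ (φ.param y x) v v) ≤ C * ‖v‖)
    {x x' : Euc k} (hx : x ∈ V) (hx' : x' ∈ V) :
    g.leafDist (φ.param y x) (φ.param y x') ≤ ENNReal.ofReal (C * ‖x' - x‖) := by
  set c : ℝ → Euc k := fun t => x + t • (x' - x) with hc
  have hcV : ∀ t ∈ Icc (0 : ℝ) 1, c t ∈ V := fun t ht => by
    have := hV.add_smul_sub_mem hx hx' ht
    exact this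
  have hcd : ContDiff ℝ 1 c := contDiff_const.add (contDiff_id.smul contDiff_const)
  have hder : ∀ t, deriv c t = x' - x := fun t => by
    have : HasDerivAt c ((1 : ℝ) • (x' - x)) t :=
      ((hasDerivAt_id t).smul_const (x' - x)).const_add x
    simpa using this.deriv
  have hpath := isC1Path_param (𝒮 := 𝒮) hr hφ hy hcd fun t ht => hVD (hcV t ht)
  have h0 : φ.param y (c 0) = φ.param y x := by simp [hc]
  have h1 : φ.param y (c 1) = φ.param y x' := by simp [hc]
  have hP := Metric.PathLength.append (g := g) (p := φ.param y x) (L := 0)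
    (fun t => φ.param y (c t)) (by rw [h0]; exact .refl _) hpath
  rw [h1, zero_add] at hP
  refine (g.leafDist_le hP).trans ?_
  rw [g.length_eq_integral hpath hr]
  refine ENNReal.ofReal_le_ofReal ?_
  have hle : ∀ t ∈ Icc (0 : ℝ) 1, g.spd (fun t => φ.param y (c t)) t ≤ C * ‖x' - x‖ := by
    intro t ht
    rw [g.spd_param hr hφ hy hcd (fun t ht => hVD (hcV t ht)) ht, hder]
    exact hg _ (hcV t ht) _
  calc ∫ t in (0 : ℝ)..1, g.spd (fun t => φ.param y (c t)) t
      ≤ ∫ t in (0 : ℝ)..1, C * ‖x' - x‖ :=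
        intervalIntegral.integral_mono_on zero_le_one
          (g.intervalIntegrable_spd hpath hr (by simp) (by simp)) (by simp) hle
    _ = C * ‖x' - x‖ := by simp

lemma Metric.symDist_param_le (hr : 1 ≤ r) (hφ : φ ∈ 𝒮.atlas) (hy : y ∈ φ.K)
    {V : Set (Euc k)} (hV : Convex ℝ V) (hVD : V ⊆ openDisk k) {C : ℝ}
    (hg : ∀ x ∈ V, ∀ v : Euc k, Real.sqrt (g.g φ (φ.param y x) v v) ≤ C * ‖v‖)
    {x x' : Euc k} (hx : x ∈ V) (hx' : x' ∈ V) :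
    g.symDist (φ.param y x) (φ.param y x') ≤ ENNReal.ofReal (C * ‖x' - x‖) := by
  refine max_le (g.leafDist_param_le hr hφ hy hV hVD hg hx hx') ?_
  rw [norm_sub_rev]
  exact g.leafDist_param_le hr hφ hy hV hVD hg hx' hx

/-- The metric is bounded on the product of two small balls around a point. -/
lemma Metric.exists_ball_bounds (hφ : φ ∈ 𝒮.atlas) (hp : p ∈ φ.source) {N : Set S}
    (hN : N ∈ 𝓝 p) : ∃ ρ > 0, ∃ c > 0, ∃ C > 0,
      ∀ x ∈ _root_.Metric.ball (φ.hor p) ρ, ∀ y ∈ _root_.Metric.ball (φ.ver p) ρ, y ∈ φ.K →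
        x ∈ openDisk k ∧ φ.param y x ∈ N ∧ ∀ v : Euc k,
          c * ‖v‖ ≤ Real.sqrt (g.g φ (φ.param y x) v v) ∧
          Real.sqrt (g.g φ (φ.param y x) v v) ≤ C * ‖v‖ := by
  obtain ⟨M, hM, -, c, hc, C, hC, h⟩ := g.exists_bounds hφ hp
  obtain ⟨ρ, hρ, hb⟩ := φ.exists_ball_param_mem hp (inter_mem hN hM)
  refine ⟨ρ, hρ, c, hc, C, hC, fun x hx y hy hyK => ?_⟩
  obtain ⟨h1, h2⟩ := hb x hx y hy hyK
  exact ⟨h1, h2.1, h _ h2.2⟩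

/-- Points close to `p` in its leaf are at small leafwise distance from `p`. -/
lemma Metric.eventually_symDist_le (hr : 1 ≤ r) (p : S) {ε : ℝ} (hε : 0 < ε) :
    ∀ᶠ z in 𝒮.nhdsL p, g.symDist p z ≤ ENNReal.ofReal ε := by
  set φ := 𝒮.boxAt p
  have hφ : φ ∈ 𝒮.atlas := 𝒮.boxAt_mem p
  have hp : p ∈ φ.source := 𝒮.mem_boxAt p
  obtain ⟨ρ, hρ, c, -, C, hC, h⟩ := g.exists_ball_bounds hφ hp univ_mem
  have hv := _root_.Metric.mem_ball_self (x := φ.ver p) hρ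
  have hy := φ.ver_mem hp
  rw [nhdsL_eq_map hφ hp, eventually_map]
  filter_upwards [_root_.Metric.ball_mem_nhds (φ.hor p) hρ,
    _root_.Metric.ball_mem_nhds (φ.hor p) (div_pos hε hC)] with x hx hx'
  have h1 := g.symDist_param_le hr hφ hy (convex_ball (φ.hor p) ρ)
    (fun x hx => (h x hx _ hv hy).1) (fun x hx v => ((h x hx _ hv hy).2.2 v).2)
    (_root_.Metric.mem_ball_self hρ) hx
  rw [φ.param_hor hp] at h1
  refine h1.trans (ENNReal.ofReal_le_ofReal ?_)
  rw [mem_ball_iff_norm, lt_div_iff₀ hC] at hx'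
  linarith

end Solenoid
end
noncomputable section

namespace Solenoid

/-! ### Gram matrices -/

/-- The Gram matrix of a bilinear form on `ℝᵏ`. -/
def gram {k : ℕ} (b : Euc k →L[ℝ] Euc k →L[ℝ] ℝ) : Matrix (Fin k) (Fin k) ℝ :=
  Matrix.of fun i j => b (EuclideanSpace.single i 1) (EuclideanSpace.single j 1)

lemma sum_single {k : ℕ} (v : Euc k) : ∑ i, v i • EuclideanSpace.single i (1 : ℝ) = v := by
  have := (EuclideanSpace.basisFun (Fin k) ℝ).sum_repr v
  simpa only [EuclideanSpace.basisFun_repr, EuclideanSpace.basisFun_apply] using this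

lemma apply_eq_sum_gram {k : ℕ} (b : Euc k →L[ℝ] Euc k →L[ℝ] ℝ) (v w : Euc k) :
    b v w = ∑ i, ∑ j, v i * gram b i j * w j := by
  conv_lhs => rw [← sum_single v, ← sum_single w]
  simp only [map_sum, map_smul, sum_apply, FunLike.coe_smul,
    Pi.smul_apply, smul_eq_mul, gram, Matrix.of_apply]
  rw [Finset.sum_comm]
  refine Finset.sum_congr rfl fun i _ => ?_
  rw [Finset.mul_sum]
  exact Finset.sum_congr rfl fun j _ => by ring

/-- The Gram matrices are congruent through the matrix `M` of `D`, i.e. `gram b = Mᵀ * gram b' * M`.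
-/
lemma det_gram_comp {k : ℕ} (b b' : Euc k →L[ℝ] Euc k →L[ℝ] ℝ) (D : Euc k →L[ℝ] Euc k)
    (h : ∀ v w, b v w = b' (D v) (D w)) : (gram b).det = D.det ^ 2 * (gram b').det := by
  set B := (EuclideanSpace.basisFun (Fin k) ℝ).toBasis with hB
  set M := LinearMap.toMatrix B B (D : Euc k →ₗ[ℝ] Euc k) with hM
  have hMa : ∀ a i, M a i = D (EuclideanSpace.single i 1) a := by
    intro a i
    rw [hM, LinearMap.toMatrix_apply, hB, OrthonormalBasis.coe_toBasis,
      EuclideanSpace.basisFun_apply]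
    rfl
  have hmat : gram b = M.transpose * gram b' * M := by
    ext i j
    rw [Matrix.mul_apply]
    simp only [Matrix.mul_apply, Matrix.transpose_apply, hMa]
    change b _ _ = _
    rw [h, apply_eq_sum_gram, Finset.sum_comm]
    exact Finset.sum_congr rfl fun j _ => by rw [Finset.sum_mul]
  rw [hmat, Matrix.det_mul, Matrix.det_mul, Matrix.det_transpose, hM, LinearMap.det_toMatrix]
  change D.det * _ * D.det = _
  ring

lemma det_gram_pos {k : ℕ} (b : Euc k →L[ℝ] Euc k →L[ℝ] ℝ) (hs : ∀ v w, b v w = b w v)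
    (hp : ∀ v, v ≠ 0 → 0 < b v v) : 0 < (gram b).det := by
  refine Matrix.PosDef.det_pos (Matrix.PosDef.of_dotProduct_mulVec_pos ?_ ?_)
  · refine Matrix.IsHermitian.ext fun i j => ?_
    rw [star_trivial]
    exact hs _ _
  · intro x hx
    have hx' : WithLp.toLp 2 x ≠ 0 := fun h => hx (by simpa using congrArg WithLp.ofLp h)
    have h1 := hp _ hx'
    rw [apply_eq_sum_gram] at h1
    have h2 : star x ⬝ᵥ (gram b).mulVec x =
        ∑ i, ∑ j, WithLp.toLp 2 x i * gram b i j * WithLp.toLp 2 x j := by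
      simp only [dotProduct, Matrix.mulVec, star_trivial, Finset.mul_sum]
      exact Finset.sum_congr rfl fun i _ => Finset.sum_congr rfl fun j _ => by
        simp [mul_assoc]
    rw [h2]
    exact h1

variable {k l : ℕ} {r s : WithTop ℕ∞} {S : Type*} [TopologicalSpace S]
variable {𝒮 : Solenoid k l r s S} {φ ψ : FlowBox k l S} {p q : S} {x : Euc k} {y : Euc l}
variable (g : 𝒮.Metric)

/-! ### The volume density -/

/-- The density of the Riemannian volume in a flow-box. -/
def Metric.dens (φ : FlowBox k l S) (p : S) : ℝ := Real.sqrt (gram (g.g φ p)).det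

lemma Metric.dens_pos (hφ : φ ∈ 𝒮.atlas) (hp : p ∈ φ.source) : 0 < g.dens φ p :=
  Real.sqrt_pos.2 (det_gram_pos _ (g.symm φ hφ p hp) (g.pos φ hφ p hp))

lemma Metric.continuousAt_dens (hφ : φ ∈ 𝒮.atlas) (hp : p ∈ φ.source) :
    ContinuousAt (g.dens φ) p := by
  have hcont : ContinuousAt (g.g φ) p := (g.continuousOn φ hφ).continuousAt (φ.source_mem_nhds hp)
  have h1 : ContinuousAt (fun p => gram (g.g φ p)) p := by
    refine continuousAt_pi.2 fun i => continuousAt_pi.2 fun j => ?_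
    exact (hcont.clm_apply continuousAt_const).clm_apply continuousAt_const
  have h2 : Continuous fun M : Matrix (Fin k) (Fin k) ℝ => M.det := continuous_id.matrix_det
  exact (h2.continuousAt.comp h1).sqrt

lemma Metric.dens_eq (hφ : φ ∈ 𝒮.atlas) (hψ : ψ ∈ 𝒮.atlas) (hp : p ∈ φ.source)
    (hp' : p ∈ ψ.source) : g.dens φ p =
      |(fderiv ℝ (fun x => ψ.hor (φ.param (φ.ver p) x)) (φ.hor p)).det| * g.dens ψ p := by
  have h := det_gram_comp (g.g φ p) (g.g ψ p) _ (g.compatible φ hφ ψ hψ p ⟨hp, hp'⟩)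
  rw [Metric.dens, h, Real.sqrt_mul (sq_nonneg _), Real.sqrt_sq_eq_abs]
  rfl

/-- The Riemannian volume of a local leaf, as a measure in the flow-box. -/
def Metric.boxVol (φ : FlowBox k l S) (y : Euc l) : Measure (Euc k) :=
  volume.withDensity fun x => ENNReal.ofReal (g.dens φ (φ.param y x))

lemma Metric.plaqueVolume_eq (φ : FlowBox k l S) (y : Euc l) (A : Set S) :
    g.plaqueVolume φ y A = g.boxVol φ y {x | x ∈ openDisk k ∧ φ.param y x ∈ A} := by
  rw [Metric.boxVol, withDensity_apply']
  rfl

/-- The change of variables formula: the Jacobian of the transition map is the ratio of the two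
densities by `dens_eq`. -/
lemma Metric.boxVol_image (hr : 1 ≤ r) (hφ : φ ∈ 𝒮.atlas) (hψ : ψ ∈ 𝒮.atlas)
    {y y' : Euc l} (hy : y ∈ φ.K) {B : Set (Euc k)} (hB : MeasurableSet B)
    (hBD : B ⊆ openDisk k)
    (h : ∀ x ∈ B, φ.param y x ∈ ψ.source ∧ ψ.ver (φ.param y x) = y') :
    g.boxVol ψ y' ((fun x => ψ.hor (φ.param y x)) '' B) = g.boxVol φ y B := by
  have hr0 : r ≠ 0 := fun h0 => by simp [h0] at hr
  have hback : ∀ x ∈ B, ψ.param y' (ψ.hor (φ.param y x)) = φ.param y x := fun x hx => by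
    rw [← (h x hx).2]
    exact ψ.param_hor (h x hx).1
  have hder : ∀ x ∈ B, HasFDerivWithinAt (fun x => ψ.hor (φ.param y x))
      (fderiv ℝ (fun x => ψ.hor (φ.param y x)) x) B x := by
    intro x hx
    have := contDiffAt_transition hφ hψ (φ.param_mem (hBD hx) hy) (h x hx).1
    rw [φ.ver_param (hBD hx) hy, φ.hor_param (hBD hx) hy] at this
    exact (this.differentiableAt hr0).hasFDerivAt.hasFDerivWithinAt
  have hinj : InjOn (fun x => ψ.hor (φ.param y x)) B := by
    intro x hx x' hx' he
    have h1 : φ.param y x = φ.param y x' := by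
      rw [← hback x hx, ← hback x' hx']
      exact congrArg _ he
    rw [← φ.hor_param (hBD hx) hy, h1, φ.hor_param (hBD hx') hy]
  rw [Metric.boxVol, Metric.boxVol, withDensity_apply', withDensity_apply',
    lintegral_image_eq_lintegral_abs_det_fderiv_mul volume hB hder hinj]
  refine setLIntegral_congr_fun hB fun x hx => ?_
  have hd := g.dens_eq hφ hψ (φ.param_mem (hBD hx) hy) (h x hx).1
  rw [φ.ver_param (hBD hx) hy, φ.hor_param (hBD hx) hy] at hd
  rw [hback x hx, hd, ENNReal.ofReal_mul (abs_nonneg _)]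

/-! ### Estimates of the volume -/

lemma Metric.vol_le_plaqueVolume (hφ : φ ∈ 𝒮.atlas) (hy : y ∈ φ.K) {A : Set S}
    (hA : A ⊆ φ.param y '' openDisk k) :
    g.vol A ≤ g.boxVol φ y {x | x ∈ openDisk k ∧ φ.param y x ∈ A} := by
  rw [← g.plaqueVolume_eq]
  refine (OuterMeasure.boundedBy_le _).trans ?_
  refine iInf_le_of_le φ (iInf_le_of_le hφ (iInf_le_of_le y (iInf_le_of_le hy
    (iInf_le_of_le ?_ le_rfl))))
  intro z hz
  obtain ⟨x, hx, rfl⟩ := hA hz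
  exact ⟨(x, y), ⟨hx, rfl⟩, rfl⟩

/-- The volume is additive from below on disjoint open parts of local leaves. -/
lemma Metric.sum_boxVol_le_vol (hr : 1 ≤ r) {ι : Type*} [Fintype ι] (φ : ι → FlowBox k l S)
    (hφ : ∀ i, φ i ∈ 𝒮.atlas) (y : ι → Euc l) (hy : ∀ i, y i ∈ (φ i).K) (Q : ι → Set (Euc k))
    (hQ : ∀ i, IsOpen (Q i)) (hQD : ∀ i, Q i ⊆ openDisk k)
    (hdisj : Pairwise fun i j => Disjoint ((φ i).param (y i) '' Q i) ((φ j).param (y j) '' Q j))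
    {A : Set S} (hA : ∀ i, (φ i).param (y i) '' Q i ⊆ A) :
    ∑ i, g.boxVol (φ i) (y i) (Q i) ≤ g.vol A := by
  -- The volume is the largest outer measure below the plaque volumes. It therefore suffices to
  -- exhibit an outer measure `m` that charges `A` with at least the sum and obeys these bounds; no
  -- measurability for `g.vol` is involved.
  set m : OuterMeasure S := OuterMeasure.sum fun i => OuterMeasure.map ((φ i).param (y i))
    (OuterMeasure.restrict (Q i) (g.boxVol (φ i) (y i)).toOuterMeasure) with hm
  have hmA : ∀ B : Set S, m B = ∑ i, g.boxVol (φ i) (y i) ((φ i).param (y i) ⁻¹' B ∩ Q i) := by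
    intro B
    rw [hm, OuterMeasure.sum_apply, tsum_fintype]
    refine Finset.sum_congr rfl fun i _ => ?_
    rw [OuterMeasure.map_apply, OuterMeasure.restrict_apply]
    rfl
  have h1 : ∑ i, g.boxVol (φ i) (y i) (Q i) ≤ m A := by
    rw [hmA]
    refine Finset.sum_le_sum fun i _ => measure_mono fun x hx => ⟨hA i ⟨x, hx, rfl⟩, hx⟩
  refine h1.trans ?_
  suffices m ≤ g.vol from this A
  refine OuterMeasure.le_boundedBy.2 fun B => ?_
  refine le_iInf fun ψ => le_iInf fun hψ => le_iInf fun η => le_iInf fun hη => le_iInf fun hB => ?_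
  rw [hmA, g.plaqueVolume_eq]
  set A' : Set (Euc k) := {x | x ∈ openDisk k ∧ ψ.param η x ∈ B}
  set E : ι → Set (Euc k) := fun i =>
    {x | x ∈ openDisk k ∧ ψ.param η x ∈ (φ i).param (y i) '' Q i}
  have hE : ∀ i, MeasurableSet (E i) := fun i =>
    (isOpen_leaf_image (isFlowBox_of_mem (hφ i)) (hy i) (hQ i) (hQD i) ψ hψ η hη).measurableSet
  have h2 : ∀ i, g.boxVol (φ i) (y i) ((φ i).param (y i) ⁻¹' B ∩ Q i) ≤
      (g.boxVol ψ η).restrict A' (E i) := by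
    intro i
    -- The set `B` is arbitrary, whereas the change of variables needs measurable sets: a measurable
    -- hull is used, cut down to the open set `E i` where the transition map is defined.
    set B' := toMeasurable (g.boxVol ψ η) (E i ∩ A') ∩ E i
    have hB'm : MeasurableSet B' := (measurableSet_toMeasurable _ _).inter (hE i)
    have hT : ∀ x ∈ B', ψ.param η x ∈ (φ i).source ∧ (φ i).ver (ψ.param η x) = y i := by
      rintro x ⟨-, -, x', hx', he⟩
      rw [← he]
      exact ⟨(φ i).param_mem (hQD i hx') (hy i), (φ i).ver_param (hQD i hx') (hy i)⟩
    have hsub : (φ i).param (y i) ⁻¹' B ∩ Q i ⊆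
        (fun x => (φ i).hor (ψ.param η x)) '' B' := by
      rintro x' ⟨hx'B, hx'Q⟩
      obtain ⟨⟨x, η'⟩, ⟨hx, rfl⟩, he⟩ := hB hx'B
      have he' : ψ.param η' x = (φ i).param (y i) x' := he
      have hxE : x ∈ E i := ⟨hx, by rw [he']; exact ⟨x', hx'Q, rfl⟩⟩
      have hxA : x ∈ A' := ⟨hx, by rw [he']; exact hx'B⟩
      refine ⟨x, ⟨subset_toMeasurable _ _ ⟨hxE, hxA⟩, hxE⟩, ?_⟩
      simp only
      rw [he', (φ i).hor_param (hQD i hx'Q) (hy i)]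
    calc _ ≤ g.boxVol (φ i) (y i) ((fun x => (φ i).hor (ψ.param η x)) '' B') := measure_mono hsub
      _ = g.boxVol ψ η B' := g.boxVol_image hr hψ (hφ i) hη hB'm (fun x hx => hx.2.1) hT
      _ ≤ g.boxVol ψ η (toMeasurable (g.boxVol ψ η) (E i ∩ A')) := measure_mono inter_subset_left
      _ = g.boxVol ψ η (E i ∩ A') := measure_toMeasurable _
      _ = (g.boxVol ψ η).restrict A' (E i) := (Measure.restrict_apply (hE i)).symm
  have hEd : Pairwise fun i j => Disjoint (E i) (E j) := fun i j hij =>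
    disjoint_left.2 fun x hxi hxj => disjoint_left.1 (hdisj hij) hxi.2 hxj.2
  -- The sets `E i` are measurable and disjoint, so their masses add up inside `A'` even if `A'` is
  -- not measurable.
  calc ∑ i, g.boxVol (φ i) (y i) ((φ i).param (y i) ⁻¹' B ∩ Q i)
      ≤ ∑ i, (g.boxVol ψ η).restrict A' (E i) := Finset.sum_le_sum fun i _ => h2 i
    _ ≤ (g.boxVol ψ η).restrict A' univ :=
      sum_measure_le_measure_univ (fun i _ => (hE i).nullMeasurableSet)
        fun i _ j _ hij => (hEd hij).aedisjoint
    _ = g.boxVol ψ η A' := Measure.restrict_apply_univ _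

lemma Metric.boxVol_le {Q : Set (Euc k)} (hQ : MeasurableSet Q) {C : ℝ}
    (hC : ∀ x ∈ Q, g.dens φ (φ.param y x) ≤ C) :
    g.boxVol φ y Q ≤ ENNReal.ofReal C * volume Q := by
  rw [Metric.boxVol, withDensity_apply', ← setLIntegral_const]
  exact setLIntegral_mono' hQ fun x hx => ENNReal.ofReal_le_ofReal (hC x hx)

lemma Metric.le_boxVol {Q : Set (Euc k)} (hQ : MeasurableSet Q) {c : ℝ}
    (hc : ∀ x ∈ Q, c ≤ g.dens φ (φ.param y x)) :
    ENNReal.ofReal c * volume Q ≤ g.boxVol φ y Q := by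
  rw [Metric.boxVol, withDensity_apply', ← setLIntegral_const]
  exact setLIntegral_mono' hQ fun x hx => ENNReal.ofReal_le_ofReal (hc x hx)

lemma Metric.exists_dens_bounds (hφ : φ ∈ 𝒮.atlas) (hp : p ∈ φ.source) :
    ∃ N ∈ 𝓝 p, ∃ c > 0, ∃ C > 0, ∀ z ∈ N, c ≤ g.dens φ z ∧ g.dens φ z ≤ C := by
  have hc := g.continuousAt_dens hφ hp
  have h0 := g.dens_pos hφ hp
  refine ⟨_, hc (Icc_mem_nhds (half_lt_self h0) (lt_add_one _)), _, half_pos h0,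
    g.dens φ p + 1, by positivity, fun z hz => hz⟩

end Solenoid
end
noncomputable section

/-! ### Tubes around a direction in a normed space -/

/-- The tube around the segment in the direction `v` through `x₀`; here `A v = 1`. -/
def tube {E : Type*} [NormedAddCommGroup E] [NormedSpace ℝ E] (A : E →L[ℝ] ℝ) (v x₀ : E)
    (τ σ : ℝ) : Set E :=
  {x | |A (x - x₀)| < τ ∧ ‖x - x₀ - A (x - x₀) • v‖ < σ}

section Tube

variable {E : Type*} [NormedAddCommGroup E] [NormedSpace ℝ E] {A : E →L[ℝ] ℝ} {v x₀ : E}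
  {τ σ t : ℝ} {F : E → ℝ}

lemma isOpen_tube : IsOpen (tube A v x₀ τ σ) := by
  have h1 : Continuous fun x => |A (x - x₀)| := by fun_prop
  have h2 : Continuous fun x => ‖x - x₀ - A (x - x₀) • v‖ := by fun_prop
  exact (isOpen_lt h1 continuous_const).inter (isOpen_lt h2 continuous_const)

lemma convex_tube : Convex ℝ (tube A v x₀ τ σ) := by
  intro x hx y hy a b ha hb hab
  have h1 : a • x + b • y - x₀ = a • (x - x₀) + b • (y - x₀) := by
    rw [smul_sub, smul_sub, sub_add_sub_comm, ← add_smul, hab, one_smul]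
  have h2 : A (a • x + b • y - x₀) = a * A (x - x₀) + b * A (y - x₀) := by
    rw [h1, map_add, map_smul, map_smul, smul_eq_mul, smul_eq_mul]
  have h3 : a • x + b • y - x₀ - A (a • x + b • y - x₀) • v =
      a • (x - x₀ - A (x - x₀) • v) + b • (y - x₀ - A (y - x₀) • v) := by
    rw [h2, h1]
    module
  constructor
  · rw [h2]
    have := (convex_ball (0 : ℝ) τ) (x := A (x - x₀)) (by simpa using hx.1)
      (y := A (y - x₀)) (by simpa using hy.1) ha hb hab
    simpa using this
  · rw [h3]
    have := (convex_ball (0 : E) σ) (x := x - x₀ - A (x - x₀) • v) (by simpa using hx.2)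
      (y := y - x₀ - A (y - x₀) • v) (by simpa using hy.2) ha hb hab
    simpa using this

lemma tube_neg : tube (-A) (-v) x₀ τ σ = tube A v x₀ τ σ := by
  ext x
  simp only [tube, mem_ofPred_eq, FunLike.coe_neg, Pi.neg_apply, abs_neg, neg_smul_neg]

lemma mem_tube_line (hA : A v = 1) (hσ : 0 < σ) (ht : |t| < τ) :
    x₀ + t • v ∈ tube A v x₀ τ σ := by
  simp [tube, hA, ht, hσ]

/-- A function which increases in the direction `v`, and is positive on a slice of the tube, has a
connected positivity set. -/
lemma isPreconnected_tube_pos (hA : A v = 1) (hσ : 0 < σ) (ht : |t| < τ)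
    (hF : ∀ x ∈ tube A v x₀ τ σ, ∀ u > (0 : ℝ), x + u • v ∈ tube A v x₀ τ σ → F x < F (x + u • v))
    (hsl : ∀ x ∈ tube A v x₀ τ σ, A (x - x₀) = t → 0 < F x) :
    IsPreconnected {x | x ∈ tube A v x₀ τ σ ∧ 0 < F x} := by
  have hmono : ∀ x ∈ tube A v x₀ τ σ, ∀ u ≥ (0 : ℝ), x + u • v ∈ tube A v x₀ τ σ →
      F x ≤ F (x + u • v) := by
    intro x hx u hu hxu
    rcases hu.eq_or_lt with rfl | hu
    · simp
    · exact (hF x hx u hu hxu).le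
  -- The slice at height `t` is convex and inside the positivity set. Each positive point is joined
  -- to it by a segment in the direction `v`, along which the transverse part is constant, so that
  -- the segment stays in the tube.
  set B : Set E := {x | x ∈ tube A v x₀ τ σ ∧ A (x - x₀) = t}
  have hBc : Convex ℝ B := by
    intro x hx y hy a b ha hb hab
    refine ⟨convex_tube hx.1 hy.1 ha hb hab, ?_⟩
    have h1 : a • x + b • y - x₀ = a • (x - x₀) + b • (y - x₀) := by
      rw [smul_sub, smul_sub, sub_add_sub_comm, ← add_smul, hab, one_smul]
    rw [h1, map_add, map_smul, map_smul, hx.2, hy.2, smul_eq_mul, smul_eq_mul, ← add_mul, hab,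
      one_mul]
  have hbase : x₀ + t • v ∈ B := ⟨mem_tube_line hA hσ ht, by simp [hA]⟩
  refine isPreconnected_of_forall (x₀ + t • v) fun x hx => ?_
  obtain ⟨hxV, hx0⟩ := hx
  set u := t - A (x - x₀) with hu
  have hsub : x + u • v - x₀ = (x - x₀) + u • v := by abel
  have hA' : A (x + u • v - x₀) = t := by rw [hsub, map_add, map_smul, hA]; simp [hu]
  have hx' : x + u • v ∈ B := by
    refine ⟨⟨by rwa [hA'], ?_⟩, hA'⟩
    rw [hA', hsub]
    have : x - x₀ + u • v - t • v = x - x₀ - A (x - x₀) • v := by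
      rw [hu]; module
    rw [this]
    exact hxV.2
  refine ⟨segment ℝ x (x + u • v) ∪ B, ?_, Or.inr hbase, Or.inl (left_mem_segment ℝ _ _), ?_⟩
  · rintro z (hz | hz)
    · have hzV : z ∈ tube A v x₀ τ σ := convex_tube.segment_subset hxV hx'.1 hz
      refine ⟨hzV, ?_⟩
      rw [segment_eq_image'] at hz
      obtain ⟨θ, hθ, rfl⟩ := hz
      simp only [add_sub_cancel_left] at hzV ⊢
      rcases le_total 0 u with h0 | h0
      · rw [smul_smul] at hzV ⊢
        exact hx0.trans_le (hmono x hxV _ (mul_nonneg hθ.1 h0) hzV)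
      -- If the slice is below `x`, positivity is propagated upwards from the slice point rather
      -- than from `x`.
      · have he : x + θ • u • v = (x + u • v) + ((θ - 1) * u) • v := by module
        rw [he] at hzV ⊢
        exact (hsl _ hx'.1 hA').trans_le (hmono _ hx'.1 _
          (mul_nonneg_of_nonpos_of_nonpos (by linarith [hθ.2]) h0) hzV)
    · exact ⟨hz.1, hsl z hz.1 hz.2⟩
  · exact (convex_segment _ _).isPreconnected.union _ (right_mem_segment ℝ _ _) hx'
      hBc.isPreconnected

lemma mem_closure_tube_pos
    (hF : ∀ x ∈ tube A v x₀ τ σ, ∀ u > (0 : ℝ), x + u • v ∈ tube A v x₀ τ σ → F x < F (x + u • v))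
    {x : E} (hx : x ∈ tube A v x₀ τ σ) (hx0 : F x = 0) :
    x ∈ closure {x | x ∈ tube A v x₀ τ σ ∧ 0 < F x} := by
  have hT : Tendsto (fun u : ℝ => x + u • v) (𝓝[>] 0) (𝓝 x) := by
    have : Continuous fun u : ℝ => x + u • v := by fun_prop
    have h := this.tendsto 0
    simp only [zero_smul, add_zero] at h
    exact h.mono_left nhdsWithin_le_nhds
  refine mem_closure_of_tendsto hT ?_
  filter_upwards [hT (isOpen_tube.mem_nhds hx), self_mem_nhdsWithin] with u hu hu0
  exact ⟨hu, by rw [← hx0]; exact hF x hx u hu0 hu⟩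

end Tube

/-! ### Functions of class `C^{r,s}` -/

section ClassCrs

variable {k l : ℕ} {F : Type*} [NormedAddCommGroup F] [NormedSpace ℝ F] {r s : WithTop ℕ∞}
  {f : Euc k × Euc l → F} {O : Set (Euc k × Euc l)}

/-- The joint continuity of the mixed derivative of order `(0, 0)`, with the two iterated
derivatives of order zero evaluated; `continuousOn_fderiv` uses order `(1, 0)` in the same way. -/
lemma IsClassCrs.continuousOn (hf : IsClassCrs r s f O) : ContinuousOn f O := by
  have h := hf.2.2 0 0 (by simp) (by simp)
  have h2 : ContinuousOn (fun z : Euc k × Euc l =>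
      iteratedFDeriv ℝ 0 (fun y => iteratedFDeriv ℝ 0 (fun x => f (x, y)) z.1) z.2
        (fun _ => 0) (fun _ => 0)) O := fun z hz =>
    ((ContinuousMultilinearMap.apply ℝ (fun _ : Fin 0 => Euc k) F
      (fun _ => 0)).continuous.continuousAt.comp_continuousWithinAt
      ((ContinuousMultilinearMap.apply ℝ (fun _ : Fin 0 => Euc l) _
        (fun _ => 0)).continuous.continuousAt.comp_continuousWithinAt (h z hz)))
  simpa using h2

lemma IsClassCrs.continuousOn_fderiv (hr : 1 ≤ r) (hf : IsClassCrs r s f O) :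
    ContinuousOn (fun z : Euc k × Euc l => fderiv ℝ (fun x => f (x, z.2)) z.1) O := by
  have h := hf.2.2 1 0 (by simpa using hr) (by simp)
  have h2 : ContinuousOn (fun z : Euc k × Euc l =>
      (continuousMultilinearCurryFin1 ℝ (Euc k) F)
        (iteratedFDeriv ℝ 0 (fun y => iteratedFDeriv ℝ 1 (fun x => f (x, y)) z.1) z.2
        (fun _ => 0))) O := fun z hz =>
    ((continuousMultilinearCurryFin1 ℝ (Euc k) F).continuous.continuousAt.comp_continuousWithinAt
      ((ContinuousMultilinearMap.apply ℝ (fun _ : Fin 0 => Euc l) _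
        (fun _ => 0)).continuous.continuousAt.comp_continuousWithinAt (h z hz)))
  refine h2.congr fun z hz => ?_
  ext v
  simp [iteratedFDeriv_one_apply]

end ClassCrs
end
noncomputable section

/-! ### Regular boxes around the zeros of `π`. -/

namespace Solenoid

variable {k l : ℕ} {r s : WithTop ℕ∞} {S : Type*} [TopologicalSpace S]
variable {𝒮 : Solenoid k l r s S} {p q : S}

/-- A product neighbourhood in a flow-box `φ` on which the map `π` has the lift `f`, whose zeros
separate each local leaf into a positive and a negative side. -/
structure IsRegularBox (g : 𝒮.Metric) (π : S → UnitAddCircle) (ε₀ : ℝ) (φ : FlowBox k l S)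
    (f : Euc k × Euc l → ℝ) (V : Set (Euc k)) (Y : Set (Euc l)) : Prop where
  mem_atlas : φ ∈ 𝒮.atlas
  isOpen_V : IsOpen V
  convex_V : Convex ℝ V
  V_sub : V ⊆ openDisk k
  isOpen_Y : IsOpen Y
  lift : ∀ x ∈ V, ∀ y ∈ Y, y ∈ φ.K → π (φ.param y x) = (f (x, y) : UnitAddCircle)
  abs_lt : ∀ x ∈ V, ∀ y ∈ Y, |f (x, y)| < ε₀
  isPreconnected_pos : ∀ y ∈ Y, IsPreconnected {x | x ∈ V ∧ 0 < f (x, y)}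
  isPreconnected_neg : ∀ y ∈ Y, IsPreconnected {x | x ∈ V ∧ f (x, y) < 0}
  mem_closure_pos : ∀ y ∈ Y, ∀ x ∈ V, f (x, y) = 0 → x ∈ closure {x | x ∈ V ∧ 0 < f (x, y)}
  mem_closure_neg : ∀ y ∈ Y, ∀ x ∈ V, f (x, y) = 0 → x ∈ closure {x | x ∈ V ∧ f (x, y) < 0}
  contDiffOn : ∀ y ∈ Y, ContDiffOn ℝ r (fun x => f (x, y)) V
  continuousOn : ContinuousOn f (V ×ˢ Y)
  exists_grad : ∃ C, ∀ x ∈ V, ∀ y ∈ Y, ‖fderiv ℝ (fun x => f (x, y)) x‖ ≤ C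
  exists_ball : ∃ c, ∃ ρ > 0, ∀ y ∈ Y, _root_.Metric.ball c ρ ⊆ {x | x ∈ V ∧ f (x, y) < 0}
  exists_bounds : ∃ c > 0, ∃ C > 0, ∀ x ∈ V, ∀ y ∈ Y, y ∈ φ.K →
    c ≤ g.dens φ (φ.param y x) ∧ ∀ v : Euc k, c * ‖v‖ ≤ Real.sqrt (g.g φ (φ.param y x) v v) ∧
      Real.sqrt (g.g φ (φ.param y x) v v) ≤ C * ‖v‖

/-- Around each regular zero of `π` there is an arbitrarily small regular box. -/
theorem exists_isRegularBox (hr : 1 ≤ r) (g : 𝒮.Metric) {π : S → UnitAddCircle} {ε₀ : ℝ}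
    (hε₀ : 0 < ε₀) (hq : 𝒮.IsRegularZero π q) {N : Set S} (hN : N ∈ 𝓝 q) :
    ∃ φ f V Y, IsRegularBox g π ε₀ φ f V Y ∧ q ∈ φ.source ∧ φ.hor q ∈ V ∧ φ.ver q ∈ Y ∧
      f (φ.hor q, φ.ver q) = 0 ∧ fderiv ℝ (fun x => f (x, φ.ver q)) (φ.hor q) ≠ 0 ∧
      ∀ x ∈ V, ∀ y ∈ Y, y ∈ φ.K → φ.param y x ∈ N := by
  have hr0 : r ≠ 0 := fun h0 => by simp [h0] at hr
  obtain ⟨φ, hφ, hqs, O, f, hO, hqO, hf, hlift, hf0, hdf⟩ := hq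
  set x₀ := φ.hor q with hx₀
  set y₀ := φ.ver q with hy₀
  have hqO' : (x₀, y₀) ∈ O := hqO
  have hf0' : f (x₀, y₀) = 0 := hf0
  set A := fderiv ℝ (fun x => f (x, y₀)) x₀ with hA
  have hdf' : A ≠ 0 := hdf
  obtain ⟨w, hw⟩ : ∃ w, A w ≠ 0 := by
    by_contra! h
    exact hdf' (ContinuousLinearMap.ext h)
  -- The direction `v` is normalized so that `A v = 1`. By continuity the derivative of `f` along
  -- `v` stays positive near `(x₀, y₀)`, so `f` increases along `v` at all nearby heights.
  set v := (A w)⁻¹ • w with hv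
  have hAv : A v = 1 := by rw [hv, map_smul, smul_eq_mul, inv_mul_cancel₀ hw]
  have hcf := hf.continuousOn
  have hcd := hf.continuousOn_fderiv hr
  have hev : ∀ᶠ z in 𝓝 (x₀, y₀), z ∈ O ∧ |f z| < ε₀ ∧
      0 < fderiv ℝ (fun x => f (x, z.2)) z.1 v ∧
      ‖fderiv ℝ (fun x => f (x, z.2)) z.1‖ < ‖A‖ + 1 := by
    have h1 := hcf.continuousAt (hO.mem_nhds hqO')
    have h2 := hcd.continuousAt (hO.mem_nhds hqO')
    refine (show ∀ᶠ z in 𝓝 (x₀, y₀), z ∈ O from hO.mem_nhds hqO').and ((h1.abs.eventually_lt continuousAt_const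
      (by rw [hf0']; simpa using hε₀)).and ((continuousAt_const.eventually_lt
      (h2.clm_apply continuousAt_const) ?_).and (h2.norm.eventually_lt continuousAt_const ?_)))
    · change 0 < A v
      rw [hAv]; exact one_pos
    · exact lt_add_one _
  obtain ⟨ρ₁, hρ₁, h1⟩ := _root_.Metric.eventually_nhds_iff_ball.1 hev
  obtain ⟨N', hN', c, hc, C', _, hdens⟩ := g.exists_dens_bounds hφ hqs
  obtain ⟨ρ₂, hρ₂, c', hc', C, hC, h2⟩ := g.exists_ball_bounds hφ hqs (inter_mem hN hN')
  set ρ := min ρ₁ ρ₂ with hρ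
  have hρ0 : 0 < ρ := lt_min hρ₁ hρ₂
  have h1' : ∀ x ∈ _root_.Metric.ball x₀ ρ, ∀ y ∈ _root_.Metric.ball y₀ ρ, (x, y) ∈ O ∧
      |f (x, y)| < ε₀ ∧ 0 < fderiv ℝ (fun x => f (x, y)) x v ∧
      ‖fderiv ℝ (fun x => f (x, y)) x‖ < ‖A‖ + 1 := by
    intro x hx y hy
    refine h1 (x, y) ?_
    rw [← ball_prod_same]
    exact ⟨_root_.Metric.ball_subset_ball (min_le_left _ _) hx,
      _root_.Metric.ball_subset_ball (min_le_left _ _) hy⟩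
  have hmono : ∀ y ∈ _root_.Metric.ball y₀ ρ, ∀ x ∈ _root_.Metric.ball x₀ ρ, ∀ u > (0 : ℝ),
      x + u • v ∈ _root_.Metric.ball x₀ ρ → f (x, y) < f (x + u • v, y) := by
    intro y hy x hx u hu hxu
    have hseg : ∀ θ ∈ Icc (0 : ℝ) u, x + θ • v ∈ _root_.Metric.ball x₀ ρ := by
      intro θ hθ
      have := (convex_ball x₀ ρ).add_smul_mem hx hxu (t := θ / u)
        ⟨div_nonneg hθ.1 hu.le, (div_le_one hu).2 hθ.2⟩
      rwa [smul_smul, div_mul_cancel₀ _ hu.ne'] at this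
    have hder : ∀ θ ∈ Icc (0 : ℝ) u, HasDerivAt (fun θ : ℝ => f (x + θ • v, y))
        (fderiv ℝ (fun x => f (x, y)) (x + θ • v) v) θ := by
      intro θ hθ
      have hd := ((hf.1 _ (h1' _ (hseg θ hθ) y hy).1).differentiableAt hr0).hasFDerivAt
      have hl : HasDerivAt (fun θ : ℝ => x + θ • v) v θ := by
        simpa using ((hasDerivAt_id θ).smul_const v).const_add x
      exact hd.comp_hasDerivAt θ hl
    have hsm : StrictMonoOn (fun θ : ℝ => f (x + θ • v, y)) (Icc 0 u) := by
      refine strictMonoOn_of_deriv_pos (convex_Icc _ _)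
        (fun θ hθ => (hder θ hθ).continuousAt.continuousWithinAt) fun θ hθ => ?_
      rw [interior_Icc] at hθ
      rw [(hder θ (Ioo_subset_Icc_self hθ)).deriv]
      exact (h1' _ (hseg θ (Ioo_subset_Icc_self hθ)) y hy).2.2.1
    simpa using hsm (left_mem_Icc.2 hu.le) (right_mem_Icc.2 hu.le) hu
  -- The tube will have half-length `2 * τ`, so that the slices at `±τ` are inside it. The factor
  -- `8` makes the displacement along `v` less than `ρ / 2`; with a transverse radius at most `ρ /
  -- 2`, the tube stays in the ball of radius `ρ`.
  set τ := ρ / (8 * (‖v‖ + 1)) with hτ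
  have hv1 : 0 < 8 * (‖v‖ + 1) := by positivity
  have hτ0 : 0 < τ := div_pos hρ0 hv1
  have hτv : 2 * τ * ‖v‖ < ρ / 2 := by
    have : τ * (8 * (‖v‖ + 1)) = ρ := div_mul_cancel₀ _ hv1.ne'
    nlinarith [norm_nonneg v]
  have hy₀b : y₀ ∈ _root_.Metric.ball y₀ ρ := _root_.Metric.mem_ball_self hρ0
  have hx₀b : x₀ ∈ _root_.Metric.ball x₀ ρ := _root_.Metric.mem_ball_self hρ0
  have hline : ∀ t : ℝ, |t| ≤ τ → x₀ + t • v ∈ _root_.Metric.ball x₀ ρ := by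
    intro t ht
    rw [mem_ball_iff_norm, add_sub_cancel_left, norm_smul, Real.norm_eq_abs]
    nlinarith [norm_nonneg v]
  have hpos : 0 < f (x₀ + τ • v, y₀) := by
    have := hmono y₀ hy₀b x₀ hx₀b τ hτ0 (hline τ (abs_of_pos hτ0).le)
    rwa [hf0'] at this
  have hneg : f (x₀ + (-τ) • v, y₀) < 0 := by
    have := hmono y₀ hy₀b (x₀ + (-τ) • v) (hline (-τ) (by rw [abs_neg, abs_of_pos hτ0])) τ hτ0
      (by simpa using hx₀b)
    simpa [hf0'] using this
  have hcat : ∀ t : ℝ, |t| ≤ τ → ContinuousAt f (x₀ + t • v, y₀) := fun t ht =>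
    hcf.continuousAt (hO.mem_nhds (h1' _ (hline t ht) y₀ hy₀b).1)
  obtain ⟨σ₁, hσ₁, hs1⟩ := _root_.Metric.eventually_nhds_iff_ball.1
    (continuousAt_const.eventually_lt (hcat τ (abs_of_pos hτ0).le) hpos)
  obtain ⟨σ₂, hσ₂, hs2⟩ := _root_.Metric.eventually_nhds_iff_ball.1
    ((hcat (-τ) (by rw [abs_neg, abs_of_pos hτ0])).eventually_lt continuousAt_const hneg)
  -- Also small enough for `f` to keep its sign on the slices at `τ` and `-τ`, for all heights in
  -- `Y`.
  set σ := min (ρ / 2) (min σ₁ σ₂) with hσ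
  have hσ0 : 0 < σ := lt_min (half_pos hρ0) (lt_min hσ₁ hσ₂)
  have hσρ : σ ≤ ρ / 2 := min_le_left _ _
  have hs1' : ∀ x ∈ _root_.Metric.ball (x₀ + τ • v) σ, ∀ y ∈ _root_.Metric.ball y₀ σ,
      0 < f (x, y) := by
    intro x hx y hy
    refine hs1 (x, y) ?_
    rw [← ball_prod_same]
    exact ⟨_root_.Metric.ball_subset_ball ((min_le_right _ _).trans (min_le_left _ _)) hx,
      _root_.Metric.ball_subset_ball ((min_le_right _ _).trans (min_le_left _ _)) hy⟩
  have hs2' : ∀ x ∈ _root_.Metric.ball (x₀ + (-τ) • v) σ, ∀ y ∈ _root_.Metric.ball y₀ σ,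
      f (x, y) < 0 := by
    intro x hx y hy
    refine hs2 (x, y) ?_
    rw [← ball_prod_same]
    exact ⟨_root_.Metric.ball_subset_ball ((min_le_right _ _).trans (min_le_right _ _)) hx,
      _root_.Metric.ball_subset_ball ((min_le_right _ _).trans (min_le_right _ _)) hy⟩
  set V := tube A v x₀ (2 * τ) σ with hV
  set Y := _root_.Metric.ball y₀ σ with hY
  have hVb : V ⊆ _root_.Metric.ball x₀ ρ := by
    intro x hx
    rw [mem_ball_iff_norm]
    have h3 : x - x₀ = (x - x₀ - A (x - x₀) • v) + A (x - x₀) • v := by abel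
    rw [h3]
    refine (norm_add_le _ _).trans_lt ?_
    rw [norm_smul, Real.norm_eq_abs]
    have := hx.1
    have := hx.2
    nlinarith [norm_nonneg v]
  have hYb : Y ⊆ _root_.Metric.ball y₀ ρ := _root_.Metric.ball_subset_ball (by linarith)
  have ht1 : |τ| < 2 * τ := by rw [abs_of_pos hτ0]; linarith
  have hposF : ∀ y ∈ Y, ∀ x ∈ V, ∀ u > (0 : ℝ), x + u • v ∈ V → f (x, y) < f (x + u • v, y) :=
    fun y hy x hx u hu hxu => hmono y (hYb hy) x (hVb hx) u hu (hVb hxu)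
  have hnegF : ∀ y ∈ Y, ∀ x ∈ tube (-A) (-v) x₀ (2 * τ) σ, ∀ u > (0 : ℝ),
      x + u • (-v) ∈ tube (-A) (-v) x₀ (2 * τ) σ → -f (x, y) < -f (x + u • (-v), y) := by
    intro y hy x hx u hu hxu
    rw [tube_neg] at hx hxu
    have := hposF y hy _ hxu u hu (by simpa using hx)
    simpa using this
  have hAv' : (-A) (-v) = 1 := by simpa using hAv
  refine ⟨φ, f, V, Y, ⟨hφ, isOpen_tube, convex_tube, ?_, _root_.Metric.isOpen_ball, ?_, ?_, ?_,
    ?_, ?_, ?_, ?_, ?_, ?_, ?_, ?_⟩, hqs, ?_, _root_.Metric.mem_ball_self hσ0, hf0', hdf', ?_⟩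
  · intro x hx
    exact (h2 x (_root_.Metric.ball_subset_ball (min_le_right _ _) (hVb hx)) y₀
      (_root_.Metric.mem_ball_self hρ₂) (φ.ver_mem hqs)).1
  · intro x hx y hy hyK
    have hxD := (h2 x (_root_.Metric.ball_subset_ball (min_le_right _ _) (hVb hx)) y₀
      (_root_.Metric.mem_ball_self hρ₂) (φ.ver_mem hqs)).1
    exact hlift (x, y) ⟨(h1' x (hVb hx) y (hYb hy)).1, φ.mem_target_iff.2 ⟨hxD, hyK⟩⟩
  · exact fun x hx y hy => (h1' x (hVb hx) y (hYb hy)).2.1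
  · intro y hy
    refine isPreconnected_tube_pos (F := fun x => f (x, y)) hAv hσ0 ht1 (hposF y hy) ?_
    intro x hx hxt
    refine hs1' x ?_ y hy
    rw [mem_ball_iff_norm, ← sub_sub, ← hxt]
    exact hx.2
  · intro y hy
    have := isPreconnected_tube_pos (F := fun x => -f (x, y)) hAv' hσ0 ht1 (hnegF y hy) ?_
    · rw [tube_neg] at this
      simpa using this
    · intro x hx hxt
      rw [tube_neg] at hx
      refine neg_pos.2 (hs2' x ?_ y hy)
      have hxt' : A (x - x₀) = -τ := by
        rw [← hxt]
        exact (neg_neg _).symm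
      rw [mem_ball_iff_norm, ← sub_sub, ← hxt']
      exact hx.2
  · exact fun y hy x hx hx0 => mem_closure_tube_pos (F := fun x => f (x, y)) (hposF y hy) hx hx0
  · intro y hy x hx hx0
    have := mem_closure_tube_pos (F := fun x => -f (x, y)) (hnegF y hy)
      (x := x) (by rw [tube_neg]; exact hx) (by simpa using hx0)
    rw [tube_neg] at this
    simpa using this
  · exact fun y hy x hx => (hf.1 _ (h1' x (hVb hx) y (hYb hy)).1).contDiffWithinAt
  · exact hcf.mono fun z hz => (h1' z.1 (hVb hz.1) z.2 (hYb hz.2)).1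
  · exact ⟨‖A‖ + 1, fun x hx y hy => (h1' x (hVb hx) y (hYb hy)).2.2.2.le⟩
  -- A ball around the centre of the slice at `-τ`, on which `f` is negative at all heights of `Y`.
  · have hcV : x₀ + (-τ) • v ∈ V := mem_tube_line hAv hσ0 (by rwa [abs_neg])
    obtain ⟨ρ', hρ', hb⟩ := _root_.Metric.isOpen_iff.1 isOpen_tube _ hcV
    refine ⟨x₀ + (-τ) • v, min ρ' σ, lt_min hρ' hσ0, fun y hy x hx => ?_⟩
    exact ⟨hb (_root_.Metric.ball_subset_ball (min_le_left _ _) hx),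
      hs2' x (_root_.Metric.ball_subset_ball (min_le_right _ _) hx) y hy⟩
  · refine ⟨min c c', lt_min hc hc', C, hC, fun x hx y hy hyK => ?_⟩
    obtain ⟨-, h3, h4⟩ := h2 x (_root_.Metric.ball_subset_ball (min_le_right _ _) (hVb hx)) y
      (_root_.Metric.ball_subset_ball (min_le_right _ _) (hYb hy)) hyK
    refine ⟨(min_le_left _ _).trans (hdens _ h3.2).1, fun v => ⟨?_, (h4 v).2⟩⟩
    exact (mul_le_mul_of_nonneg_right (min_le_right _ _) (norm_nonneg v)).trans (h4 v).1
  · have := mem_tube_line (x₀ := x₀) (τ := 2 * τ) (t := 0) hAv hσ0 (by simpa using hτ0)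
    simpa using this
  · intro x hx y hy hyK
    exact (h2 x (_root_.Metric.ball_subset_ball (min_le_right _ _) (hVb hx)) y
      (_root_.Metric.ball_subset_ball (min_le_right _ _) (hYb hy)) hyK).2.1.1

end Solenoid
end
noncomputable section

/-! ### Small arcs of the circle -/

lemma UnitAddCircle.coe_injOn {t u : ℝ} (ht : |t| < 1 / 2) (hu : |u| < 1 / 2)
    (h : (t : UnitAddCircle) = u) : t = u := by
  have ht' := abs_lt.1 ht
  have hu' := abs_lt.1 hu
  have : Fact ((0 : ℝ) < 1) := ⟨one_pos⟩
  exact (AddCircle.coe_eq_coe_iff_of_mem_Ico (p := (1 : ℝ)) (a := -(1 / 2))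
    ⟨ht'.1.le, by linarith [ht'.2]⟩ ⟨hu'.1.le, by linarith [hu'.2]⟩).1 h

namespace Solenoid

lemma coe_mem_arc_pos {t ε₀ : ℝ} (hε : ε₀ < 1 / 2) (ht : |t| < ε₀) :
    (t : UnitAddCircle) ∈ arc 0 ε₀ ↔ 0 < t := by
  constructor
  · rintro ⟨u, hu, he⟩
    have : u = t := UnitAddCircle.coe_injOn
      (by rw [abs_of_pos hu.1]; exact hu.2.trans hε) (ht.trans hε) he
    exact this ▸ hu.1
  · exact fun h => ⟨t, ⟨h, (le_abs_self t).trans_lt ht⟩, rfl⟩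

lemma coe_mem_arc_neg {t ε₀ : ℝ} (hε : ε₀ < 1 / 2) (ht : |t| < ε₀) :
    (t : UnitAddCircle) ∈ arc (-ε₀) 0 ↔ t < 0 := by
  constructor
  · rintro ⟨u, hu, he⟩
    have : u = t := UnitAddCircle.coe_injOn
      (by rw [abs_of_neg hu.2]; linarith [hu.1]) (ht.trans hε) he
    exact this ▸ hu.2
  · exact fun h => ⟨t, ⟨by linarith [neg_abs_le t], h⟩, rfl⟩

lemma coe_eq_zero_of_abs_lt {t ε₀ : ℝ} (hε : ε₀ < 1 / 2) (ht : |t| < ε₀) :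
    (t : UnitAddCircle) = 0 ↔ t = 0 := by
  constructor
  · intro h
    exact UnitAddCircle.coe_injOn (ht.trans hε) (by norm_num) (by simpa using h)
  · rintro rfl
    simp

lemma arc_disjoint {ε₀ : ℝ} (hε : ε₀ < 1 / 2) {a : UnitAddCircle} (h : a ∈ arc 0 ε₀)
    (h' : a ∈ arc (-ε₀) 0) : False := by
  obtain ⟨t, ht, rfl⟩ := h
  have := (coe_mem_arc_neg hε (by rw [abs_of_pos ht.1]; exact ht.2)).1 h'
  linarith [ht.1]

lemma arc_pos_ne_zero {ε₀ : ℝ} (hε : ε₀ < 1 / 2) {a : UnitAddCircle} (h : a ∈ arc 0 ε₀) :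
    a ≠ 0 := by
  obtain ⟨t, ht, rfl⟩ := h
  rw [ne_eq, coe_eq_zero_of_abs_lt hε (by rw [abs_of_pos ht.1]; exact ht.2)]
  exact ht.1.ne'

lemma arc_neg_ne_zero {ε₀ : ℝ} (hε : ε₀ < 1 / 2) {a : UnitAddCircle} (h : a ∈ arc (-ε₀) 0) :
    a ≠ 0 := by
  obtain ⟨t, ht, rfl⟩ := h
  rw [ne_eq, coe_eq_zero_of_abs_lt hε (by rw [abs_of_neg ht.2]; linarith [ht.1])]
  exact ht.2.ne

variable {k l : ℕ} {r s : WithTop ℕ∞} {S : Type*} [TopologicalSpace S]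
variable {𝒮 : Solenoid k l r s S} {φ : FlowBox k l S} {p q z : S} {x x' : Euc k} {y : Euc l}
  {π : S → UnitAddCircle} {ε₀ : ℝ} {L L' : Set S}

/-! ### Pieces -/

/-- The component of `π⁻¹(𝕋 - {0})` through a point. -/
def piece (𝒮 : Solenoid k l r s S) (π : S → UnitAddCircle) (q : S) : Set S :=
  𝒮.leafComponentIn (π ⁻¹' {0}ᶜ) q

lemma isPiece_piece (h : π q ≠ 0) : 𝒮.IsPiece π (𝒮.piece π q) := ⟨q, h, rfl⟩

lemma mem_piece_self (h : π q ≠ 0) : q ∈ 𝒮.piece π q :=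
  mem_connectedComponentIn (α := 𝒮.Lf) h

lemma IsPiece.ne_zero (hL : 𝒮.IsPiece π L) (hz : z ∈ L) : π z ≠ 0 := by
  obtain ⟨q, -, rfl⟩ := hL
  exact connectedComponentIn_subset (α := 𝒮.Lf) _ _ hz

lemma IsPiece.eq_piece (hL : 𝒮.IsPiece π L) (hz : z ∈ L) : L = 𝒮.piece π z := by
  obtain ⟨q, -, rfl⟩ := hL
  exact connectedComponentIn_eq (α := 𝒮.Lf) hz

lemma IsPiece.eq_of_mem (hL : 𝒮.IsPiece π L) (hL' : 𝒮.IsPiece π L') (hz : z ∈ L)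
    (hz' : z ∈ L') : L = L' := (hL.eq_piece hz).trans (hL'.eq_piece hz').symm

lemma IsPiece.isPreconnected (hL : 𝒮.IsPiece π L) : IsPreconnected (α := 𝒮.Lf) L := by
  obtain ⟨q, hq, rfl⟩ := hL
  exact isPreconnected_connectedComponentIn (α := 𝒮.Lf)

lemma subset_piece {E : Set S} (hE : IsPreconnected (α := 𝒮.Lf) E) (h0 : ∀ z ∈ E, π z ≠ 0)
    (hq : q ∈ E) : E ⊆ 𝒮.piece π q :=
  hE.subset_connectedComponentIn (α := 𝒮.Lf) hq h0

lemma piece_eq_of_mem (hz : z ∈ 𝒮.piece π q) (hq : π q ≠ 0) : 𝒮.piece π z = 𝒮.piece π q :=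
  ((isPiece_piece hq).eq_piece hz).symm

lemma piece_eq_of_isPreconnected {E : Set S} (hE : IsPreconnected (α := 𝒮.Lf) E)
    (h0 : ∀ z ∈ E, π z ≠ 0) (hq : q ∈ E) (hz : z ∈ E) : 𝒮.piece π z = 𝒮.piece π q :=
  piece_eq_of_mem (subset_piece hE h0 hq hz) (h0 q hq)

/-- Pieces are open in the leaf topology. -/
lemma eventually_mem_piece (hπ : Continuous π) (hq : π q ≠ 0) :
    ∀ᶠ z in 𝒮.nhdsL q, z ∈ 𝒮.piece π q := by
  set φ := 𝒮.boxAt q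
  have hφ : φ ∈ 𝒮.atlas := 𝒮.boxAt_mem q
  have hp : q ∈ φ.source := 𝒮.mem_boxAt q
  obtain ⟨ρ, hρ, h⟩ := φ.exists_ball_param_mem hp
    ((isOpen_compl_singleton.preimage hπ).mem_nhds (show q ∈ π ⁻¹' {0}ᶜ from hq))
  have hv := _root_.Metric.mem_ball_self (x := φ.ver q) hρ
  have hy := φ.ver_mem hp
  rw [nhdsL_eq_map hφ hp, eventually_map]
  filter_upwards [_root_.Metric.ball_mem_nhds (φ.hor q) hρ] with x hx
  refine subset_piece (𝒮 := 𝒮) (isPreconnected_param_image hφ hy (convex_ball (φ.hor q) ρ).isPreconnected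
    fun x hx => (h x hx _ hv hy).1) ?_ ⟨_, _root_.Metric.mem_ball_self hρ, φ.param_hor hp⟩
    (mem_image_of_mem _ hx)
  rintro _ ⟨x, hx, rfl⟩
  exact (h x hx _ hv hy).2

lemma IsPiece.isOpen (hπ : Continuous π) (hL : 𝒮.IsPiece π L) : IsOpen (X := 𝒮.Lf) L := by
  refine (isOpen_iff_mem_nhds (X := 𝒮.Lf)).2 fun (z : S) hz => ?_
  rw [hL.eq_piece (z := z) hz]
  have := eventually_mem_piece (𝒮 := 𝒮) hπ (hL.ne_zero hz)
  exact this

lemma mem_leafClosure_iff {A : Set S} : q ∈ 𝒮.leafClosure A ↔ ∃ᶠ z in 𝒮.nhdsL q, z ∈ A :=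
  mem_closure_iff_frequently (X := 𝒮.Lf)

lemma leafClosure_mono {A B : Set S} (h : A ⊆ B) : 𝒮.leafClosure A ⊆ 𝒮.leafClosure B :=
  closure_mono (X := 𝒮.Lf) h

lemma subset_leafClosure {A : Set S} : A ⊆ 𝒮.leafClosure A := subset_closure (X := 𝒮.Lf)

/-- The piece of an adherent point that is not a zero is a neighbourhood of it, so it meets `L` and
equals `L`. -/
lemma IsPiece.mem_of_mem_leafClosure (hπ : Continuous π) (hL : 𝒮.IsPiece π L)
    (hz : z ∈ 𝒮.leafClosure L) (h0 : π z ≠ 0) : z ∈ L := by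
  obtain ⟨w, hw, hw'⟩ := ((mem_leafClosure_iff.1 hz).and_eventually
    (eventually_mem_piece hπ h0)).exists
  rw [hL.eq_of_mem (isPiece_piece h0) hw hw']
  exact mem_piece_self h0

/-! ### Regular boxes and the sides of the zero set -/

variable {g : 𝒮.Metric} {f : Euc k × Euc l → ℝ} {V : Set (Euc k)} {Y : Set (Euc l)}

namespace IsRegularBox

variable (B : IsRegularBox g π ε₀ φ f V Y) (hε : ε₀ < 1 / 2)
include B hε

lemma eq_zero_iff (hx : x ∈ V) (hy : y ∈ Y) (hyK : y ∈ φ.K) :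
    π (φ.param y x) = 0 ↔ f (x, y) = 0 := by
  rw [B.lift x hx y hy hyK]
  exact coe_eq_zero_of_abs_lt hε (B.abs_lt x hx y hy)

lemma mem_arc_pos_iff (hx : x ∈ V) (hy : y ∈ Y) (hyK : y ∈ φ.K) :
    π (φ.param y x) ∈ arc 0 ε₀ ↔ 0 < f (x, y) := by
  rw [B.lift x hx y hy hyK]
  exact coe_mem_arc_pos hε (B.abs_lt x hx y hy)

lemma mem_arc_neg_iff (hx : x ∈ V) (hy : y ∈ Y) (hyK : y ∈ φ.K) :
    π (φ.param y x) ∈ arc (-ε₀) 0 ↔ f (x, y) < 0 := by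
  rw [B.lift x hx y hy hyK]
  exact coe_mem_arc_neg hε (B.abs_lt x hx y hy)

lemma piece_eq_of_pos (hx : x ∈ V) (hx' : x' ∈ V) (hy : y ∈ Y) (hyK : y ∈ φ.K)
    (h : 0 < f (x, y)) (h' : 0 < f (x', y)) :
    𝒮.piece π (φ.param y x) = 𝒮.piece π (φ.param y x') := by
  refine piece_eq_of_isPreconnected (isPreconnected_param_image B.mem_atlas hyK
    (B.isPreconnected_pos y hy) fun x hx => B.V_sub hx.1) ?_
    (mem_image_of_mem _ ⟨hx', h'⟩) (mem_image_of_mem _ ⟨hx, h⟩)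
  rintro _ ⟨x, hx, rfl⟩
  rw [ne_eq, B.eq_zero_iff hε hx.1 hy hyK]
  exact hx.2.ne'

lemma piece_eq_of_neg (hx : x ∈ V) (hx' : x' ∈ V) (hy : y ∈ Y) (hyK : y ∈ φ.K)
    (h : f (x, y) < 0) (h' : f (x', y) < 0) :
    𝒮.piece π (φ.param y x) = 𝒮.piece π (φ.param y x') := by
  refine piece_eq_of_isPreconnected (isPreconnected_param_image B.mem_atlas hyK
    (B.isPreconnected_neg y hy) fun x hx => B.V_sub hx.1) ?_
    (mem_image_of_mem _ ⟨hx', h'⟩) (mem_image_of_mem _ ⟨hx, h⟩)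
  rintro _ ⟨x, hx, rfl⟩
  rw [ne_eq, B.eq_zero_iff hε hx.1 hy hyK]
  exact hx.2.ne

/-- The positive side of a local leaf is connected, hence contained in the piece of any of its
points, and every zero of the local leaf is adherent to it. -/
lemma mem_leafClosure_pos (hx : x ∈ V) (hy : y ∈ Y) (hyK : y ∈ φ.K) (h : f (x, y) = 0)
    (hx' : x' ∈ V) (h' : 0 < f (x', y)) :
    φ.param y x ∈ 𝒮.leafClosure (𝒮.piece π (φ.param y x') ∩ π ⁻¹' arc 0 ε₀) := by
  have h1 : φ.param y x ∈ 𝒮.leafClosure (φ.param y '' {x | x ∈ V ∧ 0 < f (x, y)}) :=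
    ContinuousWithinAt.mem_closure_image (f := fun x => (show 𝒮.Lf from φ.param y x))
      (((continuousOn_param B.mem_atlas hyK) x (B.V_sub hx)).mono fun x hx => B.V_sub hx.1)
      (B.mem_closure_pos y hy x hx h)
  refine leafClosure_mono ?_ h1
  rintro _ ⟨x₁, hx₁, rfl⟩
  refine ⟨?_, (B.mem_arc_pos_iff hε hx₁.1 hy hyK).2 hx₁.2⟩
  rw [B.piece_eq_of_pos hε hx' hx₁.1 hy hyK h' hx₁.2]
  refine mem_piece_self ?_
  rw [ne_eq, B.eq_zero_iff hε hx₁.1 hy hyK]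
  exact hx₁.2.ne'

lemma mem_leafClosure_neg (hx : x ∈ V) (hy : y ∈ Y) (hyK : y ∈ φ.K) (h : f (x, y) = 0)
    (hx' : x' ∈ V) (h' : f (x', y) < 0) :
    φ.param y x ∈ 𝒮.leafClosure (𝒮.piece π (φ.param y x') ∩ π ⁻¹' arc (-ε₀) 0) := by
  have h1 : φ.param y x ∈ 𝒮.leafClosure (φ.param y '' {x | x ∈ V ∧ f (x, y) < 0}) :=
    ContinuousWithinAt.mem_closure_image (f := fun x => (show 𝒮.Lf from φ.param y x))
      (((continuousOn_param B.mem_atlas hyK) x (B.V_sub hx)).mono fun x hx => B.V_sub hx.1)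
      (B.mem_closure_neg y hy x hx h)
  refine leafClosure_mono ?_ h1
  rintro _ ⟨x₁, hx₁, rfl⟩
  refine ⟨?_, (B.mem_arc_neg_iff hε hx₁.1 hy hyK).2 hx₁.2⟩
  rw [B.piece_eq_of_neg hε hx' hx₁.1 hy hyK h' hx₁.2]
  refine mem_piece_self ?_
  rw [ne_eq, B.eq_zero_iff hε hx₁.1 hy hyK]
  exact hx₁.2.ne

end IsRegularBox

variable (𝒮 π ε₀) in
/-- `L` is the piece on the negative side of the zero `q` of `π`. -/
def IsNegSide (q : S) (L : Set S) : Prop :=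
  𝒮.IsPiece π L ∧ q ∈ 𝒮.leafClosure (L ∩ π ⁻¹' arc (-ε₀) 0)

variable (𝒮 π ε₀) in
/-- `L` is the piece on the positive side of the zero `q` of `π`. -/
def IsPosSide (q : S) (L : Set S) : Prop :=
  𝒮.IsPiece π L ∧ q ∈ 𝒮.leafClosure (L ∩ π ⁻¹' arc 0 ε₀)

/-- The local structure of a leaf near a zero of `π`. -/
theorem exists_sides (hr : 1 ≤ r) (g : 𝒮.Metric) (h0 : 0 < ε₀) (hε : ε₀ < 1 / 2)
    (hq : 𝒮.IsRegularZero π q) : ∃ Lm Lp, 𝒮.IsNegSide π ε₀ q Lm ∧ 𝒮.IsPosSide π ε₀ q Lp ∧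
      ∀ᶠ z in 𝒮.nhdsL q, (π z ∈ arc (-ε₀) 0 ∧ z ∈ Lm) ∨ (π z ∈ arc 0 ε₀ ∧ z ∈ Lp) ∨
        (π z = 0 ∧ 𝒮.IsNegSide π ε₀ z Lm ∧ 𝒮.IsPosSide π ε₀ z Lp) := by
  obtain ⟨φ, f, V, Y, B, hqs, hqV, hqY, hf0, -, -⟩ :=
    exists_isRegularBox hr g h0 hq (univ_mem : univ ∈ 𝓝 q)
  set y := φ.ver q
  have hyK : y ∈ φ.K := φ.ver_mem hqs
  obtain ⟨xp, hxpV, hxp⟩ := closure_nonempty_iff.1 ⟨_, B.mem_closure_pos y hqY _ hqV hf0⟩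
  obtain ⟨xm, hxmV, hxm⟩ := closure_nonempty_iff.1 ⟨_, B.mem_closure_neg y hqY _ hqV hf0⟩
  have hp0 : π (φ.param y xp) ≠ 0 := by
    rw [ne_eq, B.eq_zero_iff hε hxpV hqY hyK]; exact hxp.ne'
  have hm0 : π (φ.param y xm) ≠ 0 := by
    rw [ne_eq, B.eq_zero_iff hε hxmV hqY hyK]; exact hxm.ne
  have hneg : ∀ x ∈ V, f (x, y) = 0 →
      𝒮.IsNegSide π ε₀ (φ.param y x) (𝒮.piece π (φ.param y xm)) := fun x hx hf =>
    ⟨isPiece_piece hm0, B.mem_leafClosure_neg hε hx hqY hyK hf hxmV hxm⟩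
  have hpos : ∀ x ∈ V, f (x, y) = 0 →
      𝒮.IsPosSide π ε₀ (φ.param y x) (𝒮.piece π (φ.param y xp)) := fun x hx hf =>
    ⟨isPiece_piece hp0, B.mem_leafClosure_pos hε hx hqY hyK hf hxpV hxp⟩
  refine ⟨𝒮.piece π (φ.param y xm), 𝒮.piece π (φ.param y xp), ?_, ?_, ?_⟩
  · rw [← φ.param_hor hqs]; exact hneg _ hqV hf0
  · rw [← φ.param_hor hqs]; exact hpos _ hqV hf0
  · rw [nhdsL_eq_map B.mem_atlas hqs, eventually_map]
    filter_upwards [B.isOpen_V.mem_nhds hqV] with x hx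
    rcases lt_trichotomy (f (x, y)) 0 with h | h | h
    · refine Or.inl ⟨(B.mem_arc_neg_iff hε hx hqY hyK).2 h, ?_⟩
      rw [B.piece_eq_of_neg hε hxmV hx hqY hyK hxm h]
      exact mem_piece_self (arc_neg_ne_zero hε ((B.mem_arc_neg_iff hε hx hqY hyK).2 h))
    · exact Or.inr (Or.inr ⟨(B.eq_zero_iff hε hx hqY hyK).2 h, hneg x hx h, hpos x hx h⟩)
    · refine Or.inr (Or.inl ⟨(B.mem_arc_pos_iff hε hx hqY hyK).2 h, ?_⟩)
      rw [B.piece_eq_of_pos hε hxpV hx hqY hyK hxp h]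
      exact mem_piece_self (arc_pos_ne_zero hε ((B.mem_arc_pos_iff hε hx hqY hyK).2 h))

section Trapping

variable (g)
variable {W T : Set S} (hr : 1 ≤ r) (hW : 𝒮.IsTrappingRegion W π T ε₀)
include g hr hW

/-- Any piece adherent to `q` over `(-ε₀, 0)` has points over this arc in the neighbourhood
described by `exists_sides`, and there they all belong to `Lm`; likewise on the other side. -/
theorem exists_sides_unique (hq : π q = 0) : ∃ Lm Lp,
    (∀ L, 𝒮.IsNegSide π ε₀ q L ↔ L = Lm) ∧ (∀ L, 𝒮.IsPosSide π ε₀ q L ↔ L = Lp) ∧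
      ∀ᶠ z in 𝒮.nhdsL q, (π z ∈ arc (-ε₀) 0 ∧ z ∈ Lm) ∨ (π z ∈ arc 0 ε₀ ∧ z ∈ Lp) ∨
        (π z = 0 ∧ 𝒮.IsNegSide π ε₀ z Lm ∧ 𝒮.IsPosSide π ε₀ z Lp) := by
  have hε := hW.lt_half
  obtain ⟨Lm, Lp, hm, hp, hev⟩ := exists_sides hr g hW.pos hε (hW.regular q hq)
  refine ⟨Lm, Lp, fun L => ⟨fun hL => ?_, fun h => h ▸ hm⟩,
    fun L => ⟨fun hL => ?_, fun h => h ▸ hp⟩, hev⟩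
  · obtain ⟨z, ⟨hz1, hz2⟩, hz⟩ := ((mem_leafClosure_iff.1 hL.2).and_eventually hev).exists
    rcases hz with h | h | h
    · exact hL.1.eq_of_mem hm.1 hz1 h.2
    · exact (arc_disjoint hε h.1 hz2).elim
    · exact (arc_neg_ne_zero hε hz2 h.1).elim
  · obtain ⟨z, ⟨hz1, hz2⟩, hz⟩ := ((mem_leafClosure_iff.1 hL.2).and_eventually hev).exists
    rcases hz with h | h | h
    · exact (arc_disjoint hε hz2 h.1).elim
    · exact hL.1.eq_of_mem hp.1 hz1 h.2
    · exact (arc_pos_ne_zero hε hz2 h.1).elim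

lemma IsNegSide.eq (hq : π q = 0) (hL : 𝒮.IsNegSide π ε₀ q L) (hL' : 𝒮.IsNegSide π ε₀ q L') :
    L = L' := by
  obtain ⟨Lm, Lp, hm, -, -⟩ := exists_sides_unique g hr hW hq
  rw [(hm L).1 hL, (hm L').1 hL']

lemma IsPosSide.eq (hq : π q = 0) (hL : 𝒮.IsPosSide π ε₀ q L) (hL' : 𝒮.IsPosSide π ε₀ q L') :
    L = L' := by
  obtain ⟨Lm, Lp, -, hp, -⟩ := exists_sides_unique g hr hW hq
  rw [(hp L).1 hL, (hp L').1 hL']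

/-- The sides are constant on the components of the zero set. -/
lemma sides_iff (hz : z ∈ 𝒮.leafComponentIn (π ⁻¹' {0}) q) (hq : π q = 0) :
    (𝒮.IsNegSide π ε₀ q L ↔ 𝒮.IsNegSide π ε₀ z L) ∧
      (𝒮.IsPosSide π ε₀ q L ↔ 𝒮.IsPosSide π ε₀ z L) := by
  have hC : IsPreconnected (α := 𝒮.Lf) (𝒮.leafComponentIn (π ⁻¹' {0}) q) :=
    isPreconnected_connectedComponentIn (α := 𝒮.Lf)
  have hsub : ∀ z ∈ 𝒮.leafComponentIn (π ⁻¹' {0}) q, π z = 0 :=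
    fun z hz => connectedComponentIn_subset (α := 𝒮.Lf) _ _ hz
  -- Having `L` as a given side is a locally constant property of the zeros, so it is constant on a
  -- connected set of zeros.
  refine hC.induction₂ (fun a b : S => (𝒮.IsNegSide π ε₀ a L ↔ 𝒮.IsNegSide π ε₀ b L) ∧
    (𝒮.IsPosSide π ε₀ a L ↔ 𝒮.IsPosSide π ε₀ b L)) ?_ ?_ ?_
    (mem_connectedComponentIn (α := 𝒮.Lf) hq) hz
  · intro (a : S) ha
    obtain ⟨Lm, Lp, hm, hp, hev⟩ := exists_sides_unique g hr hW (hsub a ha)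
    filter_upwards [hev.filter_mono (@nhdsWithin_le_nhds S 𝒮.leafTopology a _),
      @self_mem_nhdsWithin S 𝒮.leafTopology a _] with b hb' hb
    have hb0 := hsub b hb
    rcases hb' with h | h | h
    · exact (arc_neg_ne_zero hW.lt_half h.1 hb0).elim
    · exact (arc_pos_ne_zero hW.lt_half h.1 hb0).elim
    · refine ⟨⟨fun hL => ?_, fun hL => ?_⟩, ⟨fun hL => ?_, fun hL => ?_⟩⟩
      · rw [(hm L).1 hL]; exact h.2.1
      · exact (hm L).2 (hL.eq g hr hW hb0 h.2.1)
      · rw [(hp L).1 hL]; exact h.2.2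
      · exact (hp L).2 (hL.eq g hr hW hb0 h.2.2)
  · intro a b c _ _ _ h h'
    exact ⟨h.1.trans h'.1, h.2.trans h'.2⟩
  · intro a b _ _ h
    exact ⟨h.1.symm, h.2.symm⟩

/-- A zero adherent to a piece is on one of its sides. -/
lemma IsPiece.side_of_mem_leafClosure (hL : 𝒮.IsPiece π L) (hq : π q = 0)
    (h : q ∈ 𝒮.leafClosure L) : 𝒮.IsNegSide π ε₀ q L ∨ 𝒮.IsPosSide π ε₀ q L := by
  obtain ⟨Lm, Lp, hm, hp, hev⟩ := exists_sides_unique g hr hW hq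
  obtain ⟨z, hz1, hz⟩ := ((mem_leafClosure_iff.1 h).and_eventually hev).exists
  rcases hz with h | h | h
  · left
    have hm' := (hm Lm).2 rfl
    rwa [hL.eq_of_mem hm'.1 hz1 h.2]
  · right
    have hp' := (hp Lp).2 rfl
    rwa [hL.eq_of_mem hp'.1 hz1 h.2]
  · exact (hL.ne_zero hz1 h.1).elim

end Trapping

lemma IsNegSide.mem_leafClosure (h : 𝒮.IsNegSide π ε₀ q L) : q ∈ 𝒮.leafClosure L :=
  leafClosure_mono inter_subset_left h.2

lemma IsPosSide.mem_leafClosure (h : 𝒮.IsPosSide π ε₀ q L) : q ∈ 𝒮.leafClosure L :=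
  leafClosure_mono inter_subset_left h.2

end Solenoid
end
noncomputable section

/-! ### Transport of points along their pieces to the transversal. -/

namespace Solenoid

variable {k l : ℕ} {r s : WithTop ℕ∞} {S : Type*} [TopologicalSpace S]
variable {𝒮 : Solenoid k l r s S} {φ ψ : FlowBox k l S} {p q z a b : S} {x x' : Euc k} {y : Euc l}
  {π : S → UnitAddCircle} {ε₀ : ℝ} {L L' : Set S} {W T : Set S}
  {f : Euc k × Euc l → ℝ} {V : Set (Euc k)} {Y : Set (Euc l)}

/-- `p` has a transport of the nearby points, along their pieces, to the transversal `T`; the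
transport separates local leaves and displaces points by a bounded distance. The chart `φ` is
used to tell local leaves apart. -/
def IsGoodIn (g : 𝒮.Metric) (π : S → UnitAddCircle) (T : Set S) (φ : FlowBox k l S) (p : S) :
    Prop :=
  ∃ N ∈ 𝓝 p, ∃ (τ : S → S) (D : ℝ), ∀ z ∈ N, π z ≠ 0 →
    τ z ∈ T ∧ τ z ∈ 𝒮.leafClosure (𝒮.piece π z) ∧ g.symDist z (τ z) ≤ ENNReal.ofReal D ∧
    ∀ z' ∈ N, π z' ≠ 0 → τ z = τ z' → φ.ver z = φ.ver z'

/-- `p` has a transport of the nearby points to the transversal `T`. -/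
def IsGood (g : 𝒮.Metric) (π : S → UnitAddCircle) (T : Set S) (p : S) : Prop :=
  ∃ φ ∈ 𝒮.atlas, p ∈ φ.source ∧ IsGoodIn g π T φ p

variable {g : 𝒮.Metric}

/-- After shrinking the neighbourhood, equal heights in one chart give equal heights in another, so
any chart of the atlas around `p` can be used. -/
lemma IsGood.isGoodIn (h : IsGood g π T p) (hψ : ψ ∈ 𝒮.atlas) (hp : p ∈ ψ.source) :
    IsGoodIn g π T ψ p := by
  obtain ⟨φ, hφ, hpφ, N, hN, τ, D, h⟩ := h
  obtain ⟨M, hM, -, hv⟩ := exists_ver_eq_of_ver_eq (𝒮.compatible φ hφ ψ hψ) hpφ hp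
  refine ⟨N ∩ M, inter_mem hN hM, τ, D, fun z hz h0 => ?_⟩
  obtain ⟨h1, h2, h3, h4⟩ := h z hz.1 h0
  exact ⟨h1, h2, h3, fun z' hz' h0' he => hv z hz.2 z' hz'.2 (h4 z' hz'.1 h0' he)⟩

/-- The points near `b` are first pushed to points near `a`, in the same piece and at the same
height, and then transported from there. The displacements add up, and separation of heights
survives because the push preserves the height. -/
lemma IsGood.of_link (ha : IsGood g π T a) (hφ : φ ∈ 𝒮.atlas) (has : a ∈ φ.source)
    (hbs : b ∈ φ.source) (D' : ℝ)
    (h : ∀ N ∈ 𝓝 a, ∀ᶠ z in 𝓝 b, π z ≠ 0 → ∃ w ∈ N, φ.ver w = φ.ver z ∧ π w ≠ 0 ∧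
      𝒮.piece π w = 𝒮.piece π z ∧ g.symDist z w ≤ ENNReal.ofReal D') :
    IsGood g π T b := by
  obtain ⟨N, hN, τ, D, hτ⟩ := ha.isGoodIn hφ has
  choose! w hw using fun (z : S) (hz : π z ≠ 0 → ∃ w ∈ N, φ.ver w = φ.ver z ∧ π w ≠ 0 ∧
      𝒮.piece π w = 𝒮.piece π z ∧ g.symDist z w ≤ ENNReal.ofReal D') (hz0 : π z ≠ 0) => hz hz0
  refine ⟨φ, hφ, hbs, _, h N hN, fun z => τ (w z), max D' 0 + max D 0, fun z hz h0 => ?_⟩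
  obtain ⟨hwN, hwv, hw0, hwp, hwd⟩ := hw z hz h0
  obtain ⟨h1, h2, h3, h4⟩ := hτ _ hwN hw0
  refine ⟨h1, by rwa [← hwp], ?_, fun z' hz' h0' he => ?_⟩
  · refine (g.symDist_triangle z (w z) _).trans ?_
    rw [ENNReal.ofReal_add (le_max_right _ _) (le_max_right _ _)]
    exact add_le_add (hwd.trans (ENNReal.ofReal_le_ofReal (le_max_left _ _)))
      (h3.trans (ENNReal.ofReal_le_ofReal (le_max_left _ _)))
  · obtain ⟨hwN', hwv', hw0', -, -⟩ := hw z' hz' h0'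
    rw [← hwv, ← hwv']
    exact h4 _ hwN' hw0' he

lemma norm_sub_le_two (hx : x ∈ openDisk k) (hx' : x' ∈ openDisk k) : ‖x' - x‖ ≤ 2 := by
  rw [mem_ball_zero_iff] at hx hx'
  exact (norm_sub_le _ _).trans (by linarith)

namespace IsRegularBox

variable (B : IsRegularBox g π ε₀ φ f V Y)
include B

lemma exists_symDist_le (hr : 1 ≤ r) : ∃ D : ℝ, ∀ y ∈ Y, y ∈ φ.K → ∀ x ∈ V, ∀ x' ∈ V,
    g.symDist (φ.param y x) (φ.param y x') ≤ ENNReal.ofReal D := by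
  obtain ⟨c, -, C, hC, h⟩ := B.exists_bounds
  refine ⟨C * 2, fun y hy hyK x hx x' hx' => ?_⟩
  refine (g.symDist_param_le hr B.mem_atlas hyK B.convex_V B.V_sub
    (fun x hx v => ((h x hx y hy hyK).2 v).2) hx hx').trans (ENNReal.ofReal_le_ofReal ?_)
  exact mul_le_mul_of_nonneg_left (norm_sub_le_two (B.V_sub hx) (B.V_sub hx')) hC.le

/-- The open set of points with coordinates in the box. -/
lemma mem_nhds (hp : p ∈ φ.source) (h1 : φ.hor p ∈ V) (h2 : φ.ver p ∈ Y) :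
    {z | z ∈ φ.source ∧ φ.hor z ∈ V ∧ φ.ver z ∈ Y} ∈ 𝓝 p :=
  inter_mem (φ.source_mem_nhds hp) (inter_mem
    ((φ.continuousAt_hor hp) (B.isOpen_V.mem_nhds h1))
    ((φ.continuousAt_ver hp) (B.isOpen_Y.mem_nhds h2)))

/-- In a regular box, transports propagate from the zeros of `π` to the local leaf. -/
lemma isGood_of_zero (hr : 1 ≤ r) (hε : ε₀ < 1 / 2) (has : a ∈ φ.source) (hbs : b ∈ φ.source)
    (haV : φ.hor a ∈ V) (hbV : φ.hor b ∈ V) (haY : φ.ver a ∈ Y) (hab : φ.ver b = φ.ver a)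
    (ha0 : π a = 0) (ha : IsGood g π T a) : IsGood g π T b := by
  obtain ⟨D, hD⟩ := B.exists_symDist_le hr
  have haK := φ.ver_mem has
  have hf0 : f (φ.hor a, φ.ver a) = 0 := by
    rw [← B.eq_zero_iff hε haV haY haK, φ.param_hor has, ha0]
  refine ha.of_link B.mem_atlas has hbs D fun N hN => ?_
  obtain ⟨ρ, hρ, hb⟩ := φ.exists_ball_param_mem has hN
  -- One relay on each side of the zero, close to `a`. At heights close to that of `a` they keep
  -- their signs, and a point `z` is pushed to the relay of the same sign, which lies in its piece
  -- because each side of the box is connected.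
  obtain ⟨xp, hxp, hxpV, hxp0⟩ := _root_.mem_closure_iff_nhds.1
    (B.mem_closure_pos _ haY _ haV hf0) _ (_root_.Metric.ball_mem_nhds _ hρ)
  obtain ⟨xm, hxm, hxmV, hxm0⟩ := _root_.mem_closure_iff_nhds.1
    (B.mem_closure_neg _ haY _ haV hf0) _ (_root_.Metric.ball_mem_nhds _ hρ)
  have hcont : ∀ x ∈ V, ContinuousAt (fun z => f (x, φ.ver z)) b := by
    intro x hx
    have h1 : ContinuousAt f (x, φ.ver b) :=
      B.continuousOn.continuousAt ((B.isOpen_V.prod B.isOpen_Y).mem_nhds ⟨hx, by rwa [hab]⟩)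
    exact ContinuousAt.comp (f := fun z => (x, φ.ver z)) h1
      (continuousAt_const.prodMk (φ.continuousAt_ver hbs))
  filter_upwards [B.mem_nhds hbs hbV (by rwa [hab]),
    continuousAt_const.eventually_lt (hcont xp hxpV) (by rwa [hab]),
    (hcont xm hxmV).eventually_lt continuousAt_const (by rwa [hab]),
    (φ.continuousAt_ver hbs) (by rw [hab]; exact _root_.Metric.ball_mem_nhds _ hρ)]
    with z hz hzp hzm hzρ h0
  obtain ⟨hzs, hzV, hzY⟩ := hz
  have hzK := φ.ver_mem hzs
  have hzz := φ.param_hor hzs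
  have key : ∀ x ∈ V, x ∈ _root_.Metric.ball (φ.hor a) ρ → f (x, φ.ver z) ≠ 0 →
      𝒮.piece π (φ.param (φ.ver z) x) = 𝒮.piece π z →
      ∃ w ∈ N, φ.ver w = φ.ver z ∧ π w ≠ 0 ∧ 𝒮.piece π w = 𝒮.piece π z ∧
        g.symDist z w ≤ ENNReal.ofReal D := by
    intro x hx hxb hfx hpc
    refine ⟨φ.param (φ.ver z) x, (hb x hxb _ hzρ hzK).2, φ.ver_param (B.V_sub hx) hzK, ?_, hpc, ?_⟩
    · rwa [ne_eq, B.eq_zero_iff hε hx hzY hzK]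
    · have := hD _ hzY hzK _ hzV x hx
      rwa [hzz] at this
  have hfz : f (φ.hor z, φ.ver z) ≠ 0 := by
    rw [ne_eq, ← B.eq_zero_iff hε hzV hzY hzK, hzz]; exact h0
  rcases hfz.lt_or_gt with h | h
  · refine key xm hxmV hxm hzm.ne ?_
    have := B.piece_eq_of_neg hε hxmV hzV hzY hzK hzm h
    rwa [hzz] at this
  · refine key xp hxpV hxp hzp.ne' ?_
    have := B.piece_eq_of_pos hε hxpV hzV hzY hzK hzp h
    rwa [hzz] at this

end IsRegularBox

/-- Away from the zeros of `π`, transports propagate along the leaf. -/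
lemma eventually_isGood_iff (g : 𝒮.Metric) (hr : 1 ≤ r) (hπ : Continuous π) (hq : π q ≠ 0) :
    ∀ᶠ z in 𝒮.nhdsL q, IsGood g π T q ↔ IsGood g π T z := by
  set φ := 𝒮.boxAt q
  have hφ : φ ∈ 𝒮.atlas := 𝒮.boxAt_mem q
  have hp : q ∈ φ.source := 𝒮.mem_boxAt q
  obtain ⟨ρ, hρ, c, -, C, hC, h⟩ := g.exists_ball_bounds hφ hp
    ((isOpen_compl_singleton.preimage hπ).mem_nhds (show q ∈ π ⁻¹' {0}ᶜ from hq))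
  have key : ∀ a b, a ∈ φ.source → b ∈ φ.source →
      φ.hor a ∈ _root_.Metric.ball (φ.hor q) ρ → φ.hor b ∈ _root_.Metric.ball (φ.hor q) ρ →
      φ.ver a ∈ _root_.Metric.ball (φ.ver q) ρ → φ.ver b = φ.ver a →
      IsGood g π T a → IsGood g π T b := by
    intro a b has hbs ha hb hva hab hga
    refine hga.of_link hφ has hbs (C * 2) fun N hN => ?_
    obtain ⟨ρ', hρ', hN'⟩ := φ.exists_ball_param_mem has hN
    filter_upwards [φ.source_mem_nhds hbs,
      (φ.continuousAt_hor hbs) (_root_.Metric.isOpen_ball.mem_nhds hb),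
      (φ.continuousAt_ver hbs) (_root_.Metric.isOpen_ball.mem_nhds (by rwa [hab])),
      (φ.continuousAt_ver hbs) (by rw [hab]; exact _root_.Metric.ball_mem_nhds _ hρ')]
      with z hzs hzh hzv hzv' h0
    have hzK := φ.ver_mem hzs
    have hall := fun x hx => h x hx _ hzv hzK
    refine ⟨φ.param (φ.ver z) (φ.hor a),
      (hN' _ (_root_.Metric.mem_ball_self hρ') _ hzv' hzK).2,
      φ.ver_param (φ.hor_mem has) hzK, (hall _ ha).2.1, ?_, ?_⟩
    · refine piece_eq_of_isPreconnected (isPreconnected_param_image hφ hzK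
        (convex_ball (φ.hor q) ρ).isPreconnected fun x hx => (hall x hx).1) ?_
        ⟨_, hzh, φ.param_hor hzs⟩ (mem_image_of_mem _ ha)
      rintro _ ⟨x, hx, rfl⟩
      exact (hall x hx).2.1
    · have h1 := g.symDist_param_le hr hφ hzK (convex_ball (φ.hor q) ρ)
        (fun x hx => (hall x hx).1) (fun x hx v => ((hall x hx).2.2 v).2) hzh ha
      rw [φ.param_hor hzs] at h1
      exact h1.trans (ENNReal.ofReal_le_ofReal (mul_le_mul_of_nonneg_left
        (norm_sub_le_two (φ.hor_mem hzs) (φ.hor_mem has)) hC.le))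
  have hqh := _root_.Metric.mem_ball_self (x := φ.hor q) hρ
  have hqv := _root_.Metric.mem_ball_self (x := φ.ver q) hρ
  filter_upwards [eventually_ver_eq hφ hp,
    (tendsto_hor hp) (_root_.Metric.isOpen_ball.mem_nhds hqh)] with z hz hzh
  exact ⟨key q z hp hz.1 hqh hzh hqv hz.2,
    key z q hz.1 hp hzh hqh (by rw [hz.2]; exact hqv) hz.2.symm⟩

lemma HasEnds.sides {x y : S} (hL : 𝒮.IsPiece π L) (h : 𝒮.HasEnds π T ε₀ L x y) :
    (x ∈ T ∧ 𝒮.IsNegSide π ε₀ x L) ∧ (y ∈ T ∧ 𝒮.IsPosSide π ε₀ y L) := by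
  have hx : x ∈ 𝒮.leafClosure (L ∩ π ⁻¹' arc (-ε₀) 0) ∩ T := by rw [h.2.1]; rfl
  have hy : y ∈ 𝒮.leafClosure (L ∩ π ⁻¹' arc 0 ε₀) ∩ T := by rw [h.2.2]; rfl
  exact ⟨⟨hx.2, hL, hx.1⟩, ⟨hy.2, hL, hy.1⟩⟩

section Trapping

variable (g)
variable (hr : 1 ≤ r) (hW : 𝒮.IsTrappingRegion W π T ε₀)
include g hr hW

/-- Near a point of `T` the transport slides each point along its local leaf to the transversal
`{a'} × K` of a flow-box. The target is a zero of `π` in the same local leaf of a regular box, hence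
adherent to the piece of the point, and it remembers the height. -/
lemma isGood_of_mem_transversal {t : S} (ht : t ∈ T) : IsGood g π T t := by
  have hε := hW.lt_half
  obtain ⟨F, -, hF, hTF⟩ := hW.transversal.1
  have hTF' : ∀ c ∈ F, ∀ η ∈ c.1.K, c.1.param η c.2 ∈ T := by
    intro c hc η hη
    rw [hTF]
    exact mem_biUnion hc ⟨(c.2, η), ⟨rfl, hη⟩, rfl⟩
  have ht' := ht
  rw [hTF] at ht'
  obtain ⟨⟨ψ, a⟩, hc, ⟨a', η₀⟩, ⟨ha', hη₀⟩, hte⟩ := mem_iUnion₂.1 ht'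
  obtain rfl : a' = a := ha'
  have hψ : 𝒮.IsFlowBox ψ := (hF _ hc).1
  have ha : a' ∈ openDisk k := (hF _ hc).2
  have hTψ : ∀ η ∈ ψ.K, ψ.param η a' ∈ T := hTF' _ hc
  replace hη₀ : η₀ ∈ ψ.K := hη₀
  have hte' : ψ.param η₀ a' = t := hte
  have ht0 : π t = 0 := hW.transversal_subset ht
  have htψ : t ∈ ψ.source := by rw [← hte']; exact ψ.param_mem ha hη₀
  have hth : ψ.hor t = a' := by rw [← hte']; exact ψ.hor_param ha hη₀
  have htv : ψ.ver t = η₀ := by rw [← hte']; exact ψ.ver_param ha hη₀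
  obtain ⟨φ, f, V, Y, B, hts, htV, htY, hf0, -, -⟩ :=
    exists_isRegularBox hr g hW.pos (hW.regular t ht0) (univ_mem : univ ∈ 𝓝 t)
  have hφ := B.mem_atlas
  obtain ⟨D, hD⟩ := B.exists_symDist_le hr
  obtain ⟨ρ, hρ, X, Yf, hXY⟩ := (hψ φ hφ).1.exists_ball htψ hts
  obtain ⟨ρ', hρ', hB⟩ := ψ.exists_ball_param_mem htψ (B.mem_nhds hts htV htY)
  rw [hth, htv] at hXY hB
  have hN : {z | (z ∈ φ.source ∧ φ.hor z ∈ V ∧ φ.ver z ∈ Y) ∧ z ∈ ψ.source ∧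
      ψ.hor z ∈ _root_.Metric.ball a' ρ ∧ ψ.ver z ∈ _root_.Metric.ball η₀ ρ ∧
      ψ.ver z ∈ _root_.Metric.ball η₀ ρ'} ∈ 𝓝 t := by
    refine inter_mem (B.mem_nhds hts htV htY) (inter_mem (ψ.source_mem_nhds htψ)
      (inter_mem ?_ (inter_mem ?_ ?_)))
    · exact (ψ.continuousAt_hor htψ) (by rw [hth]; exact _root_.Metric.ball_mem_nhds _ hρ)
    · exact (ψ.continuousAt_ver htψ) (by rw [htv]; exact _root_.Metric.ball_mem_nhds _ hρ)
    · exact (ψ.continuousAt_ver htψ) (by rw [htv]; exact _root_.Metric.ball_mem_nhds _ hρ')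
  -- The flow-box `ψ` of the transversal is only compatible with the atlas; its heights determine
  -- those of the chart `φ` of the atlas.
  have hver : ∀ z, z ∈ ψ.source → ψ.hor z ∈ _root_.Metric.ball a' ρ →
      ψ.ver z ∈ _root_.Metric.ball η₀ ρ → φ.ver z = Yf (ψ.ver z) := by
    intro z hz1 hz2 hz3
    have := (hXY _ hz2 _ hz3 (ψ.ver_mem hz1)).2.2.2.1
    rwa [ψ.param_hor hz1] at this
  refine ⟨φ, hφ, hts, _, hN, fun z => ψ.param (ψ.ver z) a', D, ?_⟩
  rintro z ⟨⟨hzs, hzV, hzY⟩, hzψ, hz1, hz2, hz3⟩ h0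
  have hzKψ := ψ.ver_mem hzψ
  have hzK := φ.ver_mem hzs
  have hzz := φ.param_hor hzs
  set w := ψ.param (ψ.ver z) a' with hw
  have hwT : w ∈ T := hTψ _ hzKψ
  have hwψ : w ∈ ψ.source := ψ.param_mem ha hzKψ
  obtain ⟨hws, hwV, hwY⟩ := (hB a' (_root_.Metric.mem_ball_self hρ') _ hz3 hzKψ).2
  have hwv : φ.ver w = φ.ver z := by
    have hw1 : ψ.hor w = a' := ψ.hor_param ha hzKψ
    have hw2 : ψ.ver w = ψ.ver z := ψ.ver_param ha hzKψ
    have h1 : ψ.hor w ∈ _root_.Metric.ball a' ρ := by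
      rw [hw1]; exact _root_.Metric.mem_ball_self hρ
    have h2 : ψ.ver w ∈ _root_.Metric.ball η₀ ρ := by rwa [hw2]
    rw [hver z hzψ hz1 hz2, hver w hwψ h1 h2, hw2]
  have hww : φ.param (φ.ver z) (φ.hor w) = w := by rw [← hwv]; exact φ.param_hor hws
  have hfw : f (φ.hor w, φ.ver z) = 0 := by
    rw [← B.eq_zero_iff hε hwV hzY hzK, hww]
    exact hW.transversal_subset hwT
  have hfz : f (φ.hor z, φ.ver z) ≠ 0 := by
    rw [ne_eq, ← B.eq_zero_iff hε hzV hzY hzK, hzz]; exact h0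
  refine ⟨hwT, ?_, ?_, ?_⟩
  · rcases hfz.lt_or_gt with h | h
    · have := B.mem_leafClosure_neg hε hwV hzY hzK hfw hzV h
      rw [hww, hzz] at this
      exact leafClosure_mono inter_subset_left this
    · have := B.mem_leafClosure_pos hε hwV hzY hzK hfw hzV h
      rw [hww, hzz] at this
      exact leafClosure_mono inter_subset_left this
  · have := hD _ hzY hzK _ hzV _ hwV
    rwa [hzz, hww] at this
  · rintro z' ⟨-, hzψ', hz1', hz2', -⟩ - he
    rw [hver z hzψ hz1 hz2, hver z' hzψ' hz1' hz2']
    congr 1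
    have : ψ.ver (ψ.param (ψ.ver z) a') = ψ.ver (ψ.param (ψ.ver z') a') := congrArg ψ.ver he
    rwa [ψ.ver_param ha hzKψ, ψ.ver_param ha (ψ.ver_mem hzψ')] at this

/-- The component of `q` in the zero set contains a point of `T`, and regular boxes propagate
goodness between neighbouring zeros of a connected set. -/
lemma isGood_of_zero (hq : π q = 0) : IsGood g π T q := by
  have hε := hW.lt_half
  obtain ⟨t, ⟨htC, htT⟩, -⟩ := hW.component q hq
  have hC : IsPreconnected (α := 𝒮.Lf) (𝒮.leafComponentIn (π ⁻¹' {0}) q) :=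
    isPreconnected_connectedComponentIn (α := 𝒮.Lf)
  have hsub : ∀ z ∈ 𝒮.leafComponentIn (π ⁻¹' {0}) q, π z = 0 :=
    fun z hz => connectedComponentIn_subset (α := 𝒮.Lf) _ _ hz
  refine (hC.induction₂ (fun a b : S => IsGood g π T a ↔ IsGood g π T b) ?_ ?_ ?_ htC
    (mem_connectedComponentIn (α := 𝒮.Lf) hq)).1 (isGood_of_mem_transversal g hr hW htT)
  · intro (a : S) ha
    have ha0 := hsub a ha
    obtain ⟨φ, f, V, Y, B, has, haV, haY, hf0, -, -⟩ :=
      exists_isRegularBox hr g hW.pos (hW.regular a ha0) (univ_mem : univ ∈ 𝓝 a)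
    have hev := (eventually_ver_eq B.mem_atlas has).and
      ((tendsto_hor (𝒮 := 𝒮) has) (B.isOpen_V.mem_nhds haV))
    filter_upwards [hev.filter_mono (@nhdsWithin_le_nhds S 𝒮.leafTopology a _),
      @self_mem_nhdsWithin S 𝒮.leafTopology a _] with b hb hbC
    obtain ⟨⟨hbs, hbv⟩, hbV⟩ := hb
    have hb0 := hsub b hbC
    exact ⟨B.isGood_of_zero hr hε has hbs haV hbV haY hbv ha0,
      B.isGood_of_zero hr hε hbs has hbV haV (by rwa [hbv]) hbv.symm hb0⟩
  · exact fun a b c _ _ _ h h' => h.trans h'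
  · exact fun a b _ _ h => h.symm

/-- All points have transports of the nearby points to the transversal. -/
theorem isGood (p : S) : IsGood g π T p := by
  have hε := hW.lt_half
  by_cases hp : π p = 0
  · exact isGood_of_zero g hr hW hp
  have hL := isPiece_piece (𝒮 := 𝒮) hp
  obtain ⟨x, y, hxy⟩ := hW.ends _ hL
  obtain ⟨⟨hxT, hxL⟩, -⟩ := HasEnds.sides hL hxy
  have hx0 : π x = 0 := hW.transversal_subset hxT
  obtain ⟨φ, f, V, Y, B, hxs, hxV, hxY, -, -, -⟩ :=
    exists_isRegularBox hr g hW.pos (hW.regular x hx0) (univ_mem : univ ∈ 𝓝 x)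
  have hev := (eventually_ver_eq B.mem_atlas hxs).and
      ((tendsto_hor (𝒮 := 𝒮) hxs) (B.isOpen_V.mem_nhds hxV))
  -- Goodness passes from the end `x` to a nearby point `q` inside the piece, and then along the
  -- connected piece to `p`.
  obtain ⟨q, hqL, ⟨hqs, hqv⟩, hqV⟩ :=
    ((mem_leafClosure_iff.1 hxL.mem_leafClosure).and_eventually hev).exists
  have hq : IsGood g π T q := B.isGood_of_zero hr hε hxs hqs hxV hqV hxY hqv hx0
    (isGood_of_zero g hr hW hx0)
  have hpL : p ∈ 𝒮.piece π p := mem_piece_self hp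
  refine (hL.isPreconnected.induction₂ (fun a b : S => IsGood g π T a ↔ IsGood g π T b) ?_ ?_ ?_
    hqL hpL).1 hq
  · intro (a : S) ha
    have ha0 : π a ≠ 0 := hL.ne_zero (z := a) ha
    have h := eventually_isGood_iff (𝒮 := 𝒮) (T := T) g hr hW.continuous ha0
    exact h.filter_mono (@nhdsWithin_le_nhds S 𝒮.leafTopology a _)
  · exact fun a b c _ _ _ h h' => h.trans h'
  · exact fun a b _ _ h => h.symm

end Trapping

end Solenoid
end
noncomputable section

/-! ### Uniform bounds for the pieces. -/

namespace Solenoid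

variable {k l : ℕ} {r s : WithTop ℕ∞} {S : Type*} [TopologicalSpace S]
variable {𝒮 : Solenoid k l r s S} {p q z : S} {π : S → UnitAddCircle} {ε₀ : ℝ} {L L' : Set S}
  {W T : Set S}

variable (g : 𝒮.Metric) (hr : 1 ≤ r) (hW : 𝒮.IsTrappingRegion W π T ε₀)
include g hr hW

/-- The neighbourhood supplied by `isGood` is shrunk so that each point lies in the compact part `E`
of its local leaf, of bounded volume and diameter. -/
lemma exists_goodBox (p : S) : ∃ φ ∈ 𝒮.atlas, ∃ N ∈ 𝓝 p, ∃ (E : Set (Euc k)) (τ : S → S)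
    (D : ℝ) (M : ℝ≥0∞), N ⊆ φ.source ∧ IsCompact E ∧ E ⊆ openDisk k ∧ M ≠ ⊤ ∧
    (∀ z ∈ N, φ.hor z ∈ E) ∧
    (∀ z ∈ N, ∀ x ∈ E, g.symDist (φ.param (φ.ver z) x) z ≤ ENNReal.ofReal D) ∧
    (∀ z ∈ N, g.vol (φ.param (φ.ver z) '' E) ≤ M) ∧
    ∀ z ∈ N, π z ≠ 0 →
      τ z ∈ T ∧ τ z ∈ 𝒮.leafClosure (𝒮.piece π z) ∧ g.symDist z (τ z) ≤ ENNReal.ofReal D ∧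
      ∀ z' ∈ N, π z' ≠ 0 → τ z = τ z' → φ.ver z = φ.ver z' := by
  obtain ⟨φ, hφ, hp, N₁, hN₁, τ, D, hτ⟩ := isGood g hr hW p
  obtain ⟨N₂, hN₂, c, -, C, -, hdens⟩ := g.exists_dens_bounds hφ hp
  obtain ⟨ρ, hρ, c', hc', C', hC', hb⟩ := g.exists_ball_bounds hφ hp hN₂
  set E := _root_.Metric.closedBall (φ.hor p) (ρ / 2) with hE
  have hEb : E ⊆ _root_.Metric.ball (φ.hor p) ρ :=
    _root_.Metric.closedBall_subset_ball (half_lt_self hρ)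
  have hED : E ⊆ openDisk k := fun x hx => (hb x (hEb hx) _ (_root_.Metric.mem_ball_self hρ)
    (φ.ver_mem hp)).1
  have hEc : IsCompact E := isCompact_closedBall _ _
  set N := N₁ ∩ (φ.source ∩ (φ.hor ⁻¹' E ∩ φ.ver ⁻¹' _root_.Metric.ball (φ.ver p) ρ)) with hN
  have hNp : N ∈ 𝓝 p := by
    refine inter_mem hN₁ (inter_mem (φ.source_mem_nhds hp) (inter_mem ?_ ?_))
    · exact (φ.continuousAt_hor hp) (_root_.Metric.closedBall_mem_nhds _ (half_pos hρ))
    · exact (φ.continuousAt_ver hp) (_root_.Metric.ball_mem_nhds _ hρ)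
  refine ⟨φ, hφ, N, hNp, E, τ, max D (C' * 2), ENNReal.ofReal C * volume E, fun z hz => hz.2.1,
    hEc, hED, ?_, fun z hz => hz.2.2.1, ?_, ?_, ?_⟩
  · exact ENNReal.mul_ne_top ENNReal.ofReal_ne_top hEc.measure_lt_top.ne
  · rintro z ⟨-, hzs, hzE, hzv⟩ x hx
    have h1 := g.symDist_param_le hr hφ (φ.ver_mem hzs) (convex_closedBall (φ.hor p) (ρ / 2)) hED
      (fun x hx v => ((hb x (hEb hx) _ hzv (φ.ver_mem hzs)).2.2 v).2) hx hzE
    rw [φ.param_hor hzs] at h1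
    refine h1.trans (ENNReal.ofReal_le_ofReal (le_trans ?_ (le_max_right _ _)))
    exact mul_le_mul_of_nonneg_left (norm_sub_le_two (hED hx) (φ.hor_mem hzs)) hC'.le
  · rintro z ⟨-, hzs, hzE, hzv⟩
    have hzK := φ.ver_mem hzs
    refine (g.vol_le_plaqueVolume hφ hzK (image_mono hED)).trans ?_
    have hset : {x | x ∈ openDisk k ∧ φ.param (φ.ver z) x ∈ φ.param (φ.ver z) '' E} = E := by
      ext x
      constructor
      · rintro ⟨hx, x', hx', he⟩
        rwa [← φ.hor_param hx hzK, ← he, φ.hor_param (hED hx') hzK]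
      · exact fun hx => ⟨hED hx, mem_image_of_mem _ hx⟩
    rw [hset]
    exact g.boxVol_le hEc.measurableSet fun x hx =>
      (hdens _ (hb x (hEb hx) _ hzv hzK).2.1).2
  · rintro z ⟨hz, -⟩ h0
    obtain ⟨h1, h2, h3, h4⟩ := hτ z hz h0
    exact ⟨h1, h2, h3.trans (ENNReal.ofReal_le_ofReal (le_max_left _ _)),
      fun z' hz' => h4 z' hz'.1⟩

/-- The closures of the pieces are compact, of uniformly bounded volume, and at bounded distance
from their ends. -/
theorem exists_piece_bounds [CompactSpace S] [T2Space S] : ∃ (D : ℝ) (M : ℝ≥0∞), M ≠ ⊤ ∧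
    ∀ L, 𝒮.IsPiece π L → ∀ x y, 𝒮.HasEnds π T ε₀ L x y →
      IsCompact (X := 𝒮.Lf) (𝒮.leafClosure L) ∧ g.vol (𝒮.leafClosure L) ≤ M ∧
      ∀ z ∈ 𝒮.leafClosure L, g.symDist z x ≤ ENNReal.ofReal D ∨
        g.symDist z y ≤ ENNReal.ofReal D := by
  choose φ hφ N hN E τ D M hNs hEc hED hM hNE hdist hvol hτ using exists_goodBox g hr hW
  obtain ⟨t, ht⟩ := CompactSpace.elim_nhds_subcover N hN
  obtain ⟨D', hD'⟩ := (t.image D).exists_le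
  have hD'' : ∀ p ∈ t, D p ≤ max D' 0 := fun p hp =>
    (hD' _ (Finset.mem_image_of_mem _ hp)).trans (le_max_left _ _)
  refine ⟨max D' 0 + max D' 0, ∑ p ∈ t, (M p + M p), ?_, fun L hL x y hxy => ?_⟩
  · exact (ENNReal.sum_lt_top.2 fun p _ => ENNReal.add_lt_top.2
      ⟨(hM p).lt_top, (hM p).lt_top⟩).ne
  set Q : S → S → Set S := fun p e =>
    -- The compact parts of local leaves through the points of `L ∩ N p` transported to `e`. As the
    -- transport separates heights, there is at most one such local leaf, so `Q p e` is empty or a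
    -- single compact set.
    {w | ∃ z ∈ N p, z ∈ L ∧ τ p z = e ∧ w ∈ (φ p).param ((φ p).ver z) '' E p} with hQ
  have hQe : ∀ p e, IsCompact (X := 𝒮.Lf) (Q p e) ∧ g.vol (Q p e) ≤ M p := by
    intro p e
    by_cases hne : ∃ z ∈ N p, z ∈ L ∧ τ p z = e
    · obtain ⟨z, hz, hzL, hze⟩ := hne
      have h1 : Q p e = (φ p).param ((φ p).ver z) '' E p := by
        ext w
        constructor
        · rintro ⟨z', hz', hzL', hze', hw⟩
          rwa [(hτ p z hz (hL.ne_zero hzL)).2.2.2 z' hz' (hL.ne_zero hzL') (hze.trans hze'.symm)]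
        · exact fun hw => ⟨z, hz, hzL, hze, hw⟩
      rw [h1]
      exact ⟨isCompact_param_image (hφ p) ((φ p).ver_mem (hNs p hz)) (hEc p) (hED p),
        hvol p z hz⟩
    · have h1 : Q p e = ∅ := by
        refine eq_empty_of_forall_notMem ?_
        rintro w ⟨z, hz, hzL, hze, -⟩
        exact hne ⟨z, hz, hzL, hze⟩
      rw [h1]
      exact ⟨isCompact_empty (X := 𝒮.Lf), by simp⟩
  have hQd : ∀ p ∈ t, ∀ e, ∀ w ∈ Q p e, g.symDist w e ≤ ENNReal.ofReal (max D' 0 + max D' 0) := by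
    rintro p hp e w ⟨z, hz, hzL, rfl, x, hx, rfl⟩
    refine (g.symDist_triangle _ z _).trans ?_
    rw [ENNReal.ofReal_add (le_max_right _ _) (le_max_right _ _)]
    exact add_le_add ((hdist p z hz x hx).trans (ENNReal.ofReal_le_ofReal (hD'' p hp)))
      ((hτ p z hz (hL.ne_zero hzL)).2.2.1.trans (ENNReal.ofReal_le_ofReal (hD'' p hp)))
  -- A transport target in the closure of `L` can only be `x` or `y`, so these finitely many compact
  -- sets cover `L`, and being closed they cover its closure.
  set K : Set S := ⋃ p ∈ t, (Q p x ∪ Q p y) with hK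
  have hKc : IsCompact (X := 𝒮.Lf) K :=
    t.isCompact_biUnion (X := 𝒮.Lf) fun p _ => (hQe p x).1.union (hQe p y).1
  have hLK : L ⊆ K := by
    intro z hz
    have h1 : z ∈ ⋃ p ∈ t, N p := by rw [ht]; trivial
    obtain ⟨p, hp, hzp⟩ := mem_iUnion₂.1 h1
    have hz0 := hL.ne_zero hz
    obtain ⟨hT, hcl, -, -⟩ := hτ p z hzp hz0
    have hmem : τ p z ∈ 𝒮.leafClosure L ∩ T := by
      refine ⟨?_, hT⟩
      rwa [hL.eq_piece hz]
    rw [hxy.1] at hmem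
    have hw : z ∈ (φ p).param ((φ p).ver z) '' E p :=
      ⟨_, hNE p z hzp, (φ p).param_hor (hNs p hzp)⟩
    refine mem_biUnion hp ?_
    rcases hmem with h | h
    · exact Or.inl ⟨z, hzp, hz, h, hw⟩
    · exact Or.inr ⟨z, hzp, hz, h, hw⟩
  have hclK : 𝒮.leafClosure L ⊆ K := closure_minimal (X := 𝒮.Lf) hLK hKc.isClosed
  refine ⟨hKc.of_isClosed_subset (isClosed_closure (X := 𝒮.Lf)) hclK, ?_, fun z hz => ?_⟩
  · calc g.vol (𝒮.leafClosure L) ≤ g.vol K := measure_mono hclK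
      _ ≤ ∑ p ∈ t, g.vol (Q p x ∪ Q p y) := measure_biUnion_finset_le _ _
      _ ≤ ∑ p ∈ t, (M p + M p) := Finset.sum_le_sum fun p _ =>
        (measure_union_le _ _).trans (add_le_add (hQe p x).2 (hQe p y).2)
  · obtain ⟨p, hp, h | h⟩ := mem_iUnion₂.1 (hclK hz)
    · exact Or.inl (hQd p hp x z h)
    · exact Or.inr (hQd p hp y z h)

/-- The closures of the pieces have uniformly bounded diameter. -/
theorem exists_piece_diam [CompactSpace S] [T2Space S] : ∃ D : ℝ, 0 ≤ D ∧
    ∀ L, 𝒮.IsPiece π L → ∀ z ∈ 𝒮.leafClosure L, ∀ z' ∈ 𝒮.leafClosure L,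
      g.symDist z z' ≤ ENNReal.ofReal D := by
  obtain ⟨D₀, M, -, h⟩ := exists_piece_bounds g hr hW
  set D := max D₀ 0 with hD
  have hD0 : 0 ≤ D := le_max_right _ _
  refine ⟨4 * (D + 1), by positivity, fun L hL => ?_⟩
  obtain ⟨x, y, hxy⟩ := hW.ends L hL
  obtain ⟨-, -, hd⟩ := h L hL x y hxy
  -- Enlarging the radius by `1` puts all points at distance at most `D₀` from `e` in an open set.
  set u : S → Set S := fun e => 𝒮.leafInterior {z | g.symDist z e ≤ ENNReal.ofReal (D + 1)} with hu
  have hmem : ∀ z e, g.symDist z e ≤ ENNReal.ofReal D₀ → z ∈ u e := by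
    intro z e hze
    refine (@mem_interior_iff_mem_nhds S 𝒮.leafTopology z _).2 ?_
    filter_upwards [g.eventually_symDist_le hr z one_pos] with w hw
    refine (g.symDist_triangle w z e).trans ?_
    rw [add_comm D, ENNReal.ofReal_add zero_le_one hD0, g.symDist_comm w z]
    exact add_le_add hw (hze.trans (ENNReal.ofReal_le_ofReal (le_max_left _ _)))
  have hu_le : ∀ z e, z ∈ u e → g.symDist z e ≤ ENNReal.ofReal (D + 1) := fun z e hz =>
    interior_subset (X := 𝒮.Lf) hz
  have hD1 : 0 ≤ D + 1 := by positivity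
  have hsame : ∀ e z z', g.symDist z e ≤ ENNReal.ofReal (D + 1) →
      g.symDist z' e ≤ ENNReal.ofReal (D + 1) → g.symDist z z' ≤ ENNReal.ofReal (2 * (D + 1)) := by
    intro e z z' h1 h2
    refine (g.symDist_triangle z e z').trans ?_
    rw [g.symDist_comm e z', two_mul, ENNReal.ofReal_add hD1 hD1]
    exact add_le_add h1 h2
  have hcov : ∀ z ∈ 𝒮.leafClosure L, z ∈ u x ∪ u y := fun z hz =>
    (hd z hz).imp (hmem z x) (hmem z y)
  have hmono : ENNReal.ofReal (2 * (D + 1)) ≤ ENNReal.ofReal (4 * (D + 1)) :=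
    ENNReal.ofReal_le_ofReal (by linarith)
  have hconn : IsPreconnected (α := 𝒮.Lf) (𝒮.leafClosure L) := hL.isPreconnected.closure
  intro z hz z' hz'
  have hcross : ∀ z ∈ 𝒮.leafClosure L, ∀ z' ∈ 𝒮.leafClosure L, z ∈ u x → z' ∈ u y →
      g.symDist z z' ≤ ENNReal.ofReal (4 * (D + 1)) := by
    intro z hz z' hz' hzx hzy
    -- Two open sets covering the connected closure of `L` and both meeting it have a common point
    -- `w` there; two points on different sides are compared through `x`, `w` and `y`, which gives
    -- the constant `4 * (D + 1)`.
    obtain ⟨w, hwL, hwx, hwy⟩ := hconn (u x) (u y) (isOpen_interior (X := 𝒮.Lf))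
      (isOpen_interior (X := 𝒮.Lf)) hcov ⟨z, hz, hzx⟩ ⟨z', hz', hzy⟩
    refine (g.symDist_triangle z w z').trans ?_
    have h4 : 4 * (D + 1) = 2 * (D + 1) + 2 * (D + 1) := by ring
    rw [h4, ENNReal.ofReal_add (by positivity) (by positivity)]
    exact add_le_add (hsame x z w (hu_le _ _ hzx) (hu_le _ _ hwx))
      (hsame y w z' (hu_le _ _ hwy) (hu_le _ _ hzy))
  rcases hcov z hz with h1 | h1 <;> rcases hcov z' hz' with h2 | h2
  · exact (hsame x z z' (hu_le _ _ h1) (hu_le _ _ h2)).trans hmono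
  · exact hcross z hz z' hz' h1 h2
  · rw [g.symDist_comm]
    exact hcross z' hz' z hz h2 h1
  · exact (hsame y z z' (hu_le _ _ h1) (hu_le _ _ h2)).trans hmono

/-- Each piece contains an open part of a local leaf of volume bounded from below. -/
theorem exists_piece_volume [CompactSpace S] : ∃ v : ℝ≥0∞, v ≠ 0 ∧
    ∀ L, 𝒮.IsPiece π L → ∃ φ ∈ 𝒮.atlas, ∃ y ∈ φ.K, ∃ Q : Set (Euc k), IsOpen Q ∧
      Q ⊆ openDisk k ∧ φ.param y '' Q ⊆ L ∧ v ≤ g.boxVol φ y Q := by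
  have hε := hW.lt_half
  -- Every piece is the negative side of its first end, so a bound for negative sides of zeros
  -- suffices; it is local in `S` and follows by compactness.
  suffices ∃ v : ℝ≥0∞, v ≠ 0 ∧ ∀ q ∈ (univ : Set S), π q = 0 → ∀ L, 𝒮.IsNegSide π ε₀ q L →
      ∃ φ ∈ 𝒮.atlas, ∃ y ∈ φ.K, ∃ Q : Set (Euc k), IsOpen Q ∧
      Q ⊆ openDisk k ∧ φ.param y '' Q ⊆ L ∧ v ≤ g.boxVol φ y Q by
    obtain ⟨v, hv, h⟩ := this
    refine ⟨v, hv, fun L hL => ?_⟩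
    obtain ⟨x, y, hxy⟩ := hW.ends L hL
    obtain ⟨⟨hxT, hxL⟩, -⟩ := HasEnds.sides hL hxy
    exact h x (mem_univ _) (hW.transversal_subset hxT) L hxL
  refine isCompact_univ.induction_on (p := fun A : Set S => ∃ v : ℝ≥0∞, v ≠ 0 ∧ ∀ q ∈ A,
      π q = 0 → ∀ L, 𝒮.IsNegSide π ε₀ q L → ∃ φ ∈ 𝒮.atlas, ∃ y ∈ φ.K, ∃ Q : Set (Euc k),
      IsOpen Q ∧ Q ⊆ openDisk k ∧ φ.param y '' Q ⊆ L ∧ v ≤ g.boxVol φ y Q) ?_ ?_ ?_ ?_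
  · exact ⟨1, one_ne_zero, fun q hq => hq.elim⟩
  · rintro A A' hAA' ⟨v, hv, h⟩
    exact ⟨v, hv, fun q hq => h q (hAA' hq)⟩
  · rintro A A' ⟨v, hv, h⟩ ⟨v', hv', h'⟩
    refine ⟨min v v', fun h0 => ?_, ?_⟩
    · rcases min_choice v v' with h1 | h1 <;> rw [h1] at h0 <;> contradiction
    · rintro q (hq | hq) h0 L hL
      · obtain ⟨φ, hφ, y, hy, Q, h1, h2, h3, h4⟩ := h q hq h0 L hL
        exact ⟨φ, hφ, y, hy, Q, h1, h2, h3, (min_le_left _ _).trans h4⟩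
      · obtain ⟨φ, hφ, y, hy, Q, h1, h2, h3, h4⟩ := h' q hq h0 L hL
        exact ⟨φ, hφ, y, hy, Q, h1, h2, h3, (min_le_right _ _).trans h4⟩
  · intro p _
    rw [nhdsWithin_univ]
    by_cases hp : π p = 0
    · obtain ⟨φ, f, V, Y, B, hps, hpV, hpY, -, -, -⟩ :=
        exists_isRegularBox hr g hW.pos (hW.regular p hp) (univ_mem : univ ∈ 𝓝 p)
      obtain ⟨c, ρ, hρ, hball⟩ := B.exists_ball
      obtain ⟨c', hc', C, hC, hb⟩ := B.exists_bounds
      refine ⟨_, B.mem_nhds hps hpV hpY, ENNReal.ofReal c' * volume (_root_.Metric.ball c ρ),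
        ?_, ?_⟩
      · exact mul_ne_zero (by simpa using hc') (_root_.Metric.measure_ball_pos _ _ hρ).ne'
      · rintro q ⟨hqs, hqV, hqY⟩ h0 L hL
        have hqK := φ.ver_mem hqs
        have hqq := φ.param_hor hqs
        have hsub := hball _ hqY
        have hcm := hsub (_root_.Metric.mem_ball_self hρ)
        refine ⟨φ, B.mem_atlas, φ.ver q, hqK, _root_.Metric.ball c ρ, _root_.Metric.isOpen_ball,
          fun x hx => B.V_sub (hsub hx).1, ?_, ?_⟩
        · have hfq : f (φ.hor q, φ.ver q) = 0 := by
            rw [← B.eq_zero_iff hε hqV hqY hqK, hqq, h0]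
          have hne : ∀ x ∈ _root_.Metric.ball c ρ, π (φ.param (φ.ver q) x) ≠ 0 := by
            intro x hx
            rw [ne_eq, B.eq_zero_iff hε (hsub hx).1 hqY hqK]
            exact (hsub hx).2.ne
          have h1 := B.mem_leafClosure_neg hε hqV hqY hqK hfq hcm.1 hcm.2
          rw [hqq] at h1
          have hcn := hne c (_root_.Metric.mem_ball_self hρ)
          -- By uniqueness of the negative side, `L` is the piece containing the ball on which `f <
          -- 0`.
          rw [hL.eq g hr hW h0 ⟨isPiece_piece hcn, h1⟩]
          rintro _ ⟨x, hx, rfl⟩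
          rw [B.piece_eq_of_neg hε hcm.1 (hsub hx).1 hqY hqK hcm.2 (hsub hx).2]
          exact mem_piece_self (hne x hx)
        · exact g.le_boxVol _root_.Metric.isOpen_ball.measurableSet fun x hx =>
            (hb x (hsub hx).1 _ hqY hqK).1
    · refine ⟨_, (isOpen_compl_singleton.preimage hW.continuous).mem_nhds
        (show p ∈ π ⁻¹' {0}ᶜ from hp), 1, one_ne_zero, fun q hq h0 => (hq h0).elim⟩

/-- Finitely many pieces have a definite volume. -/
theorem exists_volume_lower [CompactSpace S] : ∃ v : ℝ≥0∞, v ≠ 0 ∧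
    ∀ (I : Finset (Set S)) (A : Set S), (∀ L ∈ I, 𝒮.IsPiece π L ∧ L ⊆ A) →
      I.card * v ≤ g.vol A := by
  obtain ⟨v, hv, h⟩ := exists_piece_volume g hr hW
  refine ⟨v, hv, fun I A hI => ?_⟩
  choose φ hφ y hy Q hQ hQD hQL hvQ using fun L : I => h L.1 (hI L.1 L.2).1
  have h1 := g.sum_boxVol_le_vol hr φ hφ y hy Q hQ hQD ?_ (A := A)
    fun L => (hQL L).trans (hI L.1 L.2).2
  · refine le_trans ?_ h1
    calc (I.card : ℝ≥0∞) * v = ∑ _L : I, v := by simp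
      _ ≤ _ := Finset.sum_le_sum fun L _ => hvQ L
  · intro L L' hne
    refine disjoint_left.2 fun z hz hz' => hne (Subtype.ext ?_)
    exact (hI L.1 L.2).1.eq_of_mem (hI L'.1 L'.2).1 (hQL L hz) (hQL L' hz')

end Solenoid
end
noncomputable section

/-! ### Chains of pieces -/

namespace Solenoid

variable {k l : ℕ} {r s : WithTop ℕ∞} {S : Type*} [TopologicalSpace S]
variable {𝒮 : Solenoid k l r s S} {p q z : S} {π : S → UnitAddCircle} {ε₀ : ℝ}
  {W T : Set S} {x : ℤ → S} {L : ℤ → Set S} {i j : ℤ}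

variable (𝒮 π T ε₀) in
/-- Consecutive pieces `L j`, going from `x j` to `x (j + 1)`. -/
structure IsChain (x : ℤ → S) (L : ℤ → Set S) : Prop where
  isPiece : ∀ j, 𝒮.IsPiece π (L j)
  hasEnds : ∀ j, 𝒮.HasEnds π T ε₀ (L j) (x j) (x (j + 1))

lemma HasEnds.eq_of_isNegSide {L : Set S} {a b t : S} (h : 𝒮.HasEnds π T ε₀ L a b) (ht : t ∈ T)
    (hL : 𝒮.IsNegSide π ε₀ t L) : t = a := h.2.1.subset ⟨hL.2, ht⟩

lemma HasEnds.eq_of_isPosSide {L : Set S} {a b t : S} (h : 𝒮.HasEnds π T ε₀ L a b) (ht : t ∈ T)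
    (hL : 𝒮.IsPosSide π ε₀ t L) : t = b := h.2.2.subset ⟨hL.2, ht⟩

namespace IsChain

lemma isNegSide (h : 𝒮.IsChain π ε₀ T x L) (j : ℤ) : x j ∈ T ∧ 𝒮.IsNegSide π ε₀ (x j) (L j) :=
  (HasEnds.sides (h.isPiece j) (h.hasEnds j)).1

lemma isPosSide (h : 𝒮.IsChain π ε₀ T x L) (j : ℤ) : 𝒮.IsPosSide π ε₀ (x (j + 1)) (L j) :=
  (HasEnds.sides (h.isPiece j) (h.hasEnds j)).2.2

lemma isPosSide_pred (h : 𝒮.IsChain π ε₀ T x L) (j : ℤ) : 𝒮.IsPosSide π ε₀ (x j) (L (j - 1)) := by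
  simpa using h.isPosSide (j - 1)

lemma eq_of_piece_eq (h : 𝒮.IsChain π ε₀ T x L) (hij : L i = L j) : x i = x j :=
  (h.hasEnds j).eq_of_isNegSide (h.isNegSide i).1 (hij ▸ (h.isNegSide i).2)

end IsChain

section Trapping

variable (g : 𝒮.Metric) (hr : 1 ≤ r) (hW : 𝒮.IsTrappingRegion W π T ε₀)
include g hr hW

/-- The first return map of the transversal. -/
lemma exists_return : ∃ (e : T ≃ T) (M : T → Set S),
    ∀ t : T, 𝒮.IsPiece π (M t) ∧ 𝒮.HasEnds π T ε₀ (M t) t (e t) := by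
  have h0 : ∀ t : T, π t = 0 := fun t => hW.transversal_subset t.2
  have hex : ∀ t : T, ∃ (M : Set S) (u : T), 𝒮.IsPiece π M ∧ 𝒮.HasEnds π T ε₀ M t u := by
    intro t
    -- A piece going from `t` is on the negative side of `t`, which determines it; dually, a piece
    -- arriving at a point is on its positive side, which gives bijectivity.
    obtain ⟨Lm, -, hm, -, -⟩ := exists_sides_unique g hr hW (h0 t)
    have hLm := (hm Lm).2 rfl
    obtain ⟨a, b, hab⟩ := hW.ends Lm hLm.1
    have hs := HasEnds.sides hLm.1 hab
    obtain rfl := hab.eq_of_isNegSide t.2 hLm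
    exact ⟨Lm, ⟨b, hs.2.1⟩, hLm.1, hab⟩
  choose M u hM hu using hex
  refine ⟨Equiv.ofBijective u ⟨fun t t' htt => ?_, fun b => ?_⟩, M, fun t => ⟨hM t, hu t⟩⟩
  · have h1 := (HasEnds.sides (hM t) (hu t)).2.2
    have h2 := (HasEnds.sides (hM t') (hu t')).2.2
    rw [htt] at h1
    have h3 := (HasEnds.sides (hM t) (hu t)).1
    rw [h1.eq g hr hW (h0 _) h2] at h3
    exact Subtype.ext ((hu t').eq_of_isNegSide h3.1 h3.2)
  · obtain ⟨-, Lp, -, hp, -⟩ := exists_sides_unique g hr hW (h0 b)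
    have hLp := (hp Lp).2 rfl
    obtain ⟨a, c, hac⟩ := hW.ends Lp hLp.1
    obtain ⟨ha, -⟩ := HasEnds.sides hLp.1 hac
    obtain rfl := hac.eq_of_isPosSide b.2 hLp
    refine ⟨⟨a, ha.1⟩, Subtype.ext ?_⟩
    have h1 := (HasEnds.sides (hM ⟨a, ha.1⟩) (hu ⟨a, ha.1⟩)).1.2
    have h2 := (HasEnds.sides (hM ⟨a, ha.1⟩) (hu ⟨a, ha.1⟩)).2
    rw [h1.eq g hr hW (h0 ⟨a, ha.1⟩) ha.2] at h2
    exact hac.eq_of_isPosSide h2.1 h2.2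

namespace IsChain

variable (h : 𝒮.IsChain π ε₀ T x L)
include h

/-- The sides of `q` are those of the point of `T` in its zero component. Having `L j` on the
negative side forces that point to be `x j`, and so does having `L (j - 1)` on the positive side. -/
lemma isNegSide_iff (hq : π q = 0) :
    𝒮.IsNegSide π ε₀ q (L j) ↔ 𝒮.IsPosSide π ε₀ q (L (j - 1)) := by
  obtain ⟨t, ⟨htC, htT⟩, -⟩ := hW.component q hq
  rw [(sides_iff g hr hW htC hq).1, (sides_iff g hr hW htC hq).2]
  constructor
  · intro hL
    rw [(h.hasEnds j).eq_of_isNegSide htT hL]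
    exact h.isPosSide_pred j
  · intro hL
    have := (h.hasEnds (j - 1)).eq_of_isPosSide htT hL
    rw [sub_add_cancel] at this
    rw [this]
    exact (h.isNegSide j).2

lemma eventually_sides (hq : π q = 0) (hj : 𝒮.IsNegSide π ε₀ q (L j)) :
    ∀ᶠ z in 𝒮.nhdsL q, (π z ∈ arc (-ε₀) 0 ∧ z ∈ L j) ∨ (π z ∈ arc 0 ε₀ ∧ z ∈ L (j - 1)) ∨
      (π z = 0 ∧ 𝒮.IsNegSide π ε₀ z (L j)) := by
  obtain ⟨Lm, Lp, hm, hp, hev⟩ := exists_sides_unique g hr hW hq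
  rw [← (hm _).1 hj, ← (hp _).1 ((h.isNegSide_iff g hr hW hq).1 hj)] at hev
  filter_upwards [hev] with z hz
  tauto

lemma exists_isNegSide (hq : π q = 0) (hmem : q ∈ ⋃ j, 𝒮.leafClosure (L j)) :
    ∃ j, 𝒮.IsNegSide π ε₀ q (L j) := by
  obtain ⟨j, hj⟩ := mem_iUnion.1 hmem
  rcases (h.isPiece j).side_of_mem_leafClosure g hr hW hq hj with h' | h'
  · exact ⟨j, h'⟩
  · exact ⟨j + 1, (h.isNegSide_iff g hr hW hq).2 (by simpa using h')⟩

omit g hr in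
lemma exists_mem (hq : π q ≠ 0) (hmem : q ∈ ⋃ j, 𝒮.leafClosure (L j)) : ∃ j, q ∈ L j := by
  obtain ⟨j, hj⟩ := mem_iUnion.1 hmem
  exact ⟨j, (h.isPiece j).mem_of_mem_leafClosure hW.continuous hj hq⟩

/-- The chain contains the two sides of each of its zeros, which gives openness. A zero adherent to
the union has on one of its sides, or on the negative side of a nearby zero, a piece of the chain.
-/
lemma isClopen : IsClopen (X := 𝒮.Lf) (⋃ j, 𝒮.leafClosure (L j)) := by
  constructor
  · refine isClosed_of_closure_subset (X := 𝒮.Lf) fun (q : S) hq => ?_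
    have hq' : ∃ᶠ z in 𝒮.nhdsL q, z ∈ ⋃ j, 𝒮.leafClosure (L j) := mem_leafClosure_iff.1 hq
    by_cases h0 : π q = 0
    · obtain ⟨Lm, Lp, hm, hp, hev⟩ := exists_sides_unique g hr hW h0
      have hLm := (hm Lm).2 rfl
      have hLp := (hp Lp).2 rfl
      obtain ⟨z, hz, hzs⟩ := (hq'.and_eventually hev).exists
      rcases hzs with ⟨hz0, hzL⟩ | ⟨hz0, hzL⟩ | ⟨hz0, hzL, -⟩
      · obtain ⟨j, hj⟩ := h.exists_mem hW (hLm.1.ne_zero hzL) hz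
        rw [hLm.1.eq_of_mem (h.isPiece j) hzL hj] at hLm
        exact mem_iUnion.2 ⟨j, hLm.mem_leafClosure⟩
      · obtain ⟨j, hj⟩ := h.exists_mem hW (hLp.1.ne_zero hzL) hz
        rw [hLp.1.eq_of_mem (h.isPiece j) hzL hj] at hLp
        exact mem_iUnion.2 ⟨j, hLp.mem_leafClosure⟩
      · obtain ⟨j, hj⟩ := h.exists_isNegSide g hr hW hz0 hz
        rw [hzL.eq g hr hW hz0 hj] at hLm
        exact mem_iUnion.2 ⟨j, hLm.mem_leafClosure⟩
    · have hP := isPiece_piece (𝒮 := 𝒮) h0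
      have hev : ∀ᶠ z in 𝒮.nhdsL q, z ∈ 𝒮.piece π q := eventually_mem_piece hW.continuous h0
      obtain ⟨z, hz, hzq⟩ := (hq'.and_eventually hev).exists
      obtain ⟨j, hj⟩ := h.exists_mem hW (hP.ne_zero hzq) hz
      have hqj : q ∈ L j := by
        rw [(h.isPiece j).eq_of_mem hP hj hzq]
        exact mem_piece_self h0
      exact mem_iUnion.2 ⟨j, subset_leafClosure (𝒮 := 𝒮) hqj⟩
  · refine (isOpen_iff_mem_nhds (X := 𝒮.Lf)).2 fun (q : S) hq => ?_
    change ∀ᶠ z in 𝒮.nhdsL q, z ∈ ⋃ j, 𝒮.leafClosure (L j)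
    by_cases h0 : π q = 0
    · obtain ⟨j, hj⟩ := h.exists_isNegSide g hr hW h0 hq
      filter_upwards [h.eventually_sides g hr hW h0 hj] with z hz
      rcases hz with hz | hz | hz
      · exact mem_iUnion.2 ⟨j, subset_leafClosure hz.2⟩
      · exact mem_iUnion.2 ⟨j - 1, subset_leafClosure hz.2⟩
      · exact mem_iUnion.2 ⟨j, hz.2.mem_leafClosure⟩
    · obtain ⟨j, hj⟩ := h.exists_mem hW h0 hq
      have h1 : L j ∈ 𝒮.nhdsL q := ((h.isPiece j).isOpen hW.continuous).mem_nhds hj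
      filter_upwards [h1] with z hz
      exact mem_iUnion.2 ⟨j, subset_leafClosure hz⟩

/-- Consecutive closures share the point `x (j + 1)`, so the union is connected; being also open and
closed it is the component of `x i`. -/
lemma leaf_eq (i : ℤ) (hi : x i ∈ 𝒮.leaf p) : 𝒮.leaf p = ⋃ j, 𝒮.leafClosure (L j) := by
  have h1 : 𝒮.leaf p = 𝒮.leaf (x i) := connectedComponent_eq (α := 𝒮.Lf) hi
  have hmem : x i ∈ ⋃ j, 𝒮.leafClosure (L j) :=
    mem_iUnion.2 ⟨i, (h.isNegSide i).2.mem_leafClosure⟩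
  rw [h1]
  refine Subset.antisymm ((h.isClopen g hr hW).connectedComponent_subset hmem) ?_
  refine IsPreconnected.subset_connectedComponent (α := 𝒮.Lf) ?_ hmem
  refine IsPreconnected.iUnion_of_chain (α := 𝒮.Lf)
    (fun j => (h.isPiece j).isPreconnected.closure) fun j => ?_
  exact ⟨x (j + 1), (h.isPosSide j).mem_leafClosure, (h.isNegSide (j + 1)).2.mem_leafClosure⟩

end IsChain

/-- Every leaf is the union of a chain of closures of pieces, whose ends are either pairwise
distinct or periodic. -/
theorem exists_isChain (p : S) : ∃ x L, 𝒮.IsChain π ε₀ T x L ∧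
    𝒮.leaf p = ⋃ j, 𝒮.leafClosure (L j) ∧
    (L.Injective ∨ ∃ m : ℤ, 0 < m ∧ ∀ i, L (i + m) = L i) := by
  obtain ⟨e, M, hM⟩ := exists_return g hr hW
  obtain ⟨t, htT, htp⟩ := hW.transversal.2 p
  set u : ℤ → T := fun j => (e ^ j : Equiv.Perm T) ⟨t, htT⟩ with hu
  have hu1 : ∀ j, u (j + 1) = e (u j) := fun j => by
    simp only [hu]
    rw [add_comm j 1, zpow_one_add]
    rfl
  have hch : 𝒮.IsChain π ε₀ T (fun j => (u j : S)) fun j => M (u j) :=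
    ⟨fun j => (hM _).1, fun j => by simp only [hu1]; exact (hM _).2⟩
  refine ⟨_, _, hch, hch.leaf_eq g hr hW 0 (by simpa [hu] using htp), ?_⟩
  refine or_iff_not_imp_left.2 fun hinj => ?_
  obtain ⟨i, j, hij, hlt⟩ : ∃ i j, M (u i) = M (u j) ∧ i < j := by
    simp only [Function.Injective] at hinj
    push Not at hinj
    obtain ⟨i, j, hij, hne⟩ := hinj
    rcases lt_or_gt_of_ne hne with h | h
    · exact ⟨i, j, hij, h⟩
    · exact ⟨j, i, hij.symm, h⟩
  -- A repeated piece has the same starting point, and a repetition in the orbit of a permutation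
  -- makes the orbit periodic.
  have hue : u i = u j := Subtype.ext (hch.eq_of_piece_eq hij)
  refine ⟨j - i, by lia, fun n => ?_⟩
  have h1 : ∀ n m : ℤ, u (n + m) = (e ^ n : Equiv.Perm T) (u m) := fun n m => by
    simp only [hu, zpow_add]
    rfl
  have h2 : u (n + (j - i)) = u n := by
    rw [show n + (j - i) = (n - i) + j by ring, h1, ← hue, ← h1, sub_add_cancel]
  rw [h2]

end Trapping

end Solenoid
end
noncomputable section

/-! ### The height function of an infinite chain -/

namespace Solenoid

/-- A function on the circle that vanishes away from `0`, with a jump of height `1` at `0`. -/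
def bump (ε : ℝ) : UnitAddCircle → ℝ :=
  AddCircle.liftIco 1 (-(1 / 2)) fun u =>
    (if 0 < u then 1 else 0) - Real.smoothTransition ((u + ε) / (2 * ε))

lemma bump_coe (ε : ℝ) {u : ℝ} (hu : u ∈ Ico (-(1 / 2) : ℝ) (1 / 2)) :
    bump ε (u : UnitAddCircle) =
      (if 0 < u then 1 else 0) - Real.smoothTransition ((u + ε) / (2 * ε)) :=
  AddCircle.liftIco_coe_apply (by norm_num at hu ⊢; exact hu)

lemma exists_coe_eq (a : UnitAddCircle) :
    ∃ u ∈ Ico (-(1 / 2) : ℝ) (1 / 2), (u : UnitAddCircle) = a := by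
  have : Fact ((0 : ℝ) < 1) := ⟨one_pos⟩
  obtain ⟨u, hu, h⟩ := AddCircle.coe_image_Ico_eq (p := (1 : ℝ)) (-(1 / 2)) ▸ mem_univ a
  exact ⟨u, by norm_num at hu ⊢; exact hu, h⟩

lemma abs_bump_le (ε : ℝ) (a : UnitAddCircle) : |bump ε a| ≤ 1 := by
  obtain ⟨u, hu, rfl⟩ := exists_coe_eq a
  rw [bump_coe ε hu]
  have h0 := Real.smoothTransition.nonneg ((u + ε) / (2 * ε))
  have h1 := Real.smoothTransition.le_one ((u + ε) / (2 * ε))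
  rw [abs_le]
  split_ifs <;> constructor <;> linarith

lemma bump_zero_nonpos (ε : ℝ) : bump ε 0 ≤ 0 := by
  have := bump_coe ε (u := 0) (by norm_num)
  rw [AddCircle.coe_zero] at this
  rw [this]
  simpa using Real.smoothTransition.nonneg _

lemma bump_eq_zero {ε : ℝ} (hε : 0 < ε) {a : UnitAddCircle}
    (ha : a ∉ (fun t : ℝ => (t : UnitAddCircle)) '' Icc (-ε) ε) : bump ε a = 0 := by
  obtain ⟨u, hu, rfl⟩ := exists_coe_eq a
  have hu' : u ∉ Icc (-ε) ε := fun h => ha (mem_image_of_mem _ h)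
  rw [bump_coe ε hu]
  rcases lt_or_ge u (-ε) with h | h
  · rw [if_neg (by linarith), Real.smoothTransition.zero_of_nonpos, sub_zero]
    exact div_nonpos_of_nonpos_of_nonneg (by linarith) (by linarith)
  · have h2 : ε < u := by
      by_contra! h2
      exact hu' ⟨h, h2⟩
    rw [if_pos (by linarith), Real.smoothTransition.one_of_one_le, sub_self]
    rw [le_div_iff₀ (by linarith)]
    linarith

variable {k l : ℕ} {r s : WithTop ℕ∞} {S : Type*} [TopologicalSpace S]
variable {𝒮 : Solenoid k l r s S} {p q z : S} {π : S → UnitAddCircle} {ε₀ : ℝ}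
  {W T : Set S} {x : ℤ → S} {L : ℤ → Set S} {i j : ℤ}

variable (𝒮 π ε₀ L) in
/-- The position in a chain of the piece through a point, or on the negative side of a zero. -/
def chainIdx (q : S) : ℤ :=
  Classical.epsilon fun j => q ∈ L j ∨ (π q = 0 ∧ 𝒮.IsNegSide π ε₀ q (L j))

namespace IsChain

lemma chainIdx_of_mem (h : 𝒮.IsChain π ε₀ T x L) (hL : L.Injective) (hq : q ∈ L j) :
    𝒮.chainIdx π ε₀ L q = j := by
  rcases Classical.epsilon_spec
    (p := fun j => q ∈ L j ∨ (π q = 0 ∧ 𝒮.IsNegSide π ε₀ q (L j))) ⟨j, Or.inl hq⟩ with h1 | h1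
  · exact hL ((h.isPiece _).eq_of_mem (h.isPiece j) h1 hq)
  · exact ((h.isPiece j).ne_zero hq h1.1).elim

section Trapping

variable (g : 𝒮.Metric) (hr : 1 ≤ r) (hW : 𝒮.IsTrappingRegion W π T ε₀)
  (h : 𝒮.IsChain π ε₀ T x L) (hL : L.Injective)
include g hr hW h hL

lemma chainIdx_of_isNegSide (hq : π q = 0) (hj : 𝒮.IsNegSide π ε₀ q (L j)) :
    𝒮.chainIdx π ε₀ L q = j := by
  rcases Classical.epsilon_spec
    (p := fun j => q ∈ L j ∨ (π q = 0 ∧ 𝒮.IsNegSide π ε₀ q (L j))) ⟨j, Or.inr ⟨hq, hj⟩⟩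
    with h1 | h1
  · exact ((h.isPiece _).ne_zero h1 hq).elim
  · exact hL (h1.2.eq g hr hW hq hj)

/-- The height stays close to the position in the chain. -/
lemma abs_height_sub_le (ε : ℝ) (hq : q ∈ 𝒮.leafClosure (L j)) :
    |(𝒮.chainIdx π ε₀ L q + bump ε (π q)) - j| ≤ 1 := by
  have hb := abs_le.1 (abs_bump_le ε (π q))
  by_cases h0 : π q = 0
  · rcases (h.isPiece j).side_of_mem_leafClosure g hr hW h0 hq with h' | h'
    · rw [h.chainIdx_of_isNegSide g hr hW hL h0 h', abs_le]
      constructor <;> linarith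
    -- Here the index of `q` is `j + 1`, and the bound survives because `bump` takes a value in
    -- `[-1, 0]` at `0`.
    · have h1 := (h.isNegSide_iff g hr hW (j := j + 1) h0).2 (by simpa using h')
      have h2 := bump_zero_nonpos ε
      rw [h.chainIdx_of_isNegSide g hr hW hL h0 h1, abs_le]
      rw [h0] at hb ⊢
      push_cast
      constructor <;> linarith
  · rw [h.chainIdx_of_mem hL ((h.isPiece j).mem_of_mem_leafClosure hW.continuous hq h0), abs_le]
    constructor <;> linarith

omit g hr in
lemma eventually_chainIdx_eq (hq : π q ≠ 0) (hmem : q ∈ ⋃ j, 𝒮.leafClosure (L j)) :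
    ∀ᶠ z in 𝒮.nhdsL q, 𝒮.chainIdx π ε₀ L z = 𝒮.chainIdx π ε₀ L q := by
  obtain ⟨j, hj⟩ := h.exists_mem hW hq hmem
  have h1 : L j ∈ 𝒮.nhdsL q := ((h.isPiece j).isOpen hW.continuous).mem_nhds hj
  filter_upwards [h1] with z hz
  rw [h.chainIdx_of_mem hL hz, h.chainIdx_of_mem hL hj]

/-- In a regular box, the height is a constant minus a function of the lift of `π`. -/
lemma exists_height_eq {φ : FlowBox k l S} {f : Euc k × Euc l → ℝ} {V : Set (Euc k)}
    {Y : Set (Euc l)} (B : IsRegularBox g π ε₀ φ f V Y) (ε : ℝ) (hqs : q ∈ φ.source)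
    (hqV : φ.hor q ∈ V) (hqY : φ.ver q ∈ Y) (hmem : q ∈ ⋃ j, 𝒮.leafClosure (L j)) :
    ∃ c : ℝ, ∀ᶠ z in 𝒮.nhdsL q, 𝒮.chainIdx π ε₀ L z + bump ε (π z) =
      c - Real.smoothTransition ((f (φ.hor z, φ.ver q) + ε) / (2 * ε)) := by
  have hε := hW.lt_half
  have hyK := φ.ver_mem hqs
  set y := φ.ver q
  have hV : ∀ᶠ z in 𝒮.nhdsL q, φ.hor z ∈ V := (tendsto_hor hqs).eventually (B.isOpen_V.mem_nhds hqV)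
  have hbox : ∀ᶠ z in 𝒮.nhdsL q, φ.hor z ∈ V ∧ z = φ.param y (φ.hor z) := by
    filter_upwards [hV, eventually_ver_eq B.mem_atlas hqs] with z hzV hz
    refine ⟨hzV, ?_⟩
    conv_lhs => rw [← φ.param_hor hz.1, hz.2]
  have hbump : ∀ x ∈ V, bump ε (π (φ.param y x)) = (if 0 < f (x, y) then 1 else 0) -
      Real.smoothTransition ((f (x, y) + ε) / (2 * ε)) := by
    intro x hx
    have := abs_lt.1 (B.abs_lt x hx y hqY)
    rw [B.lift x hx y hqY hyK, bump_coe ε ⟨by linarith, by linarith⟩]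
  -- When the lift becomes positive the index drops by one, and the jump of `bump` makes up for it.
  suffices hc : ∃ c : ℝ, ∀ᶠ z in 𝒮.nhdsL q,
      𝒮.chainIdx π ε₀ L z + (if 0 < f (φ.hor z, y) then 1 else 0) = c by
    obtain ⟨c, hc⟩ := hc
    refine ⟨c, ?_⟩
    filter_upwards [hc, hbox] with z hz ⟨hzV, he⟩
    have := hbump _ hzV
    rw [← he] at this
    rw [this, ← hz]
    ring
  by_cases h0 : π q = 0
  · obtain ⟨j, hj⟩ := h.exists_isNegSide g hr hW h0 hmem
    refine ⟨j, ?_⟩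
    filter_upwards [hbox, h.eventually_sides g hr hW h0 hj] with z ⟨hzV, he⟩ hz
    have hp := B.mem_arc_pos_iff hε hzV hqY hyK
    have hn := B.mem_arc_neg_iff hε hzV hqY hyK
    have hz0 := B.eq_zero_iff hε hzV hqY hyK
    rw [← he] at hp hn hz0
    rcases hz with ⟨h1, h2⟩ | ⟨h1, h2⟩ | ⟨h1, h2⟩
    · rw [h.chainIdx_of_mem hL h2, if_neg (not_lt.2 (hn.1 h1).le), add_zero]
    · rw [h.chainIdx_of_mem hL h2, if_pos (hp.1 h1)]
      push_cast
      ring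
    · rw [h.chainIdx_of_isNegSide g hr hW hL h1 h2, if_neg (hz0.1 h1).not_gt, add_zero]
  · have hf0 : f (φ.hor q, y) ≠ 0 := by
      have hz0 := B.eq_zero_iff hε hqV hqY hyK
      rw [φ.param_hor hqs] at hz0
      exact fun h => h0 (hz0.2 h)
    have hcont : Tendsto (fun z => f (φ.hor z, y)) (𝒮.nhdsL q) (𝓝 (f (φ.hor q, y))) :=
      (((B.contDiffOn y hqY).continuousOn.continuousAt (B.isOpen_V.mem_nhds hqV)).tendsto).comp
        (tendsto_hor hqs)
    refine ⟨𝒮.chainIdx π ε₀ L q + (if 0 < f (φ.hor q, y) then 1 else 0), ?_⟩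
    rcases hf0.lt_or_gt with hlt | hlt
    · filter_upwards [h.eventually_chainIdx_eq hW hL h0 hmem, hcont.eventually_lt_const hlt]
        with z h1 h2
      rw [h1, if_neg h2.not_gt, if_neg hlt.not_gt]
    · filter_upwards [h.eventually_chainIdx_eq hW hL h0 hmem, hcont.eventually_const_lt hlt]
        with z h1 h2
      rw [h1, if_pos h2, if_pos hlt]

end Trapping

end IsChain

section Trapping

variable [CompactSpace S]
variable (g : 𝒮.Metric) (hr : 1 ≤ r) (hW : 𝒮.IsTrappingRegion W π T ε₀)
include g hr hW

/-- Regular boxes with uniform bounds cover a neighbourhood of the zeros of `π`. -/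
lemma exists_isRegularBox_cover : ∃ ε > 0, ∃ C : ℝ, 0 ≤ C ∧
    ∀ q, π q ∈ (fun t : ℝ => (t : UnitAddCircle)) '' Icc (-ε) ε →
      ∃ φ f V Y, IsRegularBox g π ε₀ φ f V Y ∧ q ∈ φ.source ∧ φ.hor q ∈ V ∧ φ.ver q ∈ Y ∧
        ∀ v, ‖fderiv ℝ (fun x => f (x, φ.ver q)) (φ.hor q)‖ * ‖v‖ ≤
          C * Real.sqrt (g.g φ q v v) := by
  set Q : ℝ → S → Prop := fun C q => ∃ φ f V Y, IsRegularBox g π ε₀ φ f V Y ∧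
    q ∈ φ.source ∧ φ.hor q ∈ V ∧ φ.ver q ∈ Y ∧
      ∀ v, ‖fderiv ℝ (fun x => f (x, φ.ver q)) (φ.hor q)‖ * ‖v‖ ≤
        C * Real.sqrt (g.g φ q v v) with hQ
  have hQmono : ∀ {C C' q}, C ≤ C' → Q C q → Q C' q := by
    rintro C C' q hC ⟨φ, f, V, Y, B, h1, h2, h3, h4⟩
    exact ⟨φ, f, V, Y, B, h1, h2, h3, fun v => (h4 v).trans
      (mul_le_mul_of_nonneg_right hC (Real.sqrt_nonneg _))⟩
  have hZ : IsCompact (π ⁻¹' {0}) := (isClosed_singleton.preimage hW.continuous).isCompact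
  obtain ⟨G, hG, hZG, C, hC0, hC⟩ : ∃ G : Set S, IsOpen G ∧ π ⁻¹' {0} ⊆ G ∧
      ∃ C : ℝ, 0 ≤ C ∧ ∀ q ∈ G, Q C q := by
    refine hZ.induction_on ⟨∅, isOpen_empty, Subset.rfl, 0, le_rfl, by simp⟩ ?_ ?_ ?_
    · rintro A A' hA ⟨G, h1, h2, h3⟩
      exact ⟨G, h1, hA.trans h2, h3⟩
    · rintro A A' ⟨G, h1, h2, C, h0, h3⟩ ⟨G', h1', h2', C', h0', h3'⟩
      refine ⟨G ∪ G', h1.union h1', union_subset_union h2 h2', max C C',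
        h0.trans (le_max_left _ _), ?_⟩
      rintro q (hq | hq)
      · exact hQmono (le_max_left _ _) (h3 q hq)
      · exact hQmono (le_max_right _ _) (h3' q hq)
    · intro q hq
      obtain ⟨φ, f, V, Y, B, hqs, hqV, hqY, -, -, -⟩ :=
        exists_isRegularBox hr g hW.pos (hW.regular q hq) (univ_mem : univ ∈ 𝓝 q)
      obtain ⟨Cf, hCf⟩ := B.exists_grad
      obtain ⟨c, hc, C, -, hb⟩ := B.exists_bounds
      obtain ⟨G, hGsub, hGo, hqG⟩ := mem_nhds_iff.1 (B.mem_nhds hqs hqV hqY)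
      refine ⟨G, mem_nhdsWithin_of_mem_nhds (hGo.mem_nhds hqG), G, hGo, Subset.rfl,
        max Cf 0 / c, by positivity, fun z hz => ?_⟩
      obtain ⟨hzs, hzV, hzY⟩ := hGsub hz
      refine ⟨φ, f, V, Y, B, hzs, hzV, hzY, fun v => ?_⟩
      have h1 := ((hb _ hzV _ hzY (φ.ver_mem hzs)).2 v).1
      rw [φ.param_hor hzs] at h1
      have h2 := (hCf _ hzV _ hzY).trans (le_max_left Cf 0)
      calc _ ≤ max Cf 0 * ‖v‖ := mul_le_mul_of_nonneg_right h2 (norm_nonneg _)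
        _ = max Cf 0 / c * (c * ‖v‖) := by field_simp
        _ ≤ _ := mul_le_mul_of_nonneg_left h1 (by positivity)
  have hcl : IsClosed (π '' Gᶜ) := (hG.isClosed_compl.isCompact.image hW.continuous).isClosed
  have h0 : (0 : UnitAddCircle) ∉ π '' Gᶜ := by
    rintro ⟨q, hq, h⟩
    exact hq (hZG h)
  -- The image under `π` of the complement of `G` is compact and misses `0`, so it misses a small
  -- arc around `0`; the preimage of this arc is in `G`.
  have hev : ∀ᶠ t : ℝ in 𝓝 0, (t : UnitAddCircle) ∉ π '' Gᶜ :=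
    (AddCircle.continuous_mk' 1).continuousAt.eventually (hcl.isOpen_compl.mem_nhds h0)
  obtain ⟨ε, hε, he⟩ := _root_.Metric.nhds_basis_closedBall.eventually_iff.1 hev
  refine ⟨ε, hε, C, hC0, fun q ⟨t, ht, htq⟩ => hC q ?_⟩
  by_contra hq
  refine he (x := t) ?_ ⟨q, hq, htq.symm⟩
  rw [Real.closedBall_eq_Icc]
  simpa using ht

/-- The height along an infinite chain. -/
theorem IsChain.exists_height (h : 𝒮.IsChain π ε₀ T x L) (hL : L.Injective)
    (hp : 𝒮.leaf p = ⋃ j, 𝒮.leafClosure (L j)) :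
    ∃ (C : ℝ) (H : S → ℝ), 0 ≤ C ∧ g.IsLip p C H ∧
      ∀ j, ∀ q ∈ 𝒮.leafClosure (L j), |H q - j| ≤ 1 := by
  obtain ⟨ε, hε, C, hC0, hC⟩ := exists_isRegularBox_cover g hr hW
  set σ : ℝ → ℝ := fun u => Real.smoothTransition ((u + ε) / (2 * ε)) with hσ
  have hσd : ContDiff ℝ 1 σ := Real.smoothTransition.contDiff.comp
    ((contDiff_id.add contDiff_const).div_const _)
  -- In a regular box the lift has absolute value less than `ε₀ < 1 / 2`, so a bound of the
  -- derivative of `σ` on `[-1, 1]` is enough.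
  obtain ⟨M, hM⟩ := (isCompact_Icc (a := (-1 : ℝ)) (b := 1)).exists_bound_of_continuousOn
    (hσd.continuous_deriv le_rfl).continuousOn
  have hM0 : 0 ≤ M := (norm_nonneg _).trans (hM 0 (by norm_num))
  refine ⟨M * C, fun q => 𝒮.chainIdx π ε₀ L q + bump ε (π q), by positivity, ?_,
    fun j q hq => h.abs_height_sub_le g hr hW hL ε hq⟩
  intro γ hγ hγ0 t ht
  have hmem : γ t ∈ ⋃ j, 𝒮.leafClosure (L j) := hp ▸ hγ.mem_leaf ht hγ0
  have hself : ∀ {P : S → Prop}, (∀ᶠ z in 𝒮.nhdsL (γ t), P z) → P (γ t) :=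
    fun hP => Eventually.self_of_nhds (X := 𝒮.Lf) hP
  by_cases hin : π (γ t) ∈ (fun t : ℝ => (t : UnitAddCircle)) '' Icc (-ε) ε
  · obtain ⟨φ, f, V, Y, B, hqs, hqV, hqY, hb⟩ := hC _ hin
    obtain ⟨c, hc⟩ := h.exists_height_eq g hr hW hL B ε hqs hqV hqY hmem
    have hr0 : r ≠ 0 := fun h0 => by simp [h0] at hr
    have hf : HasFDerivAt (fun x => f (x, φ.ver (γ t)))
        (fderiv ℝ (fun x => f (x, φ.ver (γ t))) (φ.hor (γ t))) (φ.hor (γ t)) :=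
      (((B.contDiffOn _ hqY).contDiffAt (B.isOpen_V.mem_nhds hqV)).differentiableAt hr0).hasFDerivAt
    set v := derivWithin (fun τ => φ.hor (γ τ)) (Icc (0 : ℝ) 1) t with hv
    have hγd : HasDerivWithinAt (fun τ => φ.hor (γ τ)) v (Icc (0 : ℝ) 1) t :=
      ((hγ.contDiffWithinAt ht B.mem_atlas hqs).differentiableWithinAt one_ne_zero).hasDerivWithinAt
    have hu := abs_lt.1 (B.abs_lt _ hqV _ hqY)
    have hε1 := hW.lt_half
    set u := f (φ.hor (γ t), φ.ver (γ t)) with hu_def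
    have hσ' : HasDerivAt σ (deriv σ u) u :=
      (hσd.differentiable one_ne_zero).differentiableAt.hasDerivAt
    have hd1 := hf.comp_hasDerivWithinAt t hγd
    have hd2 := (hσ'.comp_hasDerivWithinAt t hd1).const_sub c
    refine ⟨_, hd2.congr_of_eventuallyEq ((hγ.tendsto ht).eventually hc) (hself hc), ?_⟩
    have hspd : g.spd γ t = Real.sqrt (g.g φ (γ t) v v) :=
      g.speed_eq hγ ht (𝒮.boxAt_mem _) B.mem_atlas (𝒮.mem_boxAt _) hqs hr
    rw [abs_neg, abs_mul, hspd, mul_assoc]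
    refine mul_le_mul (hM u ⟨by linarith, by linarith⟩) ?_ (abs_nonneg _) hM0
    exact (ContinuousLinearMap.le_opNorm _ v).trans (hb v)
  -- Away from the arc `bump` vanishes and the index is locally constant, so the derivative is `0`.
  · have hcl : IsClosed ((fun t : ℝ => (t : UnitAddCircle)) '' Icc (-ε) ε) :=
      (isCompact_Icc.image (AddCircle.continuous_mk' 1)).isClosed
    have h0 : π (γ t) ≠ 0 := fun h0 => hin ⟨0, by simp [hε.le], by simp [h0]⟩
    have hout : ∀ᶠ z in 𝒮.nhdsL (γ t), π z ∉ (fun t : ℝ => (t : UnitAddCircle)) '' Icc (-ε) ε :=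
      (nhdsL_le (𝒮 := 𝒮) (p := γ t)) ((hcl.isOpen_compl.preimage hW.continuous).mem_nhds hin)
    have hc : ∀ᶠ z in 𝒮.nhdsL (γ t), 𝒮.chainIdx π ε₀ L z + bump ε (π z) =
        (𝒮.chainIdx π ε₀ L (γ t) : ℝ) := by
      filter_upwards [hout, h.eventually_chainIdx_eq hW hL h0 hmem] with z h1 h2
      rw [h2, bump_eq_zero hε h1, add_zero]
    refine ⟨0, (hasDerivWithinAt_const t (Icc (0 : ℝ) 1) _).congr_of_eventuallyEq
      ((hγ.tendsto ht).eventually hc) (hself hc), ?_⟩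
    rw [abs_zero]
    exact mul_nonneg (by positivity) (g.spd_nonneg _ _)

end Trapping

end Solenoid
end
noncomputable section

/-! ### Finite unions of consecutive closed pieces -/

namespace Solenoid

variable {k l : ℕ} {r s : WithTop ℕ∞} {S : Type*} [TopologicalSpace S]
variable {𝒮 : Solenoid k l r s S} {p q z : S} {π : S → UnitAddCircle} {ε₀ : ℝ}
  {W T : Set S} {x : ℤ → S} {L : ℤ → Set S} {i j : ℤ}

lemma isOpen_arc (a b : ℝ) : IsOpen (arc a b) :=
  QuotientAddGroup.isOpenMap_coe _ isOpen_Ioo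

lemma IsTrappingRegion.isOpen (hW : 𝒮.IsTrappingRegion W π T ε₀) : IsOpen W := by
  rw [hW.eq_preimage]
  exact (isOpen_arc _ _).preimage hW.continuous

lemma IsTrappingRegion.mem_of_eq_zero (hW : 𝒮.IsTrappingRegion W π T ε₀) (hq : π q = 0) :
    q ∈ W := by
  rw [hW.eq_preimage, mem_preimage, hq]
  exact ⟨0, ⟨neg_lt_zero.2 hW.pos, hW.pos⟩, by simp⟩

section Trapping

variable (g : 𝒮.Metric) (hr : 1 ≤ r) (hW : 𝒮.IsTrappingRegion W π T ε₀)

namespace IsRegularBox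

variable {φ : FlowBox k l S} {f : Euc k × Euc l → ℝ} {V : Set (Euc k)} {Y : Set (Euc l)}
  {g} (B : IsRegularBox g π ε₀ φ f V Y) {M : Set S} {u : Euc k}
include hr hW B

/-- By uniqueness of sides, `M` is the piece of every point of the local leaf with `f < 0`; the
zeros of the local leaf are adherent to it. -/
lemma mem_of_isNegSide (hqs : q ∈ φ.source) (hqV : φ.hor q ∈ V) (hqY : φ.ver q ∈ Y)
    (hq : π q = 0) (hM : 𝒮.IsNegSide π ε₀ q M) (hu : u ∈ V) :
    (f (u, φ.ver q) < 0 → φ.param (φ.ver q) u ∈ M) ∧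
      (f (u, φ.ver q) = 0 → φ.param (φ.ver q) u ∈ 𝒮.leafClosure M) := by
  have hε := hW.lt_half
  have hyK := φ.ver_mem hqs
  have hf0 : f (φ.hor q, φ.ver q) = 0 := by
    rw [← B.eq_zero_iff hε hqV hqY hyK, φ.param_hor hqs]
    exact hq
  have key : ∀ u ∈ V, f (u, φ.ver q) < 0 → M = 𝒮.piece π (φ.param (φ.ver q) u) ∧
      π (φ.param (φ.ver q) u) ≠ 0 := by
    intro u hu hneg
    have h0 : π (φ.param (φ.ver q) u) ≠ 0 := by
      rw [ne_eq, B.eq_zero_iff hε hu hqY hyK]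
      exact hneg.ne
    have h1 := B.mem_leafClosure_neg hε hqV hqY hyK hf0 hu hneg
    rw [φ.param_hor hqs] at h1
    exact ⟨hM.eq g hr hW hq ⟨isPiece_piece h0, h1⟩, h0⟩
  refine ⟨fun hneg => ?_, fun h0 => ?_⟩
  · rw [(key u hu hneg).1]
    exact mem_piece_self (key u hu hneg).2
  · obtain ⟨w, hwV, hw⟩ := closure_nonempty_iff.1 ⟨_, B.mem_closure_neg _ hqY _ hu h0⟩
    rw [(key w hwV hw).1]
    exact leafClosure_mono inter_subset_left (B.mem_leafClosure_neg hε hu hqY hyK h0 hwV hw)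

lemma mem_of_isPosSide (hqs : q ∈ φ.source) (hqV : φ.hor q ∈ V) (hqY : φ.ver q ∈ Y)
    (hq : π q = 0) (hM : 𝒮.IsPosSide π ε₀ q M) (hu : u ∈ V) :
    (0 < f (u, φ.ver q) → φ.param (φ.ver q) u ∈ M) ∧
      (f (u, φ.ver q) = 0 → φ.param (φ.ver q) u ∈ 𝒮.leafClosure M) := by
  have hε := hW.lt_half
  have hyK := φ.ver_mem hqs
  have hf0 : f (φ.hor q, φ.ver q) = 0 := by
    rw [← B.eq_zero_iff hε hqV hqY hyK, φ.param_hor hqs]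
    exact hq
  have key : ∀ u ∈ V, 0 < f (u, φ.ver q) → M = 𝒮.piece π (φ.param (φ.ver q) u) ∧
      π (φ.param (φ.ver q) u) ≠ 0 := by
    intro u hu hpos
    have h0 : π (φ.param (φ.ver q) u) ≠ 0 := by
      rw [ne_eq, B.eq_zero_iff hε hu hqY hyK]
      exact hpos.ne'
    have h1 := B.mem_leafClosure_pos hε hqV hqY hyK hf0 hu hpos
    rw [φ.param_hor hqs] at h1
    exact ⟨hM.eq g hr hW hq ⟨isPiece_piece h0, h1⟩, h0⟩
  refine ⟨fun hpos => ?_, fun h0 => ?_⟩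
  · rw [(key u hu hpos).1]
    exact mem_piece_self (key u hu hpos).2
  · obtain ⟨w, hwV, hw⟩ := closure_nonempty_iff.1 ⟨_, B.mem_closure_pos _ hqY _ hu h0⟩
    rw [(key w hwV hw).1]
    exact leafClosure_mono inter_subset_left (B.mem_leafClosure_pos hε hu hqY hyK h0 hwV hw)

end IsRegularBox

namespace IsChain

variable (h : 𝒮.IsChain π ε₀ T x L) (I : Finset ℤ)
include g hr hW h

/-- The points of the boundary of a finite union of closed pieces are zeros with the union on
exactly one side. -/
lemma side_of_mem_leafBoundary [CompactSpace S] [T2Space S]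
    (hq : q ∈ 𝒮.leafBoundary (⋃ j ∈ I, 𝒮.leafClosure (L j))) :
    π q = 0 ∧ ∃ i, 𝒮.IsNegSide π ε₀ q (L i) ∧ 𝒮.IsPosSide π ε₀ q (L (i - 1)) ∧
      (((∃ j ∈ I, L j = L i) ∧ ¬ ∃ j ∈ I, L j = L (i - 1)) ∨
        ((¬ ∃ j ∈ I, L j = L i) ∧ ∃ j ∈ I, L j = L (i - 1))) := by
  have hcl : IsClosed (X := 𝒮.Lf) (⋃ j ∈ I, 𝒮.leafClosure (L j)) :=
    isClosed_biUnion_finset fun j _ => isClosed_closure (X := 𝒮.Lf)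
  have hqU : q ∈ ⋃ j ∈ I, 𝒮.leafClosure (L j) := hcl.frontier_subset hq
  have hint : ¬ ∀ᶠ z in 𝒮.nhdsL q, z ∈ ⋃ j ∈ I, 𝒮.leafClosure (L j) := fun hev =>
    hq.2 ((mem_interior_iff_mem_nhds (X := 𝒮.Lf)).2 hev)
  have hsub : ∀ j ∈ I, ∀ z ∈ 𝒮.leafClosure (L j), z ∈ ⋃ j ∈ I, 𝒮.leafClosure (L j) :=
    fun j hj z hz => mem_iUnion₂.2 ⟨j, hj, hz⟩
  obtain ⟨j, hjI, hj⟩ := mem_iUnion₂.1 hqU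
  have h0 : π q = 0 := by
    by_contra h0
    refine hint ?_
    have hqL := (h.isPiece j).mem_of_mem_leafClosure hW.continuous hj h0
    have h1 : L j ∈ 𝒮.nhdsL q := ((h.isPiece j).isOpen hW.continuous).mem_nhds hqL
    exact mem_of_superset h1 fun (z : S) hz => hsub j hjI z (subset_leafClosure hz)
  obtain ⟨i, hi⟩ := h.exists_isNegSide g hr hW h0 (mem_iUnion.2 ⟨j, hj⟩)
  have hi' := (h.isNegSide_iff g hr hW h0).1 hi
  refine ⟨h0, i, hi, hi', ?_⟩
  have hor : (∃ j ∈ I, L j = L i) ∨ ∃ j ∈ I, L j = L (i - 1) := by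
    rcases (h.isPiece j).side_of_mem_leafClosure g hr hW h0 hj with h' | h'
    · exact Or.inl ⟨j, hjI, h'.eq g hr hW h0 hi⟩
    · exact Or.inr ⟨j, hjI, h'.eq g hr hW h0 hi'⟩
  -- With both sides in the union, `q` would be interior. Equality of pieces is used instead of
  -- membership of indices because a periodic chain repeats its pieces.
  have hand : ¬ ((∃ j ∈ I, L j = L i) ∧ ∃ j ∈ I, L j = L (i - 1)) := by
    rintro ⟨⟨a, ha, haL⟩, ⟨b, hb, hbL⟩⟩
    refine hint ?_
    filter_upwards [h.eventually_sides g hr hW h0 hi] with z hz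
    rcases hz with hz | hz | hz
    · exact hsub a ha z (subset_leafClosure (haL ▸ hz.2))
    · exact hsub b hb z (subset_leafClosure (hbL ▸ hz.2))
    · exact hsub a ha z (haL ▸ hz.2.mem_leafClosure)
  by_cases ha : ∃ j ∈ I, L j = L i
  · exact Or.inl ⟨ha, fun hb => hand ⟨ha, hb⟩⟩
  · exact Or.inr ⟨ha, hor.resolve_left ha⟩

lemma leafBoundary_subset [CompactSpace S] [T2Space S] :
    𝒮.leafBoundary (⋃ j ∈ I, 𝒮.leafClosure (L j)) ⊆ W := fun _ hq =>
  hW.mem_of_eq_zero (h.side_of_mem_leafBoundary g hr hW I hq).1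

/-- Compactness is that of the closed pieces. At a boundary point exactly one side belongs to the
union, so the defining function is the lift of `π` or its opposite. -/
theorem isCompactDomain [CompactSpace S] [T2Space S] :
    𝒮.IsCompactDomain (⋃ j ∈ I, 𝒮.leafClosure (L j)) := by
  constructor
  · obtain ⟨D, M, -, hDM⟩ := exists_piece_bounds g hr hW
    exact Finset.isCompact_biUnion (X := 𝒮.Lf) I fun j _ => (hDM _ (h.isPiece j) _ _ (h.hasEnds j)).1
  · intro q hq
    obtain ⟨h0, i, hi, hi', hor⟩ := h.side_of_mem_leafBoundary g hr hW I hq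
    obtain ⟨φ, f, V, Y, B, hqs, hqV, hqY, hf0, hdf, -⟩ :=
      exists_isRegularBox hr g hW.pos (hW.regular q h0) (univ_mem : univ ∈ 𝓝 q)
    have hyK := φ.ver_mem hqs
    have hneg := fun u (hu : u ∈ V) => B.mem_of_isNegSide hr hW hqs hqV hqY h0 hi hu
    have hpos := fun u (hu : u ∈ V) => B.mem_of_isPosSide hr hW hqs hqV hqY h0 hi' hu
    have hnz : ∀ u ∈ V, f (u, φ.ver q) ≠ 0 → π (φ.param (φ.ver q) u) ≠ 0 := by
      intro u hu hf
      rwa [ne_eq, B.eq_zero_iff hW.lt_half hu hqY hyK]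
    have hmem : ∀ u ∈ V, ∀ i, f (u, φ.ver q) ≠ 0 → φ.param (φ.ver q) u ∈ L i →
        φ.param (φ.ver q) u ∈ ⋃ j ∈ I, 𝒮.leafClosure (L j) → ∃ j ∈ I, L j = L i := by
      intro u hu i hf hui hU
      obtain ⟨j, hjI, hj⟩ := mem_iUnion₂.1 hU
      have := (h.isPiece j).mem_of_mem_leafClosure hW.continuous hj (hnz u hu hf)
      exact ⟨j, hjI, (h.isPiece j).eq_of_mem (h.isPiece i) this hui⟩
    have hsub : ∀ j ∈ I, ∀ z ∈ 𝒮.leafClosure (L j), z ∈ ⋃ j ∈ I, 𝒮.leafClosure (L j) :=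
      fun j hj z hz => mem_iUnion₂.2 ⟨j, hj, hz⟩
    rcases hor with ⟨⟨a, ha, haL⟩, hb⟩ | ⟨ha, ⟨b, hb, hbL⟩⟩
    · refine ⟨φ, B.mem_atlas, hqs, V, fun u => f (u, φ.ver q), B.isOpen_V, B.V_sub, hqV,
        B.contDiffOn _ hqY, hdf, fun u hu => ⟨fun hU => ?_, fun hle => ?_⟩⟩
      · by_contra! hlt
        exact hb (hmem u hu (i - 1) hlt.ne' ((hpos u hu).1 hlt) hU)
      · refine hsub a ha _ ?_
        rw [haL]
        rcases hle.lt_or_eq with hlt | heq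
        · exact subset_leafClosure ((hneg u hu).1 hlt)
        · exact (hneg u hu).2 heq
    · refine ⟨φ, B.mem_atlas, hqs, V, fun u => -f (u, φ.ver q), B.isOpen_V, B.V_sub, hqV,
        (B.contDiffOn _ hqY).neg, ?_, fun u hu => ⟨fun hU => ?_, fun hle => ?_⟩⟩
      · rw [fderiv_fun_neg, neg_ne_zero]
        exact hdf
      · by_contra! hlt
        have hlt' := neg_pos.1 hlt
        exact ha (hmem u hu i hlt'.ne ((hneg u hu).1 hlt') hU)
      · refine hsub b hb _ ?_
        rw [hbL]
        rcases (neg_nonpos.1 hle).lt_or_eq with hlt | heq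
        · exact subset_leafClosure ((hpos u hu).1 hlt)
        · exact (hpos u hu).2 heq.symm

/-- A zero adherent to `L j` separates it from `L (j - 1)` or `L (j + 1)`, so the two neighbouring
pieces are needed to fill a neighbourhood. -/
lemma mem_leafInterior (hq : q ∈ 𝒮.leafClosure (L j)) (h1 : j - 1 ∈ I) (h2 : j ∈ I)
    (h3 : j + 1 ∈ I) : q ∈ 𝒮.leafInterior (⋃ j ∈ I, 𝒮.leafClosure (L j)) := by
  have hsub : ∀ j ∈ I, ∀ z ∈ 𝒮.leafClosure (L j), z ∈ ⋃ j ∈ I, 𝒮.leafClosure (L j) :=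
    fun j hj z hz => mem_iUnion₂.2 ⟨j, hj, hz⟩
  refine (mem_interior_iff_mem_nhds (X := 𝒮.Lf)).2 ?_
  change ∀ᶠ z in 𝒮.nhdsL q, z ∈ ⋃ j ∈ I, 𝒮.leafClosure (L j)
  by_cases h0 : π q = 0
  · rcases (h.isPiece j).side_of_mem_leafClosure g hr hW h0 hq with h' | h'
    · filter_upwards [h.eventually_sides g hr hW h0 h'] with z hz
      rcases hz with hz | hz | hz
      · exact hsub j h2 z (subset_leafClosure hz.2)
      · exact hsub _ h1 z (subset_leafClosure hz.2)
      · exact hsub j h2 z hz.2.mem_leafClosure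
    · have h'' := (h.isNegSide_iff g hr hW (j := j + 1) h0).2 (by simpa using h')
      filter_upwards [h.eventually_sides g hr hW h0 h''] with z hz
      rw [add_sub_cancel_right] at hz
      rcases hz with hz | hz | hz
      · exact hsub _ h3 z (subset_leafClosure hz.2)
      · exact hsub j h2 z (subset_leafClosure hz.2)
      · exact hsub _ h3 z hz.2.mem_leafClosure
  · have hqL := (h.isPiece j).mem_of_mem_leafClosure hW.continuous hq h0
    have h1 : L j ∈ 𝒮.nhdsL q := ((h.isPiece j).isOpen hW.continuous).mem_nhds hqL
    exact mem_of_superset h1 fun (z : S) hz => hsub j h2 z (subset_leafClosure hz)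

end IsChain

end Trapping

end Solenoid
end
noncomputable section

/-! ### Riemann exhaustions and chains -/

namespace Solenoid

variable {k l : ℕ} {r s : WithTop ℕ∞} {S : Type*} [TopologicalSpace S]
variable {𝒮 : Solenoid k l r s S} {p q z w : S} {π : S → UnitAddCircle} {ε₀ : ℝ}
  {W T : Set S} {x : ℤ → S} {L : ℤ → Set S} {i j : ℤ} {g : 𝒮.Metric}

lemma Metric.closedBall_subset_leaf {R : ℝ} : g.closedBall p R ⊆ 𝒮.leaf p := fun _ hz =>
  g.mem_leaf_of_leafDist_lt_top (lt_of_le_of_lt hz ENNReal.ofReal_lt_top)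

/-- If a function with bounded gradient takes a large value in a ball, then its smaller values are
taken well inside the ball. -/
lemma Metric.IsLip.exists_leafDist_le {C R E c : ℝ} {F : S → ℝ} (h : g.IsLip p C F) (hr : 1 ≤ r)
    (hC : 0 < C) (hE : 0 ≤ E) (hR : 0 ≤ R) (hw : w ∈ g.closedBall p R) (hp : F p ≤ c)
    (hc : c + C * (1 + E) ≤ F w) :
    ∃ m ∈ 𝒮.leaf p, F m = c ∧ ∀ z, g.leafDist m z ≤ ENNReal.ofReal E → z ∈ g.closedBall p R := by
  -- The infimum defining the distance need not be attained: a path of length less than `R + 1` is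
  -- used, and the extra `1` is recovered from the `1 + E` in `hc`.
  have hlt : g.leafDist p w < ENNReal.ofReal (R + 1) :=
    lt_of_le_of_lt hw ((ENNReal.ofReal_lt_ofReal_iff (by linarith)).2 (by linarith))
  obtain ⟨Λ, hΛ, hΛR⟩ := g.exists_pathLength_lt hlt
  obtain ⟨m, Λ₁, Λ₂, hm, hΛ₁, hle, h2⟩ := h.exists_split hC.le hr hΛ hp
    (le_trans (by nlinarith) hc)
  refine ⟨m, hΛ₁.mem_leaf, hm, fun z hz => ?_⟩
  have hC0 : ENNReal.ofReal C ≠ 0 := by simpa using hC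
  -- After the level `c` the path still has to climb by `C * (1 + E)`, so its remaining length is at
  -- least `1 + E`.
  have h3 : ENNReal.ofReal (1 + E) ≤ Λ₂ := by
    refine (ENNReal.mul_le_mul_iff_right hC0 ENNReal.ofReal_ne_top).1 (le_trans ?_ h2)
    rw [← ENNReal.ofReal_mul hC.le]
    exact ENNReal.ofReal_le_ofReal (by linarith)
  have h4 : Λ₁ + ENNReal.ofReal E + 1 ≤ ENNReal.ofReal R + 1 := by
    calc Λ₁ + ENNReal.ofReal E + 1 = Λ₁ + ENNReal.ofReal (1 + E) := by
          rw [ENNReal.ofReal_add zero_le_one hE, ENNReal.ofReal_one]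
          ring
      _ ≤ Λ₁ + Λ₂ := by gcongr
      _ ≤ ENNReal.ofReal (R + 1) := hle.trans hΛR.le
      _ = ENNReal.ofReal R + 1 := by rw [ENNReal.ofReal_add hR zero_le_one, ENNReal.ofReal_one]
  have h5 : Λ₁ + ENNReal.ofReal E ≤ ENNReal.ofReal R :=
    (ENNReal.add_le_add_iff_right ENNReal.one_ne_top).1 h4
  exact (g.leafDist_triangle p m z).trans ((add_le_add (g.leafDist_le hΛ₁) hz).trans h5)

namespace IsChain

section Dist

variable (h : 𝒮.IsChain π ε₀ T x L) {D : ℝ} (hdiam : ∀ L, 𝒮.IsPiece π L →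
  ∀ z ∈ 𝒮.leafClosure L, ∀ z' ∈ 𝒮.leafClosure L, g.symDist z z' ≤ ENNReal.ofReal D)
include h hdiam

/-- Closures of equal or consecutive pieces have a common point, and the two points are compared
through it. -/
lemma symDist_le_of_abs_sub_le (hD : 0 ≤ D) (hq : q ∈ 𝒮.leafClosure (L i))
    (hz : z ∈ 𝒮.leafClosure (L j)) (hij : |j - i| ≤ 1) :
    g.symDist q z ≤ ENNReal.ofReal (2 * D) := by
  have key : ∀ {y}, y ∈ 𝒮.leafClosure (L i) → y ∈ 𝒮.leafClosure (L j) →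
      g.symDist q z ≤ ENNReal.ofReal (2 * D) := by
    intro y hyi hyj
    rw [two_mul, ENNReal.ofReal_add hD hD]
    exact (g.symDist_triangle q y z).trans (add_le_add (hdiam _ (h.isPiece i) _ hq _ hyi)
      (hdiam _ (h.isPiece j) _ hyj _ hz))
  have hij' := abs_le.1 hij
  obtain rfl | rfl | rfl : j = i - 1 ∨ j = i ∨ j = i + 1 := by lia
  · exact key (h.isNegSide i).2.mem_leafClosure (h.isPosSide_pred i).mem_leafClosure
  · exact key hq hq
  · exact key (h.isPosSide i).mem_leafClosure (h.isNegSide (i + 1)).2.mem_leafClosure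

lemma exists_subset_closedBall (hq : q ∈ 𝒮.leafClosure (L i)) (j : ℤ) :
    ∃ R, 𝒮.leafClosure (L j) ⊆ g.closedBall q R := by
  have hstep : ∀ j, g.symDist (x j) (x (j + 1)) < ⊤ := fun j =>
    (hdiam _ (h.isPiece j) _ (h.isNegSide j).2.mem_leafClosure _
      (h.isPosSide j).mem_leafClosure).trans_lt ENNReal.ofReal_lt_top
  have hx : ∀ j, g.symDist q (x j) < ⊤ := by
    intro j
    induction j using Int.inductionOn' (b := i) with
    | zero => exact (hdiam _ (h.isPiece i) _ hq _
        (h.isNegSide i).2.mem_leafClosure).trans_lt ENNReal.ofReal_lt_top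
    | succ j _ ih =>
      exact (g.symDist_triangle q (x j) _).trans_lt (ENNReal.add_lt_top.2 ⟨ih, hstep j⟩)
    | pred j _ ih =>
      have h1 := hstep (j - 1)
      rw [g.symDist_comm, sub_add_cancel] at h1
      exact (g.symDist_triangle q (x j) _).trans_lt (ENNReal.add_lt_top.2 ⟨ih, h1⟩)
  refine ⟨(g.symDist q (x j) + ENNReal.ofReal D).toReal, fun z hz => ?_⟩
  have hfin : g.symDist q (x j) + ENNReal.ofReal D ≠ ⊤ :=
    ENNReal.add_ne_top.2 ⟨(hx j).ne, ENNReal.ofReal_ne_top⟩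
  change g.leafDist q z ≤ _
  rw [ENNReal.ofReal_toReal hfin]
  refine (g.leafDist_le_symDist q z).trans ((g.symDist_triangle q (x j) z).trans ?_)
  gcongr
  exact hdiam _ (h.isPiece j) _ (h.isNegSide j).2.mem_leafClosure _ hz

lemma eventually_subset_closedBall (hq : q ∈ 𝒮.leafClosure (L i)) {R : ℕ → ℝ}
    (hR : Tendsto R atTop atTop) (I : Finset ℤ) :
    ∀ᶠ n in atTop, ∀ j ∈ I, 𝒮.leafClosure (L j) ⊆ g.closedBall q (R n) := by
  rw [Filter.eventually_all_finset]
  intro j _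
  obtain ⟨R₀, hR₀⟩ := h.exists_subset_closedBall hdiam hq j
  filter_upwards [hR.eventually_ge_atTop R₀] with n hn z hz
  exact (hR₀ hz).trans (ENNReal.ofReal_le_ofReal hn)

end Dist

section Trapping

variable [CompactSpace S] [T2Space S] (g)
variable (hr : 1 ≤ r) (hW : 𝒮.IsTrappingRegion W π T ε₀) (h : 𝒮.IsChain π ε₀ T x L)
include hr hW h

/-- The ball eventually contains any given finite number of distinct pieces, each contributing a
definite volume. -/
lemma tendsto_vol (hL : L.Injective) (hq : q ∈ 𝒮.leafClosure (L i)) {R : ℕ → ℝ}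
    (hR : Tendsto R atTop atTop) :
    Tendsto (fun n => g.vol (g.closedBall q (R n))) atTop (𝓝 ⊤) := by
  obtain ⟨v, hv, hvol⟩ := exists_volume_lower g hr hW
  obtain ⟨D, -, hdiam⟩ := exists_piece_diam g hr hW
  rw [ENNReal.tendsto_nhds_top_iff_nnreal]
  intro y
  obtain ⟨N, hN⟩ := ENNReal.exists_nat_mul_gt hv (ENNReal.coe_ne_top (r := y))
  classical
  filter_upwards [h.eventually_subset_closedBall hdiam hq hR
    ((Finset.range N).image fun n : ℕ => (n : ℤ))] with n hn
  refine hN.trans_le ?_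
  have h1 := hvol ((Finset.range N).image fun n : ℕ => L n) (g.closedBall q (R n)) ?_
  · rwa [Finset.card_image_of_injective _ fun a b hab => Nat.cast_injective (R := ℤ) (hL hab),
      Finset.card_range] at h1
  · intro M hM
    obtain ⟨a, ha, rfl⟩ := Finset.mem_image.1 hM
    exact ⟨h.isPiece a, subset_leafClosure.trans (hn a (Finset.mem_image_of_mem _ ha))⟩

/-- The case of a leaf that is the union of finitely many closed pieces. -/
lemma exists_exhaustion_of_periodic {m : ℤ} (hm : 0 < m) (hper : ∀ i, L (i + m) = L i)
    (hq : q ∈ 𝒮.leafClosure (L i)) (hleaf : 𝒮.leaf q = ⋃ j, 𝒮.leafClosure (L j)) {R : ℕ → ℝ}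
    (hR : Tendsto R atTop atTop) :
    𝒮.leaf q = ⋃ j ∈ Finset.Ico 0 m, 𝒮.leafClosure (L j) ∧
      𝒮.IsExhaustion (𝒮.leaf q) (fun _ => 𝒮.leaf q) ∧
      g.EquivalentExhaustions (fun n => g.closedBall q (R n)) fun _ => 𝒮.leaf q := by
  obtain ⟨D, -, hdiam⟩ := exists_piece_diam g hr hW
  -- One period gives the whole leaf, which is thus contained in all large balls; the difference of
  -- the two sequences is then eventually empty.
  have hmod : ∀ j, L (j % m) = L j := by
    have hmul : ∀ (n : ℤ) (i : ℤ), L (i + n * m) = L i := by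
      intro n i
      induction n using Int.induction_on with
      | zero => simp
      | succ n ih => rw [add_mul, one_mul, ← add_assoc, hper, ih]
      | pred n ih => rw [← hper, ← ih]; congr 1; ring
    intro j
    rw [← hmul (j / m) (j % m), Int.emod_add_ediv_mul]
  have heq : 𝒮.leaf q = ⋃ j ∈ Finset.Ico 0 m, 𝒮.leafClosure (L j) := by
    rw [hleaf]
    refine Subset.antisymm (iUnion_subset fun j => ?_) (iUnion₂_subset fun j _ => subset_iUnion
      (fun j => 𝒮.leafClosure (L j)) j)
    rw [← hmod j]
    exact subset_biUnion_of_mem (u := fun j => 𝒮.leafClosure (L j)) (Finset.mem_coe.2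
      (Finset.mem_Ico.2 ⟨Int.emod_nonneg _ hm.ne', Int.emod_lt_of_pos _ hm⟩))
  refine ⟨heq, ⟨fun n => ⟨Subset.rfl, ?_⟩, monotone_const, fun z hz => ?_⟩, ?_⟩
  · rw [heq]
    exact h.isCompactDomain g hr hW _
  · refine mem_iUnion.2 ⟨0, ?_⟩
    have hop : IsOpen (X := 𝒮.Lf) (𝒮.leaf q) := by
      rw [hleaf]
      exact (h.isClopen g hr hW).isOpen
    exact (mem_interior_iff_mem_nhds (X := 𝒮.Lf)).2 (hop.mem_nhds hz)
  · refine tendsto_const_nhds.congr' ?_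
    filter_upwards [h.eventually_subset_closedBall hdiam hq hR (Finset.Ico 0 m)] with n hn
    have hball : g.closedBall q (R n) = 𝒮.leaf q := by
      refine Subset.antisymm g.closedBall_subset_leaf ?_
      rw [heq]
      exact iUnion₂_subset hn
    simp [hball]

/-- The case of a leaf that is an infinite chain of closed pieces. -/
lemma exists_exhaustion_of_injective (hL : L.Injective)
    (hq : q ∈ 𝒮.leafClosure (L i)) (hleaf : 𝒮.leaf q = ⋃ j, 𝒮.leafClosure (L j)) {R : ℕ → ℝ}
    (hR0 : ∀ n, 0 ≤ R n) (hR : Tendsto R atTop atTop)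
    (hmono : Monotone fun n => g.closedBall q (R n)) :
    ∃ (a b : ℕ → ℤ), (∀ n, a n < b n) ∧
      𝒮.IsExhaustion (𝒮.leaf q)
        (fun n => ⋃ j ∈ Finset.Ico (a n) (b n), 𝒮.leafClosure (L j)) ∧
      g.EquivalentExhaustions (fun n => g.closedBall q (R n))
        fun n => ⋃ j ∈ Finset.Ico (a n) (b n), 𝒮.leafClosure (L j) := by
  obtain ⟨D, hD, hdiam⟩ := exists_piece_diam g hr hW
  obtain ⟨_, M, hM, hvolM⟩ := exists_piece_bounds g hr hW
  obtain ⟨C', H, hC', hlip', hH⟩ := h.exists_height g hr hW hL hleaf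
  -- The Lipschitz constant is made positive so that inequalities can be divided by it.
  set C := C' + 1 with hCdef
  have hC : 0 < C := by positivity
  have hlip : g.IsLip q C H := fun γ hγ h0 t ht => by
    obtain ⟨u, hu, hle⟩ := hlip' γ hγ h0 t ht
    exact ⟨u, hu, hle.trans (mul_le_mul_of_nonneg_right (by linarith) (g.spd_nonneg γ t))⟩
  have hqball : ∀ n, q ∈ g.closedBall q (R n) := fun n =>
    (g.leafDist_le (Metric.PathLength.refl q)).trans (zero_le)
  have hHq := abs_le.1 (hH i q hq)
  set J : ℕ → Set ℤ := fun n => {j | (𝒮.leafClosure (L j) ∩ g.closedBall q (R n)).Nonempty}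
    with hJ
  have hiJ : ∀ n, i ∈ J n := fun n => ⟨q, hq, hqball n⟩
  -- The height is bounded on a ball, and it differs by at most `1` from the index of any closed
  -- piece containing the point.
  have hJfin : ∀ n, (J n).Finite := by
    intro n
    set b := |H q| + C * (R n + 1) + 1 with hb
    refine (Set.finite_Icc (-⌈b⌉) ⌈b⌉).subset ?_
    rintro j ⟨w, hwj, hw⟩
    have hlt : g.leafDist q w < ENNReal.ofReal (R n + 1) := lt_of_le_of_lt hw
      ((ENNReal.ofReal_lt_ofReal_iff (by linarith [hR0 n])).2 (by linarith))
    obtain ⟨Λ, hΛ, hΛR⟩ := g.exists_pathLength_lt hlt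
    have hbd : ∀ F : S → ℝ, g.IsLip q C F → F w - F q ≤ C * (R n + 1) := by
      intro F hF
      have h1 := (hF.sub_le_length hC.le hr hΛ).trans (mul_le_mul_right hΛR.le _)
      rw [← ENNReal.ofReal_mul hC.le] at h1
      exact (ENNReal.ofReal_le_ofReal_iff (mul_nonneg hC.le (by linarith [hR0 n]))).1 h1
    have h1 := hbd H hlip
    have h2 := hbd _ hlip.neg
    have h3 := abs_le.1 (hH j w hwj)
    have h4 := neg_abs_le (H q)
    have h5 := le_abs_self (H q)
    have h6 := Int.le_ceil b
    constructor
    · have : (-⌈b⌉ : ℝ) ≤ j := by linarith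
      exact_mod_cast this
    · have : (j : ℝ) ≤ ⌈b⌉ := by linarith
      exact_mod_cast this
  choose a haJ ha using fun n => Set.exists_min_image (J n) id (hJfin n) ⟨i, hiJ n⟩
  choose b hbJ hb using fun n => Set.exists_max_image (J n) id (hJfin n) ⟨i, hiJ n⟩
  simp only [id_eq] at ha hb
  have hJmono : ∀ {m n}, m ≤ n → J m ⊆ J n := fun hmn j ⟨w, hw, hw'⟩ => ⟨w, hw, hmono hmn hw'⟩
  have hmemU : ∀ n, ∀ j ∈ J n, j ∈ Finset.Ico (a n) (b n + 1) := fun n j hj =>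
    Finset.mem_Ico.2 ⟨ha n j hj, Int.lt_add_one_iff.2 (hb n j hj)⟩
  have hsub : ∀ n, g.closedBall q (R n) ⊆
      ⋃ j ∈ Finset.Ico (a n) (b n + 1), 𝒮.leafClosure (L j) := by
    intro n z hz
    have hz' := g.closedBall_subset_leaf hz
    rw [hleaf] at hz'
    obtain ⟨j, hj⟩ := mem_iUnion.1 hz'
    exact mem_iUnion₂.2 ⟨j, hmemU n j ⟨z, hj, hz⟩, hj⟩
  have hJev : ∀ j, ∀ᶠ n in atTop, j ∈ J n := by
    intro j
    filter_upwards [h.eventually_subset_closedBall hdiam hq hR {j}] with n hn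
    have hx : x j ∈ 𝒮.leafClosure (L j) := (h.isNegSide j).2.mem_leafClosure
    exact ⟨x j, hx, hn j (by simp) hx⟩
  refine ⟨a, fun n => b n + 1, fun n => Int.lt_add_one_iff.2 (ha n _ (hbJ n)),
    ⟨fun n => ⟨?_, h.isCompactDomain g hr hW _⟩, fun m n hmn => ?_, fun z hz => ?_⟩, ?_⟩
  · rw [hleaf]
    exact iUnion₂_subset fun j _ => subset_iUnion (fun j => 𝒮.leafClosure (L j)) j
  · refine biUnion_subset_biUnion_left (t := fun j => 𝒮.leafClosure (L j)) fun j hj => ?_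
    obtain ⟨h1, h2⟩ := Finset.mem_Ico.1 hj
    have h3 := ha n _ (hJmono hmn (haJ m))
    have h4 := hb n _ (hJmono hmn (hbJ m))
    exact Finset.mem_Ico.2 ⟨by lia, by lia⟩
  · rw [hleaf] at hz
    obtain ⟨j, hj⟩ := mem_iUnion.1 hz
    obtain ⟨n, h1, h2, h3⟩ := ((hJev (j - 1)).and ((hJev j).and (hJev (j + 1)))).exists
    exact mem_iUnion.2 ⟨n, h.mem_leafInterior g hr hW _ hj (hmemU n _ h1) (hmemU n _ h2)
      (hmemU n _ h3)⟩
  -- The term `C * (1 + 2 * D)` is the climb required by `exists_leafDist_le` with `E = 2 * D`; the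
  -- `1` is the discrepancy between the height and the index at the extreme piece.
  · obtain ⟨K, hK⟩ := exists_nat_ge (C * (1 + 2 * D) + 1)
    have hsdiff : ∀ᶠ n in atTop,
        (⋃ j ∈ Finset.Ico (a n) (b n + 1), 𝒮.leafClosure (L j)) \ g.closedBall q (R n) ⊆
        ⋃ j ∈ Finset.Ico (a n) (a n + K) ∪ Finset.Ico (b n + 1 - K) (b n + 1),
          𝒮.leafClosure (L j) := by
      filter_upwards [h.eventually_subset_closedBall hdiam hq hR {i}] with n hn z hz
      obtain ⟨j, hjI, hj⟩ := mem_iUnion₂.1 hz.1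
      obtain ⟨hja, hjb⟩ := Finset.mem_Ico.1 hjI
      refine mem_iUnion₂.2 ⟨j, ?_, hj⟩
      by_contra hjK
      simp only [Finset.mem_union, Finset.mem_Ico, not_or, not_and, not_lt] at hjK
      have hj1 : a n + K ≤ j := hjK.1 hja
      have hj2 : j < b n + 1 - K := by
        by_contra! hlt
        exact absurd (hjK.2 hlt) (not_le.2 hjb)
      have hj1' : (a n + K : ℝ) ≤ j := by exact_mod_cast hj1
      have hj2' : (j + K : ℝ) ≤ b n := by
        have : j + K ≤ b n := by lia
        exact_mod_cast this
      refine hz.2 ?_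
      -- A point of height `j` is in `L j` or a neighbouring closed piece, hence within `2 * D` of
      -- any point of the closure of `L j`.
      have hnear : ∀ m ∈ 𝒮.leaf q, H m = j → g.leafDist m z ≤ ENNReal.ofReal (2 * D) := by
        intro m hm hmj
        rw [hleaf] at hm
        obtain ⟨j', hj'⟩ := mem_iUnion.1 hm
        refine (g.leafDist_le_symDist m z).trans
          (h.symDist_le_of_abs_sub_le hdiam hD hj' hj ?_)
        have := hH j' m hj'
        rw [hmj] at this
        exact_mod_cast this
      -- Below the central index the path goes to the lowest piece met by the ball and `-H` is used;
      -- above it, the path goes to the highest piece with `H`. The central piece is eventually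
      -- inside the ball.
      rcases lt_trichotomy j i with hlt | rfl | hlt
      · obtain ⟨w, hwa, hw⟩ := haJ n
        have hHw := abs_le.1 (hH _ w hwa)
        have hlt' : (j + 1 : ℝ) ≤ i := by exact_mod_cast hlt
        obtain ⟨m, hm, hmj, hmz⟩ := hlip.neg.exists_leafDist_le hr hC (E := 2 * D) (by positivity)
          (hR0 n) hw (c := -j) (by linarith) (by linarith)
        exact hmz z (hnear m hm (neg_injective hmj))
      · exact hn j (by simp) hj
      · obtain ⟨w, hwb, hw⟩ := hbJ n
        have hHw := abs_le.1 (hH _ w hwb)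
        have hlt' : (i + 1 : ℝ) ≤ j := by exact_mod_cast hlt
        obtain ⟨m, hm, hmj, hmz⟩ := hlip.exists_leafDist_le hr hC (E := 2 * D) (by positivity)
          (hR0 n) hw (c := j) (by linarith) (by linarith)
        exact hmz z (hnear m hm hmj)
    have hvol : ∀ᶠ n in atTop, (g.vol (g.closedBall q (R n) \
          ⋃ j ∈ Finset.Ico (a n) (b n + 1), 𝒮.leafClosure (L j)) +
        g.vol ((⋃ j ∈ Finset.Ico (a n) (b n + 1), 𝒮.leafClosure (L j)) \
          g.closedBall q (R n))) / g.vol (g.closedBall q (R n)) ≤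
        ((2 * K : ℕ) * M) / g.vol (g.closedBall q (R n)) := by
      filter_upwards [hsdiff] with n hn
      refine ENNReal.div_le_div_right ?_ _
      rw [sdiff_eq_empty.2 (hsub n), measure_empty, zero_add]
      refine (measure_mono hn).trans ((measure_biUnion_finset_le _ _).trans ?_)
      -- At most `K` pieces at each extremity are not contained in the ball, so the excess volume is
      -- at most `2 * K * M`, independently of `n`.
      refine (Finset.sum_le_card_nsmul _ _ M fun j _ =>
        (hvolM _ (h.isPiece j) _ _ (h.hasEnds j)).2.1).trans ?_
      rw [nsmul_eq_mul]
      gcongr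
      refine (Finset.card_union_le _ _).trans ?_
      simp only [Int.card_Ico]
      lia
    refine tendsto_of_tendsto_of_tendsto_of_le_of_le' tendsto_const_nhds ?_
      (Eventually.of_forall fun _ => zero_le) hvol
    have := ENNReal.Tendsto.const_div (a := ((2 * K : ℕ) : ℝ≥0∞) * M)
      (h.tendsto_vol g hr hW hL hq hR)
      (Or.inr (ENNReal.mul_ne_top (ENNReal.natCast_ne_top _) hM))
    rwa [ENNReal.div_top] at this

end Trapping

end IsChain

end Solenoid
end

theorem mainTheorem6 {S : Type*} [TopologicalSpace S] [CompactSpace S] [T2Space S]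
    {k l : ℕ} {r s : WithTop ℕ∞} (hr : 1 ≤ r)
    (𝒮 : Solenoid k l r s S) (g : 𝒮.Metric)
    (W : Set S) (π : S → UnitAddCircle) (T : Set S) (ε₀ : ℝ)
    (hW : 𝒮.IsTrappingRegion W π T ε₀) :
    g.IsControlledBy W ∧
    ∀ (p : S) (U : ℕ → Set S), g.IsRiemannExhaustion (𝒮.leaf p) U →
      ∃ (x : ℤ → S) (L : ℤ → Set S) (a b : ℕ → ℤ) (U' : ℕ → Set S),
        (∀ j, 𝒮.IsPiece π (L j) ∧ 𝒮.HasEnds π T ε₀ (L j) (x j) (x (j + 1))) ∧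
        𝒮.leaf p = ⋃ j, 𝒮.leafClosure (L j) ∧
        (∀ n, a n < b n ∧ U' n = ⋃ j ∈ Finset.Ico (a n) (b n), 𝒮.leafClosure (L j)) ∧
        𝒮.IsExhaustion (𝒮.leaf p) U' ∧
        g.EquivalentExhaustions U U' ∧
        ∀ n, 𝒮.leafBoundary (U' n) ⊆ W := by
  suffices hmain : ∀ (p : S) (U : ℕ → Set S), g.IsRiemannExhaustion (𝒮.leaf p) U →
      ∃ (x : ℤ → S) (L : ℤ → Set S) (a b : ℕ → ℤ) (U' : ℕ → Set S),
        (∀ j, 𝒮.IsPiece π (L j) ∧ 𝒮.HasEnds π T ε₀ (L j) (x j) (x (j + 1))) ∧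
        𝒮.leaf p = ⋃ j, 𝒮.leafClosure (L j) ∧
        (∀ n, a n < b n ∧ U' n = ⋃ j ∈ Finset.Ico (a n) (b n), 𝒮.leafClosure (L j)) ∧
        𝒮.IsExhaustion (𝒮.leaf p) U' ∧
        g.EquivalentExhaustions U U' ∧
        ∀ n, 𝒮.leafBoundary (U' n) ⊆ W by
    refine ⟨⟨hW.isOpen, fun p U hU => ?_⟩, hmain⟩
    obtain ⟨-, -, -, -, U', -, -, -, h1, h2, h3⟩ := hmain p U hU
    exact ⟨U', h1, h2, h3⟩
  rintro p U ⟨hmono, q, hq, R, hR0, hR, hU⟩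
  obtain rfl : U = fun n => g.closedBall q (R n) := funext hU
  obtain ⟨x, L, h, hleaf, hL⟩ := Solenoid.exists_isChain g hr hW p
  obtain ⟨i, hi⟩ := mem_iUnion.1 (hleaf ▸ hq)
  -- The leaf is based at the centre `q` of the balls.
  have hpq : 𝒮.leaf p = 𝒮.leaf q := connectedComponent_eq (α := 𝒮.Lf) hq
  rw [hpq] at hleaf ⊢
  rcases hL with hinj | ⟨m, hm, hper⟩
  · obtain ⟨a, b, hab, h1, h2⟩ :=
      h.exists_exhaustion_of_injective g hr hW hinj hi hleaf hR0 hR hmono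
    exact ⟨x, L, a, b, _, fun j => ⟨h.isPiece j, h.hasEnds j⟩, hleaf, fun n => ⟨hab n, rfl⟩,
      h1, h2, fun n => h.leafBoundary_subset g hr hW _⟩
  · obtain ⟨h0, h1, h2⟩ := h.exists_exhaustion_of_periodic g hr hW hm hper hi hleaf hR
    refine ⟨x, L, fun _ => 0, fun _ => m, _, fun j => ⟨h.isPiece j, h.hasEnds j⟩, hleaf,
      fun n => ⟨hm, h0⟩, h1, h2, fun n => ?_⟩
    rw [h0]
    exact h.leafBoundary_subset g hr hW _
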